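/- Let $g\ge 1$. Let $A_g$ be the set of real symmetric positive definite $g\times g$ matrices with integer diagonal entries and off-diagonal entries in $\frac12\mathbf{Z}$, let $\mathbf{H}_g$ be the set of complex symmetric $g\times g$ matrices with positive definite imaginary part, let $\Gamma_g=\mathrm{Sp}(2g,\mathbf{Z})$ act on $\mathbf{H}_g$ by $\gamma\cdot z=(az+b)(cz+d)^{-1}$ for $\gamma=\begin{pmatrix}a&b\\c&d\end{pmatrix}$, and let $$\Gamma_\infty=\Bigl\{\pm\begin{pmatrix}1&S\\0&1\end{pmatrix}: S\in M(g,\mathbf{Z}),\ {}^tS=S\Bigr\}.$$ Write $e(w)=e^{2\pi i w}$. For $s\in A_g$ and even $k$ let $$\mathcal{P}_{s,k}(z)=\sum_{\gamma\in\Gamma_\infty\backslash\Gamma_g}\det(cz+d)^{-k}\,e(\mathrm{Tr}(s\,(\gamma\cdot z))),\qquad z\in\mathbf{H}_g,$$ and for $t\in A_g$ let $$p_{s,k}(t)=\int \mathcal{P}_{s,k}(x+i\,\mathrm{Id})\,e(-\mathrm{Tr}(t(x+i\,\mathrm{Id})))\,dx$$ be its $t$-th Fourier coefficient, where $x$ runs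 over the real symmetric $g\times g$ matrices with $|x_{ij}|\le 1/2$ for all $i,j$, and $dx$ is Lebesgue measure in the coordinates $x_{ij}$, $i\le j$. Fix $s\in A_g$. 1. For all sufficiently large even $k$ and all $z\in\mathbf{H}_g$, the series defining $\mathcal{P}_{s,k}(z)$ converges absolutely, and $\mathcal{P}_{s,k}(z)=\sum_{t\in A_g}p_{s,k}(t)\,e(\mathrm{Tr}(tz))$, with absolute convergence. 2. The group $\mathrm{Aut}(s)=\{a\in \mathrm{GL}(g,\mathbf{Z}) : {}^ta\,s\,a=s\}$ is finite, and for every $t\in A_g$, as $k\to+\infty$ over even integers, $$\lim_{k\to+\infty}p_{s,k}(t)=\begin{cases}|\mathrm{Aut}(s)|/2 & \text{if } t={}^ta\,s\,a\text{ for some }a\in\mathrm{GL}(g,\mathbf{Z}),\\ 0&\text{otherwise.}\end{cases}$$ -/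

import Mathlib

open Matrix Filter Topology MeasureTheory

namespace SiegelPoincare

/-- Half-integral symmetric positive definite matrices: integers on the diagonal,
elements of `(1/2)ℤ` off the diagonal. (`Matrix.PosDef` over `ℝ` includes symmetry.) -/
def HalfIntPosDef (g : ℕ) : Type :=
  {s : Matrix (Fin g) (Fin g) ℝ //
    s.PosDef ∧ (∀ i, ∃ n : ℤ, s i i = n) ∧ ∀ i j, ∃ n : ℤ, 2 * s i j = n}

/-- The Siegel upper half-space: complex symmetric matrices with positive definite
imaginary part. -/
def siegelUpperHalfSpace (g : ℕ) : Set (Matrix (Fin g) (Fin g) ℂ) :=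
  {z | z.IsSymm ∧ (z.map Complex.im).PosDef}

/-- `e(w) = exp(2πiw)`. -/
noncomputable def e (w : ℂ) : ℂ := Complex.exp (2 * Real.pi * Complex.I * w)

/-- The Siegel modular group `Sp(2g, ℤ)`. -/
abbrev Gam (g : ℕ) : Type := symplecticGroup (Fin g) ℤ

section Blocks

variable {g : ℕ}

/-- The four `g × g` blocks of `γ`, viewed over `ℂ`. -/
def blockA (γ : Gam g) : Matrix (Fin g) (Fin g) ℂ := γ.1.toBlocks₁₁.map (Int.cast : ℤ → ℂ)

def blockB (γ : Gam g) : Matrix (Fin g) (Fin g) ℂ := γ.1.toBlocks₁₂.map (Int.cast : ℤ → ℂ)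

def blockC (γ : Gam g) : Matrix (Fin g) (Fin g) ℂ := γ.1.toBlocks₂₁.map (Int.cast : ℤ → ℂ)

def blockD (γ : Gam g) : Matrix (Fin g) (Fin g) ℂ := γ.1.toBlocks₂₂.map (Int.cast : ℤ → ℂ)

/-- `cz + d`. -/
noncomputable def denom (γ : Gam g) (z : Matrix (Fin g) (Fin g) ℂ) : Matrix (Fin g) (Fin g) ℂ :=
  blockC γ * z + blockD γ

/-- The action `γ · z = (az + b)(cz + d)⁻¹`. -/
noncomputable def act (γ : Gam g) (z : Matrix (Fin g) (Fin g) ℂ) : Matrix (Fin g) (Fin g) ℂ :=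
  (blockA γ * z + blockB γ) * (denom γ z)⁻¹

end Blocks

/-- The subgroup of the matrices `± (1 S; 0 1)` with `S` integral and symmetric. -/
def gamInfty (g : ℕ) : Subgroup (Gam g) where
  carrier := {γ | ∃ S : Matrix (Fin g) (Fin g) ℤ, S.IsSymm ∧
    (γ.1 = fromBlocks 1 S 0 1 ∨ γ.1 = -fromBlocks 1 S 0 1)}
  one_mem' := ⟨0, isSymm_zero, Or.inl (by simp)⟩
  mul_mem' := by
    rintro γ δ ⟨S, hS, h⟩ ⟨T, hT, h'⟩
    refine ⟨T + S, hT.add hS, ?_⟩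
    have hm : (fromBlocks 1 S 0 1 : Matrix (Fin g ⊕ Fin g) (Fin g ⊕ Fin g) ℤ)
        * fromBlocks 1 T 0 1 = fromBlocks 1 (T + S) 0 1 := by
      simp [fromBlocks_multiply]
    rcases h with h | h <;> rcases h' with h' | h' <;> simp [h, h', hm]
  inv_mem' := by
    rintro γ ⟨S, hS, h⟩
    refine ⟨-S, hS.neg, ?_⟩
    have hm : (fromBlocks 1 (-S) 0 1 : Matrix (Fin g ⊕ Fin g) (Fin g ⊕ Fin g) ℤ)
        * fromBlocks 1 S 0 1 = 1 := by
      simp [fromBlocks_multiply]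
    have hinv : ((γ⁻¹ : Gam g)).1 * γ.1 = 1 :=
      congrArg Subtype.val (inv_mul_cancel γ)
    rcases h with h | h
    · left
      have hm' := mul_eq_one_comm.mp hm
      calc ((γ⁻¹ : Gam g)).1 = (γ⁻¹ : Gam g).1 * (fromBlocks 1 S 0 1 * fromBlocks 1 (-S) 0 1) := by
            rw [hm', mul_one]
        _ = fromBlocks 1 (-S) 0 1 := by rw [← mul_assoc, ← h, hinv, one_mul]
    · right
      have hm' := mul_eq_one_comm.mp hm
      calc ((γ⁻¹ : Gam g)).1 = (γ⁻¹ : Gam g).1 * (fromBlocks 1 S 0 1 * fromBlocks 1 (-S) 0 1) := by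
            rw [hm', mul_one]
        _ = -((γ⁻¹ : Gam g).1 * (-fromBlocks 1 S 0 1) * fromBlocks 1 (-S) 0 1) := by
            simp [mul_assoc]
        _ = -fromBlocks 1 (-S) 0 1 := by rw [← h, hinv, one_mul]

/-- The set `Γ_∞ \ Γ_g` of the cosets `Γ_∞ γ`. -/
abbrev Cosets (g : ℕ) : Type := Quotient (QuotientGroup.rightRel (gamInfty g))

/-- `det(cz + d)^{-k} e(Tr(s (γ · z)))`. -/
noncomputable def summand {g : ℕ} (s : HalfIntPosDef g) (k : ℕ) (z : Matrix (Fin g) (Fin g) ℂ)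
    (γ : Gam g) : ℂ :=
  (denom γ z).det ^ (-(k : ℤ)) * e (trace (s.1.map Complex.ofReal * act γ z))

/-- The summand of a coset, evaluated at a representative. For even `k` and `z` in the Siegel upper
half-space it does not depend on the representative: passing from `γ` to `± (1 S; 0 1) γ` multiplies
`cz + d` by `± 1` and adds `S` to `γ · z`, and `Tr(sS)` is an integer. -/
noncomputable def cosetSummand {g : ℕ} (s : HalfIntPosDef g) (k : ℕ)
    (z : Matrix (Fin g) (Fin g) ℂ) (q : Cosets g) : ℂ :=
  summand s k z q.out

/-- The Siegel Poincaré series. -/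
noncomputable def poincareSeries {g : ℕ} (s : HalfIntPosDef g) (k : ℕ)
    (z : Matrix (Fin g) (Fin g) ℂ) : ℂ :=
  ∑' q : Cosets g, cosetSummand s k z q

/-- The point `x + i·Id`, where `x` is the real symmetric matrix with coordinates
`x i j = u s(i, j)`, one for each unordered pair `{i, j}`. -/
noncomputable def pointAt {g : ℕ} (u : Sym2 (Fin g) → ℝ) : Matrix (Fin g) (Fin g) ℂ :=
  Matrix.of (fun i j => (u s(i, j) : ℂ)) + Complex.I • (1 : Matrix (Fin g) (Fin g) ℂ)

/-- The `t`-th Fourier coefficient `∫ F(z) e(-Tr(tz)) dx`, `z = x + i·Id`, over the real symmetric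
matrices `x` with `|x i j| ≤ 1/2`, for Lebesgue measure in the coordinates `x i j`, `i ≤ j`. -/
noncomputable def fourierCoeff {g : ℕ} (F : Matrix (Fin g) (Fin g) ℂ → ℂ) (t : HalfIntPosDef g) :
    ℂ :=
  ∫ u in Set.Icc (fun _ : Sym2 (Fin g) => (-1 / 2 : ℝ)) (fun _ => 1 / 2),
    F (pointAt u) * e (-trace (t.1.map Complex.ofReal * pointAt u))

/-- The Fourier coefficient `p_{s,k}(t)` of the Poincaré series. -/
noncomputable def poincareCoeff {g : ℕ} (s : HalfIntPosDef g) (k : ℕ) (t : HalfIntPosDef g) : ℂ :=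
  fourierCoeff (poincareSeries s k) t

/-- `a · s = ᵗa s a` for `a` in `GL(g, ℤ)`. -/
noncomputable def transform {g : ℕ} (a : GL (Fin g) ℤ) (s : Matrix (Fin g) (Fin g) ℝ) :
    Matrix (Fin g) (Fin g) ℝ :=
  (a.1.map (Int.cast : ℤ → ℝ))ᵀ * s * a.1.map (Int.cast : ℤ → ℝ)

/-- `GL(g, ℤ)`-equivalence. -/
def Equivalent {g : ℕ} (s t : HalfIntPosDef g) : Prop :=
  ∃ a : GL (Fin g) ℤ, transform a s.1 = t.1

theorem transform_one {g : ℕ} (s : Matrix (Fin g) (Fin g) ℝ) : transform 1 s = s := by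
  simp [transform, Matrix.map_one]

theorem transform_mul {g : ℕ} (a b : GL (Fin g) ℤ) (s : Matrix (Fin g) (Fin g) ℝ) :
    transform (a * b) s = transform b (transform a s) := by
  have h : (a * b).1.map (Int.cast : ℤ → ℝ)
      = a.1.map (Int.cast : ℤ → ℝ) * b.1.map (Int.cast : ℤ → ℝ) :=
    Matrix.map_mul (f := Int.castRingHom ℝ)
  simp only [transform, h, transpose_mul, Matrix.mul_assoc]

/-- `Aut(s) = O(s, ℤ)`, the group of the `a` in `GL(g, ℤ)` with `ᵗa s a = s`. -/
def aut {g : ℕ} (s : HalfIntPosDef g) : Subgroup (GL (Fin g) ℤ) where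
  carrier := {a | transform a s.1 = s.1}
  one_mem' := transform_one s.1
  mul_mem' := by
    intro a b ha hb
    simp only [Set.mem_ofPred_eq] at *
    rw [transform_mul, ha, hb]
  inv_mem' := by
    intro a ha
    simp only [Set.mem_ofPred_eq] at *
    conv_lhs => rw [← ha]
    rw [← transform_mul, mul_inv_cancel, transform_one]

/-- The filter "`k → ∞` along the even integers". -/
def evenAtTop : Filter ℕ := atTop ⊓ 𝓟 {k | Even k}

end SiegelPoincare

/-! Convergence. Put `V = Im(γz)`. Since `|det(cz+d)|² det V = det(Im z)`, for `k = 2l` a summand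
has absolute value `(det Im z)^(-l) (det V)^l exp(-2π Tr(sV))`. The product `det V · Tr V⁻¹` is the
trace of the adjugate, hence polynomially bounded in `Tr V`, and the exponential beats every
polynomial in `Tr V`; so the part depending on `V` is at most `C (Tr V⁻¹)^(-l₀)` when `l₀ ≤ l`
(`exists_det_pow_mul_exp_le`). As `V⁻¹ = (cz+d)(Im z)⁻¹(cz+d)ᴴ`, its trace controls the square of
the size of `(c, d)`, and `(c, d)` is an integral vector that determines the coset. With `l₀ = 2g²`
this gives a majorant `growth z · b q` with `b` summable (`exists_norm_cosetSummand_le`).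

Expansion. The series is therefore a periodic holomorphic function on the tube over the positive
cone. Its Fourier coefficients do not depend on the imaginary part at which they are computed
(`IsPeriodicHolo.integral_slice_eq`); moving that imaginary part slightly gives exponential decay
and an absolutely convergent expansion. If `T` is not positive definite, some `v ≠ 0` has `ᵗv T v ≤
0`; moving the imaginary part to `1 + M v ᵗv` with `M → ∞` kills the coefficient, because `growth`
tends to zero there (`tubeCoeff_eq_zero`).

Limit. At `z = x + i` one has `|det(cz+d)| ≥ 1`, and for `c ≠ 0` equality confines `x` to an affine
hyperplane (`one_le_det_gramDenom`). Absolute values of the summands thus decrease with `k`, a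
single majorant serves all large even `k`, and dominated convergence leaves only the cosets with `c
= 0`. These are parametrized by `GL(g, ℤ)/±1`, the coset of `a` contributing `e(Tr(ᵗa s a z))`. By
orthogonality the limit counts the classes `±a` with `ᵗa s a = t`, which is `|Aut(s)|/2` or `0`. -/

section

open scoped ComplexOrder MatrixOrder

namespace SiegelPoincare

variable {g : ℕ}

/-! ### The symplectic action on the Siegel upper half-space -/

theorem block_relations (γ : Gam g) :
    (blockA γ)ᵀ * blockC γ = (blockC γ)ᵀ * blockA γ ∧
    (blockB γ)ᵀ * blockD γ = (blockD γ)ᵀ * blockB γ ∧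
    (blockA γ)ᵀ * blockD γ - (blockC γ)ᵀ * blockB γ = 1 := by
  have h := SymplecticGroup.map_mem γ.2 (Int.castRingHom ℂ)
  rw [← fromBlocks_toBlocks γ.1, fromBlocks_map] at h
  exact SymplecticGroup.fromBlocks_mem_iff.1 h

theorem blockC_mul_blockD_transpose_int (γ : Gam g) :
    γ.1.toBlocks₂₁ * γ.1.toBlocks₂₂ᵀ = γ.1.toBlocks₂₂ * γ.1.toBlocks₂₁ᵀ := by
  have h := SymplecticGroup.transpose_mem γ.2
  rw [← fromBlocks_toBlocks γ.1, fromBlocks_transpose] at h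
  simpa using (SymplecticGroup.fromBlocks_mem_iff.1 h).2.1

@[simp] theorem blockA_conjTranspose (γ : Gam g) : (blockA γ)ᴴ = (blockA γ)ᵀ := by
  ext i j; simp [blockA]

@[simp] theorem blockB_conjTranspose (γ : Gam g) : (blockB γ)ᴴ = (blockB γ)ᵀ := by
  ext i j; simp [blockB]

@[simp] theorem blockC_conjTranspose (γ : Gam g) : (blockC γ)ᴴ = (blockC γ)ᵀ := by
  ext i j; simp [blockC]

@[simp] theorem blockD_conjTranspose (γ : Gam g) : (blockD γ)ᴴ = (blockD γ)ᵀ := by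
  ext i j; simp [blockD]

/-- The numerator `az + b` of the action. -/
noncomputable def numer (γ : Gam g) (z : Matrix (Fin g) (Fin g) ℂ) : Matrix (Fin g) (Fin g) ℂ :=
  blockA γ * z + blockB γ

theorem act_eq (γ : Gam g) (z : Matrix (Fin g) (Fin g) ℂ) :
    act γ z = numer γ z * (denom γ z)⁻¹ := rfl

/-- The symplectic relation for a general left factor `w` (in practice `zᵀ` or `zᴴ`). -/
theorem symplectic_pairing (γ : Gam g) (w z : Matrix (Fin g) (Fin g) ℂ) :
    (w * (blockC γ)ᵀ + (blockD γ)ᵀ) * numer γ z - (w * (blockA γ)ᵀ + (blockB γ)ᵀ) * denom γ z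
      = z - w := by
  obtain ⟨h1, h2, h3⟩ := block_relations γ
  have h4 : (blockD γ)ᵀ * blockA γ - (blockB γ)ᵀ * blockC γ = 1 := by
    have := congrArg Matrix.transpose h3
    simpa using this
  have e : (w * (blockC γ)ᵀ + (blockD γ)ᵀ) * numer γ z
        - (w * (blockA γ)ᵀ + (blockB γ)ᵀ) * denom γ z
      = w * ((blockC γ)ᵀ * blockA γ - (blockA γ)ᵀ * blockC γ) * z
        + ((blockD γ)ᵀ * blockA γ - (blockB γ)ᵀ * blockC γ) * z
        - w * ((blockA γ)ᵀ * blockD γ - (blockC γ)ᵀ * blockB γ)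
        - ((blockB γ)ᵀ * blockD γ - (blockD γ)ᵀ * blockB γ) := by
    simp only [numer, denom]
    noncomm_ring
  rw [e, h1, h2, h3, h4]
  simp

theorem denom_conjTranspose (γ : Gam g) (z : Matrix (Fin g) (Fin g) ℂ) :
    (denom γ z)ᴴ = zᴴ * (blockC γ)ᵀ + (blockD γ)ᵀ := by
  simp [denom]

theorem numer_conjTranspose (γ : Gam g) (z : Matrix (Fin g) (Fin g) ℂ) :
    (numer γ z)ᴴ = zᴴ * (blockA γ)ᵀ + (blockB γ)ᵀ := by
  simp [numer]

/-- The pairing identity with `w = zᴴ` produces the imaginary part of `z`; with `w = zᵀ` its right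
side vanishes, which yields the symmetry of `γz`. -/
theorem denom_conjTranspose_mul_numer (γ : Gam g) (z : Matrix (Fin g) (Fin g) ℂ) :
    (denom γ z)ᴴ * numer γ z - (numer γ z)ᴴ * denom γ z = z - zᴴ := by
  rw [denom_conjTranspose, numer_conjTranspose, symplectic_pairing]

theorem denom_transpose_mul_numer (γ : Gam g) {z : Matrix (Fin g) (Fin g) ℂ} (hz : z.IsSymm) :
    (denom γ z)ᵀ * numer γ z = (numer γ z)ᵀ * denom γ z := by
  have := symplectic_pairing γ zᵀ z
  rw [hz.eq, sub_self, sub_eq_zero] at this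
  simpa [denom, numer, hz.eq] using this

/-- The imaginary part of a matrix, viewed over `ℂ`. -/
noncomputable def imC (z : Matrix (Fin g) (Fin g) ℂ) : Matrix (Fin g) (Fin g) ℂ :=
  (z.map Complex.im).map Complex.ofReal

theorem sub_conjTranspose_of_isSymm {z : Matrix (Fin g) (Fin g) ℂ} (hz : z.IsSymm) :
    z - zᴴ = (2 * Complex.I) • imC z := by
  ext i j
  have h : z j i = z i j := hz.apply i j
  simp only [imC, Matrix.sub_apply, conjTranspose_apply, Matrix.smul_apply, map_apply, h,
    smul_eq_mul]
  apply Complex.ext <;> simp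
  ring

theorem exists_isUnit_conjTranspose_mul_self {𝕜 n : Type*} [RCLike 𝕜] [Fintype n] [DecidableEq n]
    {y : Matrix n n 𝕜} (hy : y.PosDef) : ∃ B : Matrix n n 𝕜, IsUnit B ∧ y = Bᴴ * B :=
  CStarAlgebra.isStrictlyPositive_iff_eq_star_mul_self.mp hy.isStrictlyPositive

theorem exists_conjTranspose_mul_self {𝕜 n : Type*} [RCLike 𝕜] [Fintype n] [DecidableEq n]
    {y : Matrix n n 𝕜} (hy : y.PosSemidef) : ∃ B : Matrix n n 𝕜, y = Bᴴ * B :=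
  CStarAlgebra.nonneg_iff_eq_star_mul_self.mp hy.nonneg

theorem map_ofReal_mul {l m n : Type*} [Fintype m] (A : Matrix l m ℝ) (B : Matrix m n ℝ) :
    (A * B).map Complex.ofReal = A.map Complex.ofReal * B.map Complex.ofReal :=
  Matrix.map_mul (f := Complex.ofRealHom)

theorem map_ofReal_conjTranspose {m n : Type*} (A : Matrix m n ℝ) :
    (Aᴴ).map Complex.ofReal = (A.map Complex.ofReal)ᴴ := by
  ext i j; simp

theorem map_ofReal_one {n : Type*} [DecidableEq n] :
    (1 : Matrix n n ℝ).map Complex.ofReal = 1 := Matrix.map_one _ (by simp) (by simp)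

theorem map_ofReal_det {n : Type*} [Fintype n] [DecidableEq n] (A : Matrix n n ℝ) :
    (A.map Complex.ofReal).det = (A.det : ℂ) :=
  (Complex.ofRealHom.map_det A).symm

theorem map_ofReal_inv {n : Type*} [Fintype n] [DecidableEq n] {A : Matrix n n ℝ}
    (hA : IsUnit A.det) : (A⁻¹).map Complex.ofReal = (A.map Complex.ofReal)⁻¹ := by
  symm
  apply Matrix.inv_eq_left_inv
  rw [← map_ofReal_mul, Matrix.nonsing_inv_mul _ hA, map_ofReal_one]

theorem posDef_map_ofReal {n : Type*} [Fintype n] [DecidableEq n] {y : Matrix n n ℝ}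
    (hy : y.PosDef) : (y.map Complex.ofReal).PosDef := by
  obtain ⟨B, hB, rfl⟩ := exists_isUnit_conjTranspose_mul_self hy
  rw [map_ofReal_mul, map_ofReal_conjTranspose]
  apply PosDef.conjTranspose_mul_self
  rw [Matrix.mulVec_injective_iff_isUnit, Matrix.isUnit_iff_isUnit_det, map_ofReal_det]
  simpa [Matrix.isUnit_iff_isUnit_det] using hB

theorem posDef_of_map_ofReal {n : Type*} [Fintype n] {y : Matrix n n ℝ}
    (hy : (y.map Complex.ofReal).PosDef) : y.PosDef := by
  refine .of_dotProduct_mulVec_pos ?_ fun x hx => ?_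
  · ext i j
    have := congrFun (congrFun hy.1 i) j
    simpa using this
  · have h1 : (Complex.ofReal ∘ x) ≠ 0 := by
      intro h
      apply hx
      ext i
      simpa using congrFun h i
    have h2 := hy.dotProduct_mulVec_pos h1
    have h3 : star (Complex.ofReal ∘ x) ⬝ᵥ y.map Complex.ofReal *ᵥ (Complex.ofReal ∘ x)
        = ((star x ⬝ᵥ y *ᵥ x : ℝ) : ℂ) := by
      simp [dotProduct, mulVec]
    rw [h3] at h2
    exact_mod_cast h2

theorem imC_posDef {z : Matrix (Fin g) (Fin g) ℂ} (hz : z ∈ siegelUpperHalfSpace g) :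
    (imC z).PosDef := posDef_map_ofReal hz.2

/-- If `(cz+d)v = 0`, evaluating the Hermitian pairing identity at `v` gives `0 = 2i vᴴ(Im z)v`,
against positivity of `Im z`. -/
theorem isUnit_det_denom (γ : Gam g) {z : Matrix (Fin g) (Fin g) ℂ}
    (hz : z ∈ siegelUpperHalfSpace g) : IsUnit (denom γ z).det := by
  rw [isUnit_iff_ne_zero]
  intro h
  obtain ⟨v, hv, hv0⟩ := Matrix.exists_mulVec_eq_zero_iff.2 h
  have h1 := denom_conjTranspose_mul_numer γ z
  rw [sub_conjTranspose_of_isSymm hz.1] at h1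
  have h2 := (imC_posDef hz).dotProduct_mulVec_pos hv
  have h3 : star v ⬝ᵥ ((2 * Complex.I) • imC z) *ᵥ v = 0 := by
    rw [← h1, sub_mulVec, ← mulVec_mulVec, ← mulVec_mulVec, hv0, mulVec_zero, sub_zero,
      dotProduct_mulVec, vecMul_conjTranspose, star_star, hv0, star_zero, zero_dotProduct]
  rw [smul_mulVec, dotProduct_smul, smul_eq_mul] at h3
  simp [h2.ne'] at h3

theorem imC_act (γ : Gam g) {z : Matrix (Fin g) (Fin g) ℂ} (hz : z ∈ siegelUpperHalfSpace g) :
    (act γ z).IsSymm ∧ imC (act γ z) = ((denom γ z)⁻¹)ᴴ * imC z * (denom γ z)⁻¹ := by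
  have hu := isUnit_det_denom γ hz
  have hs : (act γ z).IsSymm := by
    have huT : IsUnit (denom γ z)ᵀ.det := by rwa [det_transpose]
    have h := denom_transpose_mul_numer γ hz.1
    rw [IsSymm, act_eq, transpose_mul, transpose_nonsing_inv]
    calc ((denom γ z)ᵀ)⁻¹ * (numer γ z)ᵀ
        = ((denom γ z)ᵀ)⁻¹ * ((numer γ z)ᵀ * denom γ z) * (denom γ z)⁻¹ := by
          rw [Matrix.mul_assoc, Matrix.mul_assoc, Matrix.mul_nonsing_inv _ hu, Matrix.mul_one]
      _ = numer γ z * (denom γ z)⁻¹ := by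
          rw [← h, ← Matrix.mul_assoc, Matrix.nonsing_inv_mul _ huT, Matrix.one_mul]
  refine ⟨hs, ?_⟩
  have h1 := denom_conjTranspose_mul_numer γ z
  rw [sub_conjTranspose_of_isSymm hz.1] at h1
  have h2 : (2 * Complex.I) • imC (act γ z) = (2 * Complex.I) •
      (((denom γ z)⁻¹)ᴴ * imC z * (denom γ z)⁻¹) := by
    have huH : ((denom γ z)⁻¹)ᴴ * (denom γ z)ᴴ = 1 := by
      rw [← conjTranspose_mul, Matrix.mul_nonsing_inv _ hu, conjTranspose_one]
    rw [← sub_conjTranspose_of_isSymm hs, ← Matrix.smul_mul, ← Matrix.mul_smul, ← h1, act_eq,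
      conjTranspose_mul, Matrix.mul_sub, Matrix.sub_mul, ← Matrix.mul_assoc, huH, Matrix.one_mul,
      ← Matrix.mul_assoc, Matrix.mul_assoc _ (denom γ z), Matrix.mul_nonsing_inv _ hu,
      Matrix.mul_one]
  exact smul_right_injective _ (by simp) h2

theorem act_mem (γ : Gam g) {z : Matrix (Fin g) (Fin g) ℂ} (hz : z ∈ siegelUpperHalfSpace g) :
    act γ z ∈ siegelUpperHalfSpace g := by
  refine ⟨(imC_act γ hz).1, posDef_of_map_ofReal ?_⟩
  change (imC (act γ z)).PosDef
  rw [(imC_act γ hz).2]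
  apply (imC_posDef hz).conjTranspose_mul_mul_same
  rw [Matrix.mulVec_injective_iff_isUnit, Matrix.isUnit_iff_isUnit_det]
  exact Matrix.isUnit_nonsing_inv_det _ (isUnit_det_denom γ hz)

/-- The imaginary part of a matrix. -/
noncomputable abbrev im (z : Matrix (Fin g) (Fin g) ℂ) : Matrix (Fin g) (Fin g) ℝ :=
  z.map Complex.im

theorem norm_det_denom_sq_mul (γ : Gam g) {z : Matrix (Fin g) (Fin g) ℂ}
    (hz : z ∈ siegelUpperHalfSpace g) :
    ‖(denom γ z).det‖ ^ 2 * (im (act γ z)).det = (im z).det := by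
  have h := congrArg Matrix.det (imC_act γ hz).2
  have hu := isUnit_det_denom γ hz
  simp only [imC, map_ofReal_det, det_mul, det_conjTranspose, det_nonsing_inv,
    Ring.inverse_eq_inv'] at h
  have h0 : (denom γ z).det ≠ 0 := hu.ne_zero
  have : (‖(denom γ z).det‖ ^ 2 * (im (act γ z)).det : ℂ) = (im z).det := by
    rw [h, star_inv₀, ← Complex.mul_conj']
    have h0' : (starRingEnd ℂ) (denom γ z).det ≠ 0 := by simpa using h0
    rw [← starRingEnd_apply]
    field_simp
  exact_mod_cast this

/-- This form is linear in the Gram data of `cz+d`: it is what lets `Tr (Im γz)⁻¹` bound the entries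
of `cz+d`. -/
theorem inv_im_act (γ : Gam g) {z : Matrix (Fin g) (Fin g) ℂ} (hz : z ∈ siegelUpperHalfSpace g) :
    ((im (act γ z))⁻¹).map Complex.ofReal = denom γ z * (imC z)⁻¹ * (denom γ z)ᴴ := by
  have hu := isUnit_det_denom γ hz
  have hd := (act_mem γ hz).2.det_pos.ne'
  rw [map_ofReal_inv hd.isUnit]
  change (imC (act γ z))⁻¹ = _
  rw [(imC_act γ hz).2, Matrix.mul_inv_rev, Matrix.mul_inv_rev, Matrix.nonsing_inv_nonsing_inv _ hu,
    conjTranspose_nonsing_inv, Matrix.nonsing_inv_nonsing_inv, Matrix.mul_assoc]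
  rw [det_conjTranspose]
  exact hu.star

/-! ### Coordinates on symmetric matrices and half-integral forms -/

/-- The symmetric matrix with prescribed coordinates on unordered pairs. -/
def symMat {R : Type*} (u : Sym2 (Fin g) → R) : Matrix (Fin g) (Fin g) R :=
  Matrix.of fun i j => u s(i, j)

@[simp] theorem symMat_apply {R : Type*} (u : Sym2 (Fin g) → R) (i j : Fin g) :
    symMat u i j = u s(i, j) := rfl

theorem symMat_isSymm {R : Type*} (u : Sym2 (Fin g) → R) : (symMat u).IsSymm := by
  ext i j; simp [Sym2.eq_swap]

theorem exists_eq_symMat {R : Type*} {z : Matrix (Fin g) (Fin g) R} (hz : z.IsSymm) :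
    ∃ u, z = symMat u := by
  refine ⟨Sym2.lift ⟨fun i j => z i j, fun i j => hz.apply j i⟩, ?_⟩
  ext i j; simp

/-- The symmetric matrix whose trace pairing with `symMat u` is `∑ n p * u p`. -/
noncomputable def halfMat (n : Sym2 (Fin g) → ℝ) : Matrix (Fin g) (Fin g) ℝ :=
  Matrix.of fun i j => if i = j then n s(i, j) else n s(i, j) / 2

theorem halfMat_isSymm (n : Sym2 (Fin g) → ℝ) : (halfMat n).IsSymm := by
  ext i j; simp [halfMat, Sym2.eq_swap, eq_comm]

theorem sum_sum_sym2_eq {M : Type*} [AddCommMonoid M] (f : Fin g → Fin g → M)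
    (F : Sym2 (Fin g) → M) (h1 : ∀ i, f i i = F s(i, i))
    (h2 : ∀ i j, i ≠ j → f i j + f j i = F s(i, j)) :
    ∑ i, ∑ j, f i j = ∑ p, F p := by
  classical
  rw [← Finset.sum_product', Finset.univ_product_univ,
    ← Finset.sum_fiberwise (g := fun x : Fin g × Fin g => s(x.1, x.2))]
  refine Finset.sum_congr rfl fun p _ => ?_
  induction p using Sym2.inductionOn with
  | hf a b =>
    by_cases hab : a = b
    · subst hab
      have : (Finset.univ.filter fun x : Fin g × Fin g => s(x.1, x.2) = s(a, a)) = {(a, a)} := by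
        ext ⟨x, y⟩; simp
      rw [this, Finset.sum_singleton, h1]
    · have : (Finset.univ.filter fun x : Fin g × Fin g => s(x.1, x.2) = s(a, b))
          = {(a, b), (b, a)} := by
        ext ⟨x, y⟩; simp
      rw [this, Finset.sum_pair (by simp [hab]), h2 a b hab]

theorem trace_halfMat_mul_symMat (n : Sym2 (Fin g) → ℝ) (u : Sym2 (Fin g) → ℂ) :
    trace ((halfMat n).map Complex.ofReal * symMat u) = ∑ p, (n p : ℂ) * u p := by
  simp only [trace, diag_apply, mul_apply]
  apply sum_sum_sym2_eq
  · intro i; simp [halfMat]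
  · intro i j hij
    simp only [halfMat, map_apply, of_apply, hij, hij.symm, if_false, symMat_apply,
      Sym2.eq_swap (a := j) (b := i)]
    push_cast; ring

theorem trace_halfMat_mul_symMat_real (n : Sym2 (Fin g) → ℝ) (u : Sym2 (Fin g) → ℝ) :
    trace (halfMat n * symMat u) = ∑ p, n p * u p := by
  simp only [trace, diag_apply, mul_apply]
  apply sum_sum_sym2_eq
  · intro i; simp [halfMat]
  · intro i j hij
    simp only [halfMat, of_apply, hij, hij.symm, if_false, symMat_apply,
      Sym2.eq_swap (a := j) (b := i)]
    ring

theorem halfMat_injective : Function.Injective (halfMat (g := g)) := by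
  intro m n h
  ext p
  induction p using Sym2.inductionOn with
  | hf a b =>
    have := congrFun (congrFun h a) b
    by_cases hab : a = b
    · simpa [halfMat, hab] using this
    · simpa [halfMat, hab] using this

/-- The integral coordinates of a half-integral matrix. -/
theorem exists_halfMat_eq (t : HalfIntPosDef g) :
    ∃ n : Sym2 (Fin g) → ℤ, halfMat (fun p => (n p : ℝ)) = t.1 := by
  obtain ⟨t, ht, h1, h2⟩ := t
  have hs : t.IsSymm := by
    have := ht.1
    rwa [IsHermitian, conjTranspose_eq_transpose_of_trivial] at this
  have key : ∀ p : Sym2 (Fin g), ∃ n : ℤ, ∀ i j, p = s(i, j) →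
      (n : ℝ) = if i = j then t i j else 2 * t i j := by
    intro p
    induction p using Sym2.inductionOn with
    | hf a b =>
      have hex : ∃ n : ℤ, (n : ℝ) = if a = b then t a b else 2 * t a b := by
        split_ifs with hab
        · subst hab
          exact (h1 a).imp fun n hn => hn.symm
        · exact (h2 a b).imp fun n hn => hn.symm
      obtain ⟨n, hn⟩ := hex
      refine ⟨n, fun i j hij => ?_⟩
      rcases Sym2.eq_iff.1 hij with ⟨rfl, rfl⟩ | ⟨rfl, rfl⟩
      · exact hn
      · rw [hn, hs.apply]
        simp [eq_comm]
  choose n hn using key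
  refine ⟨n, ?_⟩
  ext i j
  have := hn s(i, j) i j rfl
  simp only [halfMat, of_apply, this]
  split_ifs <;> ring

theorem e_add (a b : ℂ) : e (a + b) = e a * e b := by
  simp only [e, ← Complex.exp_add]; ring_nf

@[simp] theorem e_zero : e 0 = 1 := by simp [e]

theorem e_intCast (n : ℤ) : e (n : ℂ) = 1 := by
  rw [e, Complex.exp_eq_one_iff]
  exact ⟨n, by ring⟩

theorem norm_e (w : ℂ) : ‖e w‖ = Real.exp (-(2 * Real.pi * w.im)) := by
  rw [e, Complex.norm_exp]
  congr 1
  simp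

theorem exists_int_trace_eq (n : Sym2 (Fin g) → ℤ) {S : Matrix (Fin g) (Fin g) ℤ}
    (hS : S.IsSymm) : ∃ m : ℤ, trace ((halfMat (fun p => (n p : ℝ))).map Complex.ofReal *
      S.map (Int.cast : ℤ → ℂ)) = m := by
  obtain ⟨u, rfl⟩ := exists_eq_symMat hS
  refine ⟨∑ p, n p * u p, ?_⟩
  have : (symMat u).map (Int.cast : ℤ → ℂ) = symMat fun p => (u p : ℂ) := by ext; simp
  rw [this, trace_halfMat_mul_symMat]
  push_cast
  rfl

/-! ### Invariance under `Γ_∞`, periodicity, and bottom rows of cosets -/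

/-- Left multiplication by `(1 S; 0 1)` translates the action. -/
theorem blocks_left {γ δ : Gam g} {S : Matrix (Fin g) (Fin g) ℤ}
    (h : δ.1 = fromBlocks 1 S 0 1 * γ.1) :
    blockA δ = blockA γ + S.map Int.cast * blockC γ ∧
    blockB δ = blockB γ + S.map Int.cast * blockD γ ∧
    blockC δ = blockC γ ∧ blockD δ = blockD γ := by
  have hm := fun (A B : Matrix (Fin g) (Fin g) ℤ) =>
    (Matrix.map_mul (L := A) (M := B) (f := Int.castRingHom ℂ)).symm
  simp only [Int.coe_castRingHom] at hm
  rw [← fromBlocks_toBlocks γ.1, fromBlocks_multiply] at h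
  simp only [blockA, blockB, blockC, blockD, h, toBlocks_fromBlocks₁₁, toBlocks_fromBlocks₁₂,
    toBlocks_fromBlocks₂₁, toBlocks_fromBlocks₂₂, hm]
  refine ⟨?_, ?_, ?_, ?_⟩ <;> ext i j <;> simp

theorem blocks_neg_left {γ δ : Gam g} {S : Matrix (Fin g) (Fin g) ℤ}
    (h : δ.1 = -fromBlocks 1 S 0 1 * γ.1) :
    blockA δ = -(blockA γ + S.map Int.cast * blockC γ) ∧
    blockB δ = -(blockB γ + S.map Int.cast * blockD γ) ∧
    blockC δ = -blockC γ ∧ blockD δ = -blockD γ := by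
  have hm := fun (A B : Matrix (Fin g) (Fin g) ℤ) =>
    (Matrix.map_mul (L := A) (M := B) (f := Int.castRingHom ℂ)).symm
  simp only [Int.coe_castRingHom] at hm
  rw [← fromBlocks_toBlocks γ.1, neg_mul, fromBlocks_multiply, fromBlocks_neg] at h
  simp only [blockA, blockB, blockC, blockD, h, toBlocks_fromBlocks₁₁, toBlocks_fromBlocks₁₂,
    toBlocks_fromBlocks₂₁, toBlocks_fromBlocks₂₂, hm]
  refine ⟨?_, ?_, ?_, ?_⟩ <;> ext i j <;> simp

theorem act_left_and_det_denom {γ δ : Gam g} (hδ : δ ∈ gamInfty g)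
    {z : Matrix (Fin g) (Fin g) ℂ} (hz : z ∈ siegelUpperHalfSpace g) :
    ∃ S : Matrix (Fin g) (Fin g) ℤ, S.IsSymm ∧
      act (δ * γ) z = act γ z + S.map Int.cast ∧
      (denom (δ * γ) z = denom γ z ∨ denom (δ * γ) z = -denom γ z) := by
  obtain ⟨S, hS, h⟩ := hδ
  refine ⟨S, hS, ?_⟩
  have hu := isUnit_det_denom γ hz
  have key : (blockA γ + S.map Int.cast * blockC γ) * z + (blockB γ + S.map Int.cast * blockD γ)
      = numer γ z + S.map Int.cast * denom γ z := by
    simp only [numer, denom]; noncomm_ring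
  have key2 : (numer γ z + S.map Int.cast * denom γ z) * (denom γ z)⁻¹
      = act γ z + S.map Int.cast := by
    rw [add_mul, Matrix.mul_assoc, Matrix.mul_nonsing_inv _ hu, Matrix.mul_one, act_eq]
  rcases h with h | h
  · obtain ⟨hA, hB, hC, hD⟩ := blocks_left (γ := γ) (δ := δ * γ) (S := S)
      (by rw [← h]; rfl)
    have hden : denom (δ * γ) z = denom γ z := by rw [denom, hC, hD, denom]
    refine ⟨?_, Or.inl hden⟩
    rw [act_eq, hden, numer, hA, hB, key, key2]
  · obtain ⟨hA, hB, hC, hD⟩ := blocks_neg_left (γ := γ) (δ := δ * γ) (S := S)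
      (by rw [← h]; rfl)
    have hden : denom (δ * γ) z = -denom γ z := by rw [denom, hC, hD, denom]; noncomm_ring
    refine ⟨?_, Or.inr hden⟩
    have hnum : numer (δ * γ) z = -(numer γ z + S.map Int.cast * denom γ z) := by
      rw [numer, hA, hB, ← key]; noncomm_ring
    have hinv : (-denom γ z)⁻¹ = -(denom γ z)⁻¹ := by
      apply Matrix.inv_eq_left_inv
      rw [neg_mul_neg, Matrix.nonsing_inv_mul _ hu]
    rw [act_eq, hden, hnum, hinv, neg_mul_neg, key2]

theorem summand_left (s : HalfIntPosDef g) {k : ℕ} (hk : Even k) {γ δ : Gam g}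
    (hδ : δ ∈ gamInfty g) {z : Matrix (Fin g) (Fin g) ℂ} (hz : z ∈ siegelUpperHalfSpace g) :
    summand s k z (δ * γ) = summand s k z γ := by
  obtain ⟨S, hS, h1, h2⟩ := act_left_and_det_denom (γ := γ) hδ hz
  obtain ⟨n, hn⟩ := exists_halfMat_eq s
  obtain ⟨m, hm⟩ := exists_int_trace_eq n hS
  rw [hn] at hm
  have hdet : (denom (δ * γ) z).det ^ (-(k : ℤ)) = (denom γ z).det ^ (-(k : ℤ)) := by
    rcases h2 with h2 | h2
    · rw [h2]
    · rw [h2, det_neg, mul_zpow]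
      have : ((-1 : ℂ) ^ Fintype.card (Fin g)) ^ (-(k : ℤ)) = 1 := by
        rw [_root_.zpow_neg, zpow_natCast, ← pow_mul, mul_comm, pow_mul, hk.neg_one_pow, one_pow, inv_one]
      rw [this, one_mul]
  rw [summand, summand, hdet, h1, mul_add, trace_add, e_add, hm, e_intCast, mul_one]

theorem cosetSummand_mk (s : HalfIntPosDef g) {k : ℕ} (hk : Even k)
    {z : Matrix (Fin g) (Fin g) ℂ} (hz : z ∈ siegelUpperHalfSpace g) (γ : Gam g) :
    cosetSummand s k z (Quotient.mk _ γ : Cosets g) = summand s k z γ := by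
  have h : (QuotientGroup.rightRel (gamInfty g)) (Quotient.mk _ γ : Cosets g).out γ :=
    Quotient.exact (Quotient.out_eq _)
  rw [QuotientGroup.rightRel_apply] at h
  have := summand_left s hk (γ := (Quotient.mk _ γ : Cosets g).out) h hz
  rw [cosetSummand, ← this]
  congr 1
  group

/-- The translation `(1 S; 0 1)` as an element of the modular group. -/
def translation (S : Matrix (Fin g) (Fin g) ℤ) (hS : S.IsSymm) : Gam g :=
  ⟨fromBlocks 1 S 0 1, SymplecticGroup.fromBlocks_mem_iff.2 (by simp [hS.eq])⟩

theorem summand_mul_translation (s : HalfIntPosDef g) (k : ℕ) (γ : Gam g)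
    {S : Matrix (Fin g) (Fin g) ℤ} (hS : S.IsSymm) (z : Matrix (Fin g) (Fin g) ℂ) :
    summand s k z (γ * translation S hS) = summand s k (z + S.map Int.cast) γ := by
  have hm := fun (A B : Matrix (Fin g) (Fin g) ℤ) =>
    (Matrix.map_mul (L := A) (M := B) (f := Int.castRingHom ℂ)).symm
  simp only [Int.coe_castRingHom] at hm
  have h : (γ * translation S hS).1 = fromBlocks γ.1.toBlocks₁₁
      (γ.1.toBlocks₁₁ * S + γ.1.toBlocks₁₂) γ.1.toBlocks₂₁
      (γ.1.toBlocks₂₁ * S + γ.1.toBlocks₂₂) := by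
    change γ.1 * fromBlocks 1 S 0 1 = _
    conv_lhs => rw [← fromBlocks_toBlocks γ.1, fromBlocks_multiply]
    simp
  have hA : blockA (γ * translation S hS) = blockA γ := by simp [blockA, h]
  have hC : blockC (γ * translation S hS) = blockC γ := by simp [blockC, h]
  have hB : blockB (γ * translation S hS) = blockA γ * S.map Int.cast + blockB γ := by
    simp only [blockB, blockA, h, toBlocks_fromBlocks₁₂, hm]
    ext; simp
  have hD : blockD (γ * translation S hS) = blockC γ * S.map Int.cast + blockD γ := by
    simp only [blockC, blockD, h, toBlocks_fromBlocks₂₂, hm]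
    ext; simp
  have hden : denom (γ * translation S hS) z = denom γ (z + S.map Int.cast) := by
    simp only [denom, hC, hD]; noncomm_ring
  have hact : act (γ * translation S hS) z = act γ (z + S.map Int.cast) := by
    rw [act_eq, act_eq, hden]
    congr 1
    simp only [numer, hA, hB]; noncomm_ring
  rw [summand, summand, hden, hact]

/-- Right multiplication on `Γ_∞ \ Γ_g`. -/
def cosetMul (δ : Gam g) : Cosets g ≃ Cosets g :=
  Quotient.congr (Equiv.mulRight δ) fun a b => by
    change (QuotientGroup.rightRel (gamInfty g)) a b ↔
      (QuotientGroup.rightRel (gamInfty g)) (a * δ) (b * δ)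
    rw [QuotientGroup.rightRel_apply, QuotientGroup.rightRel_apply]
    simp [mul_assoc]

theorem add_intCast_mem {z : Matrix (Fin g) (Fin g) ℂ} (hz : z ∈ siegelUpperHalfSpace g)
    {S : Matrix (Fin g) (Fin g) ℤ} (hS : S.IsSymm) :
    z + S.map Int.cast ∈ siegelUpperHalfSpace g := by
  refine ⟨hz.1.add (by rw [IsSymm, ← transpose_map, hS.eq]), ?_⟩
  have : (z + S.map Int.cast).map Complex.im = z.map Complex.im := by ext; simp
  rw [this]
  exact hz.2

/-- Replacing `z` by `z + S` amounts to multiplying every `γ` on the right by a translation, and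
this permutes the cosets `Γ_∞ γ`. -/
theorem poincareSeries_add (s : HalfIntPosDef g) {k : ℕ} (hk : Even k)
    {z : Matrix (Fin g) (Fin g) ℂ} (hz : z ∈ siegelUpperHalfSpace g)
    {S : Matrix (Fin g) (Fin g) ℤ} (hS : S.IsSymm) :
    poincareSeries s k (z + S.map Int.cast) = poincareSeries s k z := by
  rw [poincareSeries, poincareSeries, ← (cosetMul (translation S hS)).tsum_eq (cosetSummand s k z)]
  refine tsum_congr fun q => ?_
  induction q using Quotient.inductionOn with
  | h γ =>
    change _ = cosetSummand s k z (Quotient.mk _ (γ * translation S hS))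
    rw [cosetSummand_mk s hk hz, cosetSummand_mk s hk (add_intCast_mem hz hS),
      summand_mul_translation]

/-- The bottom row `(c, d)` of a representative. -/
noncomputable def bottomRow (q : Cosets g) : Matrix (Fin g) (Fin g) ℤ × Matrix (Fin g) (Fin g) ℤ :=
  (q.out.1.toBlocks₂₁, q.out.1.toBlocks₂₂)

/-- If `γ` and `δ` share their bottom row, then `δγ⁻¹` has bottom row `(0, 1)`, and the symplectic
relations force it to be a translation. Sums over cosets thereby become sums over integral vectors.
-/
theorem bottomRow_injective : Function.Injective (bottomRow (g := g)) := by
  intro q r h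
  have h1 : q.out.1.toBlocks₂₁ = r.out.1.toBlocks₂₁ := congrArg Prod.fst h
  have h2 : q.out.1.toBlocks₂₂ = r.out.1.toBlocks₂₂ := congrArg Prod.snd h
  have hq := q.out.2
  rw [← Quotient.out_eq q, ← Quotient.out_eq r]
  refine Quotient.sound ?_
  change (QuotientGroup.rightRel (gamInfty g)) _ _
  rw [QuotientGroup.rightRel_apply]
  set γ := q.out
  set δ := r.out
  set a := (δ * γ⁻¹).1 with ha
  have h3 : a * γ.1 = δ.1 := by
    change ((δ * γ⁻¹) * γ).1 = δ.1
    simp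
  have hdet : IsUnit γ.1 := by
    rw [Matrix.isUnit_iff_isUnit_det]; exact SymplecticGroup.symplectic_det hq
  have h4 : a.toBlocks₂₁ = 0 ∧ a.toBlocks₂₂ = 1 := by
    -- Only the bottom rows of `aγ = δ` are known to agree with those of `γ`, so the top rows are
    -- replaced by zero before cancelling `γ`.
    have h5 : fromBlocks 0 0 a.toBlocks₂₁ a.toBlocks₂₂ * γ.1 = fromBlocks 0 0 0 1 * γ.1 := by
      have h6 := h3
      rw [← fromBlocks_toBlocks a, ← fromBlocks_toBlocks γ.1, ← fromBlocks_toBlocks δ.1,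
        fromBlocks_multiply, fromBlocks_inj] at h6
      conv_lhs => rw [← fromBlocks_toBlocks γ.1]
      conv_rhs => rw [← fromBlocks_toBlocks γ.1]
      rw [fromBlocks_multiply, fromBlocks_multiply, h6.2.2.1, h6.2.2.2, ← h1, ← h2]
      simp
    have h7 := hdet.mul_left_injective h5
    rw [fromBlocks_inj] at h7
    exact ⟨h7.2.2.1, h7.2.2.2⟩
  have h5 := (δ * γ⁻¹).2
  rw [← ha, ← fromBlocks_toBlocks a, h4.1, h4.2, SymplecticGroup.fromBlocks_mem_iff] at h5
  obtain ⟨-, h6, h7⟩ := h5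
  refine ⟨a.toBlocks₁₂, ?_, Or.inl ?_⟩
  · simpa [IsSymm] using h6
  · have h8 : a.toBlocks₁₁ = 1 := by
      have := congrArg Matrix.transpose h7
      simpa using this
    rw [← ha]
    conv_lhs => rw [← fromBlocks_toBlocks a, h4.1, h4.2, h8]

/-! ### Entry sums, traces and determinants of positive matrices -/

section EntrySum

variable {𝕜 : Type*} [RCLike 𝕜]

/-- The sum of the absolute values of the entries. -/
noncomputable def entrySum (A : Matrix (Fin g) (Fin g) 𝕜) : ℝ := ∑ i, ∑ j, ‖A i j‖

theorem entrySum_nonneg (A : Matrix (Fin g) (Fin g) 𝕜) : 0 ≤ entrySum A :=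
  Finset.sum_nonneg fun _ _ => Finset.sum_nonneg fun _ _ => norm_nonneg _

theorem norm_apply_le_entrySum (A : Matrix (Fin g) (Fin g) 𝕜) (i j : Fin g) :
    ‖A i j‖ ≤ entrySum A :=
  (Finset.single_le_sum (f := fun j => ‖A i j‖) (fun _ _ => norm_nonneg _)
    (Finset.mem_univ j)).trans
    (Finset.single_le_sum (f := fun i => ∑ j, ‖A i j‖)
      (fun _ _ => Finset.sum_nonneg fun _ _ => norm_nonneg _) (Finset.mem_univ i))

theorem entrySum_add_le (A B : Matrix (Fin g) (Fin g) 𝕜) :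
    entrySum (A + B) ≤ entrySum A + entrySum B := by
  simp only [entrySum, ← Finset.sum_add_distrib]
  exact Finset.sum_le_sum fun _ _ => Finset.sum_le_sum fun _ _ => norm_add_le _ _

theorem entrySum_mul_le (A B : Matrix (Fin g) (Fin g) 𝕜) :
    entrySum (A * B) ≤ entrySum A * entrySum B := by
  have h1 : ∀ i j, ‖(A * B) i j‖ ≤ ∑ k, ‖A i k‖ * ‖B k j‖ := fun i j => by
    rw [mul_apply]
    exact (norm_sum_le _ _).trans (Finset.sum_le_sum fun k _ => norm_mul_le _ _)
  calc entrySum (A * B) ≤ ∑ i, ∑ j, ∑ k, ‖A i k‖ * ‖B k j‖ :=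
        Finset.sum_le_sum fun i _ => Finset.sum_le_sum fun j _ => h1 i j
    _ = ∑ i, ∑ k, ‖A i k‖ * ∑ j, ‖B k j‖ := by
        refine Finset.sum_congr rfl fun i _ => ?_
        rw [Finset.sum_comm]
        simp only [Finset.mul_sum]
    _ ≤ ∑ i, ∑ k, ‖A i k‖ * entrySum B := by
        refine Finset.sum_le_sum fun i _ => Finset.sum_le_sum fun k _ => ?_
        refine mul_le_mul_of_nonneg_left ?_ (norm_nonneg _)
        exact Finset.single_le_sum (f := fun k => ∑ j, ‖B k j‖)
          (fun _ _ => Finset.sum_nonneg fun _ _ => norm_nonneg _) (Finset.mem_univ k)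
    _ = entrySum A * entrySum B := by
        simp only [entrySum, Finset.sum_mul]

theorem re_trace_conjTranspose_mul_self (A : Matrix (Fin g) (Fin g) 𝕜) :
    RCLike.re (trace (Aᴴ * A)) = ∑ i, ∑ j, ‖A i j‖ ^ 2 := by
  simp only [trace, diag_apply, mul_apply, conjTranspose_apply, map_sum, RCLike.star_def,
    RCLike.conj_mul]
  rw [Finset.sum_comm]
  refine Finset.sum_congr rfl fun i _ => Finset.sum_congr rfl fun j _ => ?_
  rw [← RCLike.ofReal_pow, RCLike.ofReal_re]

theorem re_trace_conjTranspose_mul_self_le (A : Matrix (Fin g) (Fin g) 𝕜) :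
    RCLike.re (trace (Aᴴ * A)) ≤ entrySum A ^ 2 := by
  rw [re_trace_conjTranspose_mul_self, sq, entrySum, Finset.sum_mul]
  refine Finset.sum_le_sum fun i _ => ?_
  rw [Finset.sum_mul]
  refine Finset.sum_le_sum fun j _ => ?_
  rw [sq]
  exact mul_le_mul_of_nonneg_left (norm_apply_le_entrySum A i j) (norm_nonneg _)

theorem entrySum_sq_le (A : Matrix (Fin g) (Fin g) 𝕜) :
    entrySum A ^ 2 ≤ g ^ 2 * RCLike.re (trace (Aᴴ * A)) := by
  rw [re_trace_conjTranspose_mul_self, entrySum, ← Finset.sum_product', ← Finset.sum_product']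
  refine (sq_sum_le_card_mul_sum_sq (s := Finset.univ ×ˢ Finset.univ)
    (f := fun x : Fin g × Fin g => ‖A x.1 x.2‖)).trans (le_of_eq ?_)
  simp [sq]

/-- With `s = BᴴB` and `V = CᴴC`, the trace of `sV` is the squared Frobenius norm of `CBᴴ`, and `C =
(CBᴴ)(B⁻¹)ᴴ`. Submultiplicativity of `entrySum` gives the bound; each of the two comparisons with a
Frobenius norm costs a factor `g²`. This coercivity of `Tr(sV)` also gives the finiteness of
`Aut(s)` and the openness of the positive cone. -/
theorem re_trace_le_of_posDef {s V : Matrix (Fin g) (Fin g) 𝕜} (hs : s.PosDef)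
    (hV : V.PosSemidef) :
    RCLike.re (trace V) ≤ g ^ 4 * RCLike.re (trace s⁻¹) * RCLike.re (trace (s * V)) := by
  obtain ⟨B, hB, rfl⟩ := exists_isUnit_conjTranspose_mul_self hs
  obtain ⟨C, rfl⟩ := exists_conjTranspose_mul_self hV
  have hBd : IsUnit B.det := (Matrix.isUnit_iff_isUnit_det _).1 hB
  have h1 : trace (Bᴴ * B * (Cᴴ * C)) = trace ((C * Bᴴ)ᴴ * (C * Bᴴ)) := by
    rw [conjTranspose_mul, conjTranspose_conjTranspose, Matrix.mul_assoc Bᴴ, trace_mul_comm Bᴴ]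
    simp only [Matrix.mul_assoc]
  have h2 : (Bᴴ * B)⁻¹ = ((B⁻¹)ᴴ)ᴴ * (B⁻¹)ᴴ := by
    rw [Matrix.mul_inv_rev, conjTranspose_conjTranspose, conjTranspose_nonsing_inv]
  have h3 : C * Bᴴ * (B⁻¹)ᴴ = C := by
    rw [Matrix.mul_assoc, ← conjTranspose_mul, Matrix.nonsing_inv_mul _ hBd, conjTranspose_one,
      Matrix.mul_one]
  have h4 := entrySum_mul_le (C * Bᴴ) (B⁻¹)ᴴ
  rw [h3] at h4
  rw [h1, h2]
  calc RCLike.re (trace (Cᴴ * C)) ≤ entrySum C ^ 2 := re_trace_conjTranspose_mul_self_le C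
    _ ≤ (entrySum (C * Bᴴ) * entrySum (B⁻¹)ᴴ) ^ 2 :=
        pow_le_pow_left₀ (entrySum_nonneg _) h4 2
    _ = entrySum (C * Bᴴ) ^ 2 * entrySum (B⁻¹)ᴴ ^ 2 := by ring
    _ ≤ (g ^ 2 * RCLike.re (trace ((C * Bᴴ)ᴴ * (C * Bᴴ)))) *
          (g ^ 2 * RCLike.re (trace (((B⁻¹)ᴴ)ᴴ * (B⁻¹)ᴴ))) :=
        mul_le_mul (entrySum_sq_le _) (entrySum_sq_le _) (sq_nonneg _)
          ((sq_nonneg _).trans (entrySum_sq_le _))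
    _ = _ := by ring

end EntrySum

theorem abs_apply_le_trace {V : Matrix (Fin g) (Fin g) ℝ} (hV : V.PosSemidef) (i j : Fin g) :
    |V i j| ≤ trace V := by
  have hd : ∀ i, V i i ≤ trace V := fun i =>
    Finset.single_le_sum (f := fun i => V i i) (fun _ _ => hV.diag_nonneg) (Finset.mem_univ i)
  have h1 := hd i
  have h2 := hd j
  obtain ⟨B, hB⟩ := exists_conjTranspose_mul_self hV
  have key : |V i j| ≤ (V i i + V j j) / 2 := by
    rw [hB]
    simp only [mul_apply, conjTranspose_apply, star_trivial]
    rw [← Finset.sum_add_distrib, Finset.sum_div]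
    refine (Finset.abs_sum_le_sum_abs _ _).trans (Finset.sum_le_sum fun k _ => ?_)
    rw [abs_mul]
    nlinarith [sq_nonneg (|B k i| - |B k j|), sq_abs (B k i), sq_abs (B k j)]
  linarith

theorem det_le_of_posSemidef {V : Matrix (Fin g) (Fin g) ℝ} (hV : V.PosSemidef) :
    V.det ≤ g.factorial * (1 + trace V) ^ g := by
  have h := Matrix.det_le (A := V) (abv := AbsoluteValue.abs) (x := 1 + trace V) fun i j => by
    have := abs_apply_le_trace hV i j
    change |V i j| ≤ _
    linarith
  have := (le_abs_self V.det).trans h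
  simpa using this

/-- A diagonal cofactor is the determinant of `V` with one row replaced by a unit vector; the entry
bound `1 + Tr V`, rather than `Tr V`, also covers that row. -/
theorem trace_adjugate_le {V : Matrix (Fin g) (Fin g) ℝ} (hV : V.PosSemidef) :
    trace V.adjugate ≤ g * (g.factorial * (1 + trace V) ^ g) := by
  have hτ : 0 ≤ trace V := hV.trace_nonneg
  have h : ∀ i, V.adjugate i i ≤ g.factorial * (1 + trace V) ^ g := fun i => by
    rw [adjugate_apply]
    have h := Matrix.det_le (A := V.updateRow i (Pi.single i 1)) (abv := AbsoluteValue.abs)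
      (x := 1 + trace V) fun a b => by
        change |_| ≤ _
        by_cases ha : a = i
        · subst ha
          rw [updateRow_self, Pi.single_apply]
          split_ifs <;> simp <;> linarith
        · rw [updateRow_ne ha]
          have := abs_apply_le_trace hV a b
          linarith
    have := (le_abs_self _).trans h
    simpa using this
  calc trace V.adjugate = ∑ i, V.adjugate i i := rfl
    _ ≤ ∑ _i : Fin g, (g.factorial * (1 + trace V) ^ g : ℝ) := Finset.sum_le_sum fun i _ => h i
    _ = _ := by simp

theorem det_mul_trace_inv {V : Matrix (Fin g) (Fin g) ℝ} (hV : V.PosDef) :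
    V.det * trace V⁻¹ = trace V.adjugate := by
  rw [Matrix.inv_def, trace_smul, smul_eq_mul, ← mul_assoc, Ring.mul_inverse_cancel _
    hV.det_pos.ne'.isUnit, one_mul]

/-- Take `x = c(1 + τ)` in `x^N / N! ≤ exp x`; the surplus factor `exp c` goes into the constant. -/
theorem exists_pow_mul_exp_neg_le (N : ℕ) {c : ℝ} (hc : 0 < c) :
    ∃ C : ℝ, 0 < C ∧ ∀ τ : ℝ, 0 ≤ τ → (1 + τ) ^ N * Real.exp (-(c * τ)) ≤ C := by
  refine ⟨N.factorial * Real.exp c / c ^ N, by positivity, fun τ hτ => ?_⟩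
  have h := Real.pow_div_factorial_le_exp (c * (1 + τ)) (by positivity) N
  rw [div_le_iff₀ (by positivity), mul_pow] at h
  rw [le_div_iff₀ (by positivity), Real.exp_neg, mul_comm, ← mul_assoc, ← div_eq_mul_inv,
    div_le_iff₀ (Real.exp_pos _)]
  calc c ^ N * (1 + τ) ^ N ≤ Real.exp (c * (1 + τ)) * N.factorial := h
    _ = _ := by rw [mul_add, Real.exp_add, mul_one]; ring

/-! ### A summable majorant for the series -/

/-- The exponential factor absorbs the smallness of the determinant. -/
theorem exists_det_pow_mul_exp_le (s : HalfIntPosDef g) {l₀ l : ℕ} (hl : l₀ ≤ l) :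
    ∃ C : ℝ, 0 < C ∧ ∀ V : Matrix (Fin g) (Fin g) ℝ, V.PosDef →
      V.det ^ l * trace V⁻¹ ^ l₀ * Real.exp (-(2 * Real.pi * trace (s.1 * V))) ≤ C := by
  set K : ℝ := g ^ 4 * trace (s.1)⁻¹ with hK
  have hK0 : 0 ≤ K := mul_nonneg (by positivity) s.2.1.inv.posSemidef.trace_nonneg
  obtain ⟨C, hC0, hC⟩ := exists_pow_mul_exp_neg_le (g * l) (c := 2 * Real.pi / (K + 1))
    (by positivity)
  set A : ℝ := (g + 1) * g.factorial with hA
  have hA0 : 0 < A := by positivity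
  refine ⟨A ^ l * C, by positivity, fun V hV => ?_⟩
  set τ := trace V with hτ
  have hτ0 : 0 ≤ τ := hV.posSemidef.trace_nonneg
  have hdet := hV.det_pos
  have hW := hV.inv.posSemidef.trace_nonneg
  have hsV : 0 ≤ trace (s.1 * V) := by
    obtain ⟨B, hB⟩ := exists_conjTranspose_mul_self hV.posSemidef
    rw [hB, ← Matrix.mul_assoc, trace_mul_comm, ← Matrix.mul_assoc]
    exact (s.2.1.posSemidef.mul_mul_conjTranspose_same B).trace_nonneg
  have hle : τ ≤ (K + 1) * trace (s.1 * V) := by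
    have := re_trace_le_of_posDef s.2.1 hV.posSemidef
    simp only [RCLike.re_to_real] at this
    nlinarith
  have h1 : V.det ≤ A * (1 + τ) ^ g := by
    refine (det_le_of_posSemidef hV.posSemidef).trans ?_
    refine mul_le_mul_of_nonneg_right ?_ (by positivity)
    rw [hA]
    nlinarith [Nat.cast_nonneg (α := ℝ) g, Nat.cast_nonneg (α := ℝ) g.factorial]
  have h2 : V.det * trace V⁻¹ ≤ A * (1 + τ) ^ g := by
    rw [det_mul_trace_inv hV]
    refine (trace_adjugate_le hV.posSemidef).trans ?_
    rw [← mul_assoc]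
    refine mul_le_mul_of_nonneg_right ?_ (by positivity)
    rw [hA]
    nlinarith [Nat.cast_nonneg (α := ℝ) g.factorial]
  -- Each factor `Tr V⁻¹` is paired with one factor `det V` to form the trace of the adjugate; `l₀ ≤
  -- l` ensures that there are enough determinants.
  have h3 : V.det ^ l * trace V⁻¹ ^ l₀ ≤ (A * (1 + τ) ^ g) ^ l := by
    obtain ⟨m, rfl⟩ := Nat.exists_eq_add_of_le hl
    calc V.det ^ (l₀ + m) * trace V⁻¹ ^ l₀ = (V.det * trace V⁻¹) ^ l₀ * V.det ^ m := by ring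
      _ ≤ (A * (1 + τ) ^ g) ^ l₀ * (A * (1 + τ) ^ g) ^ m := by gcongr
      _ = _ := by ring
  have h4 : Real.exp (-(2 * Real.pi * trace (s.1 * V)))
      ≤ Real.exp (-(2 * Real.pi / (K + 1) * τ)) := by
    apply Real.exp_le_exp.2
    have : 2 * Real.pi / (K + 1) * τ ≤ 2 * Real.pi * trace (s.1 * V) := by
      rw [div_mul_eq_mul_div, div_le_iff₀ (by positivity)]
      nlinarith [Real.pi_pos]
    linarith
  calc V.det ^ l * trace V⁻¹ ^ l₀ * Real.exp (-(2 * Real.pi * trace (s.1 * V)))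
      ≤ (A * (1 + τ) ^ g) ^ l * Real.exp (-(2 * Real.pi / (K + 1) * τ)) := by gcongr
    _ = A ^ l * ((1 + τ) ^ (g * l) * Real.exp (-(2 * Real.pi / (K + 1) * τ))) := by
        rw [mul_pow, ← pow_mul]; ring
    _ ≤ A ^ l * C := by gcongr; exact hC τ hτ0

/-- The real part of a matrix. -/
noncomputable abbrev re (z : Matrix (Fin g) (Fin g) ℂ) : Matrix (Fin g) (Fin g) ℝ :=
  z.map Complex.re

/-- The size of the bottom row of a symplectic matrix. -/
noncomputable def bottomSize (γ : Gam g) : ℝ :=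
  entrySum (γ.1.toBlocks₂₁.map (Int.cast : ℤ → ℝ)) +
    entrySum (γ.1.toBlocks₂₂.map (Int.cast : ℤ → ℝ))

theorem im_denom (γ : Gam g) (z : Matrix (Fin g) (Fin g) ℂ) :
    im (denom γ z) = γ.1.toBlocks₂₁.map (Int.cast : ℤ → ℝ) * im z := by
  ext i j
  simp [denom, blockC, blockD, mul_apply]

theorem re_denom (γ : Gam g) (z : Matrix (Fin g) (Fin g) ℂ) :
    re (denom γ z) = γ.1.toBlocks₂₁.map (Int.cast : ℤ → ℝ) * re z
      + γ.1.toBlocks₂₂.map (Int.cast : ℤ → ℝ) := by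
  ext i j
  simp [denom, blockC, blockD, mul_apply]

theorem entrySum_im_le (A : Matrix (Fin g) (Fin g) ℂ) : entrySum (im A) ≤ entrySum A :=
  Finset.sum_le_sum fun _ _ => Finset.sum_le_sum fun _ _ => Complex.abs_im_le_norm _

theorem entrySum_re_le (A : Matrix (Fin g) (Fin g) ℂ) : entrySum (re A) ≤ entrySum A :=
  Finset.sum_le_sum fun _ _ => Finset.sum_le_sum fun _ _ => Complex.abs_re_le_norm _

theorem entrySum_neg {𝕜 : Type*} [RCLike 𝕜] (A : Matrix (Fin g) (Fin g) 𝕜) :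
    entrySum (-A) = entrySum A := by simp [entrySum]

/-- Both blocks are recovered from `cz+d`: with `z = x + iy`, `c = Im(cz+d) y⁻¹` and `d = Re(cz+d) -
cx`. -/
theorem bottomSize_le (γ : Gam g) {z : Matrix (Fin g) (Fin g) ℂ}
    (hz : z ∈ siegelUpperHalfSpace g) :
    bottomSize γ ≤ entrySum (denom γ z) * (1 + entrySum (im z)⁻¹ * (1 + entrySum (re z))) := by
  set c := γ.1.toBlocks₂₁.map (Int.cast : ℤ → ℝ) with hc
  set d := γ.1.toBlocks₂₂.map (Int.cast : ℤ → ℝ) with hd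
  have hyd : IsUnit (im z).det := hz.2.det_pos.ne'.isUnit
  have h1 : entrySum c ≤ entrySum (denom γ z) * entrySum (im z)⁻¹ := by
    have : c = im (denom γ z) * (im z)⁻¹ := by
      rw [im_denom, Matrix.mul_assoc, Matrix.mul_nonsing_inv _ hyd, Matrix.mul_one]
    conv_lhs => rw [this]
    refine (entrySum_mul_le _ _).trans ?_
    exact mul_le_mul_of_nonneg_right (entrySum_im_le _) (entrySum_nonneg _)
  have h2 : entrySum d ≤ entrySum (denom γ z) + entrySum c * entrySum (re z) := by
    have : d = re (denom γ z) + -(c * re z) := by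
      rw [re_denom]; abel
    conv_lhs => rw [this]
    refine (entrySum_add_le _ _).trans (add_le_add (entrySum_re_le _) ?_)
    rw [entrySum_neg]
    exact entrySum_mul_le _ _
  have h3 : entrySum c * entrySum (re z)
      ≤ entrySum (denom γ z) * entrySum (im z)⁻¹ * entrySum (re z) :=
    mul_le_mul_of_nonneg_right h1 (entrySum_nonneg _)
  calc bottomSize γ = entrySum c + entrySum d := rfl
    _ ≤ _ := by linarith

/-- By `inv_im_act`, `Tr (Im γz)⁻¹` equals `Tr(y⁻¹ DᴴD)` with `D = cz+d` and `y = Im z`; coercivity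
for the form `y⁻¹` then bounds `Tr(DᴴD)`. -/
theorem entrySum_denom_sq_le (γ : Gam g) {z : Matrix (Fin g) (Fin g) ℂ}
    (hz : z ∈ siegelUpperHalfSpace g) :
    entrySum (denom γ z) ^ 2 ≤ g ^ 6 * trace (im z) * trace (im (act γ z))⁻¹ := by
  have hy := imC_posDef hz
  have h1 := re_trace_le_of_posDef hy.inv (posSemidef_conjTranspose_mul_self (denom γ z))
  have hyd : IsUnit (imC z).det := (Matrix.isUnit_iff_isUnit_det _).1 hy.isUnit
  rw [Matrix.nonsing_inv_nonsing_inv _ hyd] at h1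
  have h2 : RCLike.re (trace (imC z)) = trace (im z) := by
    simp [trace, imC]
  have h3 : RCLike.re (trace ((imC z)⁻¹ * ((denom γ z)ᴴ * denom γ z)))
      = trace (im (act γ z))⁻¹ := by
    rw [← Matrix.mul_assoc, trace_mul_comm, ← Matrix.mul_assoc, ← inv_im_act γ hz]
    simp [trace]
  rw [h2, h3] at h1
  calc entrySum (denom γ z) ^ 2 ≤ g ^ 2 * RCLike.re (trace ((denom γ z)ᴴ * denom γ z)) :=
        entrySum_sq_le _
    _ ≤ g ^ 2 * (g ^ 4 * trace (im z) * trace (im (act γ z))⁻¹) := by gcongr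
    _ = _ := by ring

theorem norm_summand (s : HalfIntPosDef g) (l : ℕ) (γ : Gam g) {z : Matrix (Fin g) (Fin g) ℂ}
    (hz : z ∈ siegelUpperHalfSpace g) :
    ‖summand s (2 * l) z γ‖ = ((im z).det ^ l)⁻¹ * ((im (act γ z)).det ^ l *
      Real.exp (-(2 * Real.pi * trace (s.1 * im (act γ z))))) := by
  have h0 := (isUnit_det_denom γ hz).ne_zero
  have h1 := norm_det_denom_sq_mul γ hz
  have hd := (act_mem γ hz).2.det_pos
  have hn : 0 < ‖(denom γ z).det‖ := norm_pos_iff.2 h0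
  have him : (trace (s.1.map Complex.ofReal * act γ z)).im = trace (s.1 * im (act γ z)) := by
    simp [trace, mul_apply]
  rw [summand, norm_mul, norm_e, him, norm_zpow, ← mul_assoc]
  congr 1
  rw [← h1, _root_.zpow_neg, zpow_natCast, pow_mul, mul_pow]
  field_simp

/-- The factor depending on `z` in the bound of the summands. -/
noncomputable def growth (l₀ l : ℕ) (z : Matrix (Fin g) (Fin g) ℂ) : ℝ :=
  ((im z).det ^ l)⁻¹ *
    (g ^ 6 * trace (im z) * (1 + entrySum (im z)⁻¹ * (1 + entrySum (re z))) ^ 2) ^ l₀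

theorem one_le_bottomSize (hg : 1 ≤ g) (γ : Gam g) : 1 ≤ bottomSize γ := by
  have hne : γ.1.toBlocks₂₁ ≠ 0 ∨ γ.1.toBlocks₂₂ ≠ 0 := by
    by_contra! h
    have h1 := (block_relations γ).2.2
    rw [blockC, blockD, h.1, h.2] at h1
    have := congrFun (congrFun h1 ⟨0, hg⟩) ⟨0, hg⟩
    simp [Matrix.map_zero] at this
  have key : ∀ A : Matrix (Fin g) (Fin g) ℤ, A ≠ 0 → 1 ≤ entrySum (A.map (Int.cast : ℤ → ℝ)) := by
    intro A hA
    obtain ⟨i, j, hij⟩ : ∃ i j, A i j ≠ 0 := by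
      by_contra! h
      exact hA (by ext i j; simp [h])
    refine le_trans ?_ (norm_apply_le_entrySum _ i j)
    simp only [map_apply, Real.norm_eq_abs, ← Int.cast_abs]
    exact_mod_cast Int.one_le_abs hij
  rcases hne with h | h
  · have := key _ h
    have := entrySum_nonneg (γ.1.toBlocks₂₂.map (Int.cast : ℤ → ℝ))
    unfold bottomSize; linarith
  · have := key _ h
    have := entrySum_nonneg (γ.1.toBlocks₂₁.map (Int.cast : ℤ → ℝ))
    unfold bottomSize; linarith

theorem exists_norm_summand_le (hg : 1 ≤ g) (s : HalfIntPosDef g) {l₀ l : ℕ} (hl : l₀ ≤ l) :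
    ∃ C : ℝ, 0 < C ∧ ∀ γ : Gam g, ∀ z ∈ siegelUpperHalfSpace g,
      ‖summand s (2 * l) z γ‖ ≤ C * growth l₀ l z * ((bottomSize γ ^ (2 * l₀))⁻¹) := by
  obtain ⟨C, hC0, hC⟩ := exists_det_pow_mul_exp_le s hl
  refine ⟨C, hC0, fun γ z hz => ?_⟩
  rw [norm_summand s l γ hz]
  have hy := hz.2.det_pos
  have hV := (act_mem γ hz).2
  have hW : 0 < trace (im (act γ z))⁻¹ := by
    have : Nonempty (Fin g) := ⟨⟨0, hg⟩⟩
    exact hV.inv.trace_pos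
  have hb := one_le_bottomSize hg γ
  set b := bottomSize γ
  set W := trace (im (act γ z))⁻¹
  set ρ := 1 + entrySum (im z)⁻¹ * (1 + entrySum (re z))
  -- A large bottom row makes `W = Tr (Im γz)⁻¹` large, so the inverse powers of `W` supplied by the
  -- exponential become inverse powers of `b`.
  have h1 : b ^ 2 ≤ g ^ 6 * trace (im z) * ρ ^ 2 * W := by
    calc b ^ 2 ≤ (entrySum (denom γ z) * ρ) ^ 2 :=
          pow_le_pow_left₀ (by linarith) (bottomSize_le γ hz) 2
      _ = entrySum (denom γ z) ^ 2 * ρ ^ 2 := by ring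
      _ ≤ (g ^ 6 * trace (im z) * W) * ρ ^ 2 := by
          gcongr; exact entrySum_denom_sq_le γ hz
      _ = _ := by ring
  have h2 : (b ^ (2 * l₀)) ≤ (g ^ 6 * trace (im z) * ρ ^ 2) ^ l₀ * W ^ l₀ := by
    rw [pow_mul, ← mul_pow]
    exact pow_le_pow_left₀ (by positivity) h1 _
  have h3 := hC _ hV
  have h4 : C * growth l₀ l z * (b ^ (2 * l₀))⁻¹ = ((im z).det ^ l)⁻¹ *
      ((g ^ 6 * trace (im z) * ρ ^ 2) ^ l₀ * (C * (b ^ (2 * l₀))⁻¹)) := by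
    rw [growth]; ring
  rw [h4]
  refine mul_le_mul_of_nonneg_left ?_ (by positivity)
  rw [← mul_assoc, ← div_eq_mul_inv, le_div_iff₀ (by positivity)]
  have hVd := hV.det_pos
  calc _ ≤ (im (act γ z)).det ^ l * Real.exp (-(2 * Real.pi * trace (s.1 * im (act γ z))))
        * ((g ^ 6 * trace (im z) * ρ ^ 2) ^ l₀ * W ^ l₀) := by gcongr
    _ = (g ^ 6 * trace (im z) * ρ ^ 2) ^ l₀ * ((im (act γ z)).det ^ l * W ^ l₀ *
          Real.exp (-(2 * Real.pi * trace (s.1 * im (act γ z))))) := by ring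
    _ ≤ (g ^ 6 * trace (im z) * ρ ^ 2) ^ l₀ * C := by
        have : 0 ≤ trace (im z) := hz.2.posSemidef.trace_nonneg
        gcongr

/-- A finite partial sum is enlarged to a sum over a product of finite sets, which factors into
one-variable sums. -/
theorem summable_pi_prod {ι : Type*} [Fintype ι] {f : ℤ → ℝ} (h0 : ∀ n, 0 ≤ f n)
    (hf : Summable f) : Summable fun n : ι → ℤ => ∏ i, f (n i) := by
  classical
  refine summable_of_sum_le (c := ∏ _i : ι, ∑' n, f n)
    (fun n => Finset.prod_nonneg fun i _ => h0 (n i)) fun u => ?_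
  calc ∑ n ∈ u, ∏ i, f (n i)
      ≤ ∑ n ∈ Fintype.piFinset fun i => u.image fun n => n i, ∏ i, f (n i) := by
        refine Finset.sum_le_sum_of_subset_of_nonneg (fun n hn => ?_)
          fun n _ _ => Finset.prod_nonneg fun i _ => h0 _
        rw [Fintype.mem_piFinset]
        exact fun i => Finset.mem_image_of_mem _ hn
    _ = ∏ i, ∑ m ∈ u.image (fun n => n i), f m := by
        rw [Finset.prod_univ_sum]
    _ ≤ _ := Finset.prod_le_prod (fun i _ => Finset.sum_nonneg fun _ _ => h0 _)
        fun i _ => hf.sum_le_tsum _ fun _ _ => h0 _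

theorem summable_one_add_abs_inv_sq : Summable fun n : ℤ => ((1 + |(n : ℝ)|) ^ 2)⁻¹ := by
  have h : Summable fun n : ℕ => ((1 + |(n : ℝ)|) ^ 2)⁻¹ := by
    have := (summable_nat_add_iff 1).2 (Real.summable_nat_pow_inv (p := 2) |>.2 one_lt_two)
    refine this.congr fun n => ?_
    rw [Nat.abs_cast]; push_cast; ring_nf
  exact Summable.of_nat_of_neg (by simpa using h) (by simpa using h)

/-- The pair `(c, d)` has `2g²` integral coordinates, each at most `b = bottomSize` in absolute
value. As `b ≥ 1`, `(1 + |n|)² ≤ 4b²` for every coordinate `n`, so a factor `b⁻²` per coordinate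
gives a product of summable one-variable terms. This is the origin of the exponent `2 · 2g²`. -/
theorem summable_bottomSize (hg : 1 ≤ g) :
    Summable fun q : Cosets g => (bottomSize q.out ^ (2 * (2 * g ^ 2)))⁻¹ := by
  let ι := (Fin g × Fin g) ⊕ (Fin g × Fin g)
  let φ : Cosets g → ι → ℤ := fun q =>
    Sum.elim (fun x => (bottomRow q).1 x.1 x.2) (fun x => (bottomRow q).2 x.1 x.2)
  have hφ : Function.Injective φ := by
    intro q r h
    apply bottomRow_injective
    refine Prod.ext ?_ ?_
    · ext i j; exact congrFun h (Sum.inl (i, j))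
    · ext i j; exact congrFun h (Sum.inr (i, j))
  have h1 := (summable_pi_prod (ι := ι) (f := fun n : ℤ => ((1 + |(n : ℝ)|) ^ 2)⁻¹)
    (fun n => by positivity)
    summable_one_add_abs_inv_sq).comp_injective hφ
  refine Summable.of_nonneg_of_le (fun q => ?_) (fun q => ?_)
    (h1.mul_left ((4 : ℝ) ^ Fintype.card ι))
  · have := one_le_bottomSize hg q.out
    positivity
  · have hb := one_le_bottomSize hg q.out
    set b := bottomSize q.out with hbdef
    have h2 : ∀ i, |(φ q i : ℝ)| ≤ b := by
      rintro (⟨i, j⟩ | ⟨i, j⟩)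
      · have h3 := norm_apply_le_entrySum (q.out.1.toBlocks₂₁.map (Int.cast : ℤ → ℝ)) i j
        have h4 := entrySum_nonneg (q.out.1.toBlocks₂₂.map (Int.cast : ℤ → ℝ))
        rw [hbdef, bottomSize]
        exact h3.trans (by linarith)
      · have h3 := norm_apply_le_entrySum (q.out.1.toBlocks₂₂.map (Int.cast : ℤ → ℝ)) i j
        have h4 := entrySum_nonneg (q.out.1.toBlocks₂₁.map (Int.cast : ℤ → ℝ))
        rw [hbdef, bottomSize]
        exact h3.trans (by linarith)
    have hcard : 2 * g ^ 2 = Fintype.card ι := by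
      simp [ι]; ring
    rw [hcard, pow_mul, ← inv_pow]
    have : ((b ^ 2)⁻¹) ^ Fintype.card ι = ∏ _i : ι, (b ^ 2)⁻¹ := by simp
    rw [this, ← Finset.card_univ, ← Finset.prod_const, Function.comp_apply,
      ← Finset.prod_mul_distrib]
    refine Finset.prod_le_prod (fun i _ => by positivity) fun i _ => ?_
    have h5 := h2 i
    rw [← div_eq_mul_inv, inv_le_comm₀ (by positivity) (by positivity), inv_div,
      div_le_iff₀ (by norm_num)]
    nlinarith [abs_nonneg (φ q i : ℝ)]

/-- Uniform bound of the summands by a summable sequence. -/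
theorem exists_norm_cosetSummand_le (hg : 1 ≤ g) (s : HalfIntPosDef g) {l : ℕ}
    (hl : 2 * g ^ 2 ≤ l) :
    ∃ b : Cosets g → ℝ, Summable b ∧ (∀ q, 0 ≤ b q) ∧ ∀ q, ∀ z ∈ siegelUpperHalfSpace g,
      ‖cosetSummand s (2 * l) z q‖ ≤ growth (2 * g ^ 2) l z * b q := by
  obtain ⟨C, hC0, hC⟩ := exists_norm_summand_le hg s hl
  refine ⟨fun q => C * (bottomSize q.out ^ (2 * (2 * g ^ 2)))⁻¹,
    (summable_bottomSize hg).mul_left C, fun q => ?_, fun q z hz => ?_⟩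
  · have := one_le_bottomSize hg q.out
    positivity
  · refine (hC q.out z hz).trans (le_of_eq ?_)
    ring

/-! ### The lower bound for `|det(cz+d)|` at imaginary part `1` -/

section DetAdd

variable {ι : Type*} [Fintype ι] [DecidableEq ι]

theorem det_one_add_of_isHermitian {R : Matrix ι ι ℝ} (hR : R.IsHermitian) :
    (1 + R).det = ∏ i, (1 + hR.eigenvalues i) := by
  have h := hR.spectral_theorem
  rw [Unitary.conjStarAlgAut_apply] at h
  set U := (hR.eigenvectorUnitary : Matrix ι ι ℝ) with hU
  have hUU : U * star U = 1 := Unitary.coe_mul_star_self hR.eigenvectorUnitary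
  have h1 : 1 + R = U * (1 + diagonal hR.eigenvalues) * star U := by
    rw [mul_add, add_mul, mul_one, hUU]
    congr 1
  have h2 : (1 : Matrix ι ι ℝ) + diagonal hR.eigenvalues
      = diagonal fun i => 1 + hR.eigenvalues i := by
    rw [← diagonal_one, diagonal_add]
  rw [h1, det_mul, det_mul, mul_right_comm, ← det_mul, hUU, det_one, one_mul, h2, det_diagonal]

theorem one_le_det_one_add {R : Matrix ι ι ℝ} (hR : R.PosSemidef) :
    1 ≤ (1 + R).det ∧ ((1 + R).det = 1 → R = 0) := by
  rw [det_one_add_of_isHermitian hR.1]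
  have h0 : ∀ i, 0 ≤ hR.1.eigenvalues i := hR.eigenvalues_nonneg
  have h1 : ∀ i, 1 ≤ 1 + hR.1.eigenvalues i := fun i => by linarith [h0 i]
  have h2 : ∀ j, 1 + hR.1.eigenvalues j ≤ ∏ i, (1 + hR.1.eigenvalues i) := fun j => by
    rw [← Finset.mul_prod_erase Finset.univ _ (Finset.mem_univ j)]
    exact le_mul_of_one_le_right (by linarith [h0 j]) (Finset.one_le_prod fun i _ => h1 i)
  refine ⟨Finset.one_le_prod fun i _ => h1 i, fun h => ?_⟩
  rw [← hR.trace_eq_zero_iff, hR.1.trace_eq_sum_eigenvalues]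
  refine Finset.sum_eq_zero fun i _ => ?_
  have := h2 i
  rw [h] at this
  have h3 : hR.1.eigenvalues i = 0 := le_antisymm (by linarith) (h0 i)
  simp [h3]

/-- Writing `P = BᴴB` and conjugating by `B⁻¹` reduces to `P = 1`, where the determinant is a
product of factors `1 + λ` with `λ ≥ 0`. The equality case is needed to locate the points where
`|det(cz+d)| = 1`. -/
theorem det_le_det_add {P Q : Matrix ι ι ℝ} (hP : P.PosDef) (hQ : Q.PosSemidef) :
    P.det ≤ (P + Q).det ∧ ((P + Q).det = P.det → Q = 0) := by
  obtain ⟨B, hB, rfl⟩ := exists_isUnit_conjTranspose_mul_self hP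
  have hBd : IsUnit B.det := (Matrix.isUnit_iff_isUnit_det _).1 hB
  have hBi : Bᴴ * (B⁻¹)ᴴ = 1 := by
    rw [← conjTranspose_mul, Matrix.nonsing_inv_mul _ hBd, conjTranspose_one]
  have hR : ((B⁻¹)ᴴ * Q * B⁻¹).PosSemidef := hQ.conjTranspose_mul_mul_same _
  have h1 : Bᴴ * ((B⁻¹)ᴴ * Q * B⁻¹) * B = Q := by
    calc Bᴴ * ((B⁻¹)ᴴ * Q * B⁻¹) * B = (Bᴴ * (B⁻¹)ᴴ) * Q * (B⁻¹ * B) := by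
          simp only [Matrix.mul_assoc]
      _ = Q := by rw [hBi, Matrix.nonsing_inv_mul _ hBd, Matrix.one_mul, Matrix.mul_one]
  have h2 : (Bᴴ * B + Q).det = (Bᴴ * B).det * (1 + (B⁻¹)ᴴ * Q * B⁻¹).det := by
    have : Bᴴ * B + Q = Bᴴ * (1 + (B⁻¹)ᴴ * Q * B⁻¹) * B := by
      rw [mul_add, add_mul, h1, mul_one]
    rw [this, det_mul, det_mul, det_mul]; ring
  obtain ⟨h3, h4⟩ := one_le_det_one_add hR
  have hpos := hP.det_pos
  rw [h2]
  refine ⟨le_mul_of_one_le_right hpos.le h3, fun h => ?_⟩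
  have h5 := h4 ((mul_eq_left₀ hpos.ne').1 h)
  rw [← h1, h5]
  simp

end DetAdd

/-- A unimodular change of rows adapted to the left kernel of an integral matrix. -/
theorem exists_unimodular_adapted (c : Matrix (Fin g) (Fin g) ℤ) :
    ∃ (ι κ : Type) (_ : Fintype ι) (_ : Fintype κ) (_ : DecidableEq ι) (_ : DecidableEq κ)
      (U : Matrix (ι ⊕ κ) (Fin g) ℤ) (U' : Matrix (Fin g) (ι ⊕ κ) ℤ),
      U * U' = 1 ∧ U' * U = 1 ∧ (∀ k j, (U * c) (Sum.inr k) j = 0) ∧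
      ∀ w : ι → ℤ, w ᵥ* (U * c).toRows₁ = 0 → w = 0 := by
  classical
  let f : (Fin g → ℤ) →ₗ[ℤ] (Fin g → ℤ) := c.vecMulLinear
  -- The image of `v ↦ vc` is a submodule of a free `ℤ`-module, hence free, so this map onto its
  -- image splits and `ℤ^g` is image plus kernel. Bases of the two summands give the rows of `U`.
  obtain ⟨s, hs⟩ := Module.projective_lifting_property f.rangeRestrict LinearMap.id
    f.surjective_rangeRestrict
  have hs' : ∀ r : LinearMap.range f, f (s r) = r := fun r => by
    have := LinearMap.congr_fun hs r
    simpa using congrArg Subtype.val this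
  let E : (LinearMap.range f × LinearMap.ker f) ≃ₗ[ℤ] (Fin g → ℤ) :=
    { toFun := fun p => s p.1 + p.2
      map_add' := fun p q => by simp; abel
      map_smul' := fun a p => by simp
      invFun := fun v => (f.rangeRestrict v, ⟨v - s (f.rangeRestrict v), by
        rw [LinearMap.mem_ker, map_sub, hs']; simp⟩)
      left_inv := fun ⟨r, k⟩ => by
        have hk : f k = 0 := k.2
        have h1 : f.rangeRestrict (s r + k) = r := by
          apply Subtype.ext
          simp [hs', hk]
        refine Prod.ext h1 (Subtype.ext ?_)
        simp only [h1]
        abel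
      right_inv := fun v => by simp }
  let bR := Module.Free.chooseBasis ℤ (LinearMap.range f)
  let bK := Module.Free.chooseBasis ℤ (LinearMap.ker f)
  let b := (bR.prod bK).map E
  have hU : ∀ i, (fun j => ((Pi.basisFun ℤ (Fin g)).toMatrix b)ᵀ i j) = b i := fun i => by
    ext j; simp [Module.Basis.toMatrix_apply]
  have hrow : ∀ i, (((Pi.basisFun ℤ (Fin g)).toMatrix b)ᵀ * c) i = f (b i) := fun i => by
    rw [← hU i]
    rfl
  refine ⟨_, _, inferInstance, inferInstance, Classical.decEq _, Classical.decEq _,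
    ((Pi.basisFun ℤ (Fin g)).toMatrix b)ᵀ, (b.toMatrix (Pi.basisFun ℤ (Fin g)))ᵀ, ?_, ?_, ?_, ?_⟩
  · rw [← transpose_mul, Module.Basis.toMatrix_mul_toMatrix_flip]
    convert transpose_one
  · rw [← transpose_mul, Module.Basis.toMatrix_mul_toMatrix_flip, transpose_one]
  · intro k j
    rw [hrow]
    have : f (b (Sum.inr k)) = 0 := by
      have h1 : b (Sum.inr k) = bK k := by simp [b, E]
      rw [h1]
      exact (bK k).2
    rw [this]; rfl
  · intro w hw
    have h1 : ∀ i, f (b (Sum.inl i)) = bR i := fun i => by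
      have h1 : b (Sum.inl i) = s (bR i) := by simp [b, E]
      rw [h1, hs']
    have h2 : ∑ i, w i • bR i = 0 := by
      apply Subtype.ext
      rw [Submodule.coe_sum]
      refine Eq.trans ?_ hw
      ext j
      simp only [SetLike.val_smul, vecMul, dotProduct, Finset.sum_apply, Pi.smul_apply, smul_eq_mul]
      refine Finset.sum_congr rfl fun i _ => ?_
      rw [← h1 i, ← hrow]
      rfl
    exact funext (Fintype.linearIndependent_iff.1 bR.linearIndependent w h2)

theorem one_le_of_int_det {n : Type*} [Fintype n] [DecidableEq n] {A : Matrix n n ℤ}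
    (h : 0 < (A.map (Int.cast : ℤ → ℝ)).det) : 1 ≤ (A.map (Int.cast : ℤ → ℝ)).det := by
  have h1 : (A.map (Int.cast : ℤ → ℝ)).det = (A.det : ℝ) :=
    ((Int.castRingHom ℝ).map_det A).symm
  rw [h1] at h ⊢
  exact_mod_cast h

theorem map_intCast_mul {l m n : Type*} [Fintype m] (A : Matrix l m ℤ) (B : Matrix m n ℤ) :
    (A * B).map (Int.cast : ℤ → ℝ) = A.map (Int.cast : ℤ → ℝ) * B.map (Int.cast : ℤ → ℝ) :=
  Matrix.map_mul (f := Int.castRingHom ℝ)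

/-- The Gram matrix of the bottom row `(c, cx + d)`. -/
noncomputable def gramDenom (c d x : Matrix (Fin g) (Fin g) ℝ) : Matrix (Fin g) (Fin g) ℝ :=
  c * cᵀ + (c * x + d) * (c * x + d)ᵀ

/-- A unimodular `U` brings `(c, d)` to rows `(c₁, d₁)` and `(0, d₂)`, with `c₁` of independent rows
and `c₁ ᵗd₂ = 0`. Put `M₁ = c₁x + d₁` and let `Pr` be the orthogonal projection away from the rows
of `d₂`. A Schur complement gives the determinant as `det(d₂ ᵗd₂) · det(c₁ ᵗc₁ + M₁ Pr ᵗM₁)`. The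
Gram determinants of `d₂` and `c₁` are positive integers, and the semidefinite term cannot decrease
the second factor. If the product is `1` then `M₁ Pr = 0`, hence `M₁ ᵗc₁ = 0`; one diagonal entry of
this is the required affine equation in `x`. -/
theorem one_le_det_gramDenom {c d : Matrix (Fin g) (Fin g) ℤ} (hcd : c * dᵀ = d * cᵀ)
    (hpos : ∀ x : Matrix (Fin g) (Fin g) ℝ, x.IsSymm →
      (gramDenom (c.map (Int.cast : ℤ → ℝ)) (d.map (Int.cast : ℤ → ℝ)) x).PosDef) :
    (∀ x : Matrix (Fin g) (Fin g) ℝ, x.IsSymm →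
      1 ≤ (gramDenom (c.map (Int.cast : ℤ → ℝ)) (d.map (Int.cast : ℤ → ℝ)) x).det) ∧
    (c ≠ 0 → ∃ v : Fin g → ℝ, v ≠ 0 ∧ ∃ r : ℝ, ∀ x : Matrix (Fin g) (Fin g) ℝ, x.IsSymm →
      (gramDenom (c.map (Int.cast : ℤ → ℝ)) (d.map (Int.cast : ℤ → ℝ)) x).det ≤ 1 → v ⬝ᵥ x *ᵥ v = r) := by
  obtain ⟨ι, κ, _, _, _, _, U, U', hUU', hU'U, hker, hindep⟩ := exists_unimodular_adapted c
  set c₁ := (U * c).toRows₁ with hc₁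
  set d₁ := (U * d).toRows₁ with hd₁
  set d₂ := (U * d).toRows₂ with hd₂
  have hUc : U * c = fromRows c₁ 0 := by
    rw [← fromRows_toRows (U * c)]
    congr 1
    ext k j
    exact hker k j
  have hUd : U * d = fromRows d₁ d₂ := (fromRows_toRows (U * d)).symm
  have horth : c₁ * d₂ᵀ = 0 := by
    have h1 : (U * c) * (U * d)ᵀ = (U * d) * (U * c)ᵀ := by
      rw [transpose_mul, transpose_mul, Matrix.mul_assoc, Matrix.mul_assoc, ← Matrix.mul_assoc c,
        ← Matrix.mul_assoc d, hcd]
    rw [hUc, hUd, transpose_fromRows, transpose_fromRows, fromRows_mul_fromCols,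
      fromRows_mul_fromCols, fromBlocks_inj] at h1
    have h2 := h1.2.1
    simpa using h2
  set C₁ : Matrix ι (Fin g) ℝ := c₁.map (Int.cast : ℤ → ℝ) with hC₁
  set D₁ : Matrix ι (Fin g) ℝ := d₁.map (Int.cast : ℤ → ℝ) with hD₁
  set D₂ : Matrix κ (Fin g) ℝ := d₂.map (Int.cast : ℤ → ℝ) with hD₂
  set V : Matrix (ι ⊕ κ) (Fin g) ℝ := U.map (Int.cast : ℤ → ℝ) with hV
  set V' : Matrix (Fin g) (ι ⊕ κ) ℝ := U'.map (Int.cast : ℤ → ℝ) with hV'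
  have hVV' : V * V' = 1 := by
    rw [hV, hV', ← map_intCast_mul, hUU']; ext; simp [one_apply]
  have hV'V : V' * V = 1 := by
    rw [hV, hV', ← map_intCast_mul, hU'U]; ext; simp [one_apply]
  have horthR : C₁ * D₂ᵀ = 0 := by
    rw [hC₁, hD₂, ← transpose_map, ← map_intCast_mul, horth]; ext; simp
  have horthR' : D₂ * C₁ᵀ = 0 := by
    have := congrArg Matrix.transpose horthR
    simpa using this
  have hVc : V * c.map (Int.cast : ℤ → ℝ) = fromRows C₁ 0 := by
    rw [hV, ← map_intCast_mul, hUc]; ext (i | i) j <;> simp [hC₁]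
  have hVd : V * d.map (Int.cast : ℤ → ℝ) = fromRows D₁ D₂ := by
    rw [hV, ← map_intCast_mul, hUd]; ext (i | i) j <;> simp [hD₁, hD₂]
  -- Rows and columns of `V` have different index types, so `V` itself has no determinant. Instead
  -- `ᵗV V` and its inverse `V' ᵗV'` have positive integral determinants with product `1`.
  have hdetV : (Vᵀ * V).det = 1 := by
    have h1 : (Vᵀ * V) = (Uᵀ * U).map (Int.cast : ℤ → ℝ) := by
      rw [map_intCast_mul, hV, transpose_map]
    have h2 : (Vᵀ * V) * (V' * V'ᵀ) = 1 := by
      calc (Vᵀ * V) * (V' * V'ᵀ) = Vᵀ * (V * V') * V'ᵀ := by simp only [Matrix.mul_assoc]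
        _ = 1 := by rw [hVV', Matrix.mul_one, ← transpose_mul, hV'V, transpose_one]
    have h3 : (V' * V'ᵀ) = (U' * U'ᵀ).map (Int.cast : ℤ → ℝ) := by
      rw [map_intCast_mul, hV', transpose_map]
    have h4 : (Vᵀ * V).det * (V' * V'ᵀ).det = 1 := by rw [← det_mul, h2, det_one]
    have p1 : 0 ≤ (Vᵀ * V).det := by
      have := (posSemidef_conjTranspose_mul_self V).det_nonneg
      rwa [conjTranspose_eq_transpose_of_trivial] at this
    have p2 : 0 ≤ (V' * V'ᵀ).det := by
      have := (posSemidef_self_mul_conjTranspose V').det_nonneg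
      rwa [conjTranspose_eq_transpose_of_trivial] at this
    have q1 : 0 < (Vᵀ * V).det := p1.lt_of_ne fun h => by rw [← h] at h4; simp at h4
    have q2 : 0 < (V' * V'ᵀ).det := p2.lt_of_ne fun h => by rw [← h] at h4; simp at h4
    have r1 : 1 ≤ (Vᵀ * V).det := by rw [h1] at q1 ⊢; exact one_le_of_int_det q1
    have r2 : 1 ≤ (V' * V'ᵀ).det := by rw [h3] at q2 ⊢; exact one_le_of_int_det q2
    nlinarith
  have hP : (C₁ * C₁ᵀ).PosDef := by
    have h1 : (C₁ * C₁ᵀ).PosSemidef := by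
      have := posSemidef_self_mul_conjTranspose C₁
      rwa [conjTranspose_eq_transpose_of_trivial] at this
    rw [h1.posDef_iff_det_ne_zero]
    have h2 : C₁ * C₁ᵀ = (c₁ * c₁ᵀ).map (Int.cast : ℤ → ℝ) := by
      rw [map_intCast_mul, hC₁, transpose_map]
    have h3 : ((c₁ * c₁ᵀ).map (Int.cast : ℤ → ℝ)).det = ((c₁ * c₁ᵀ).det : ℝ) :=
      ((Int.castRingHom ℝ).map_det _).symm
    rw [h2, h3]
    intro h4
    have h5 : (c₁ * c₁ᵀ).det = 0 := by exact_mod_cast h4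
    obtain ⟨w, hw, hw0⟩ := Matrix.exists_vecMul_eq_zero_iff.2 h5
    apply hw
    apply hindep
    have h6 : (w ᵥ* c₁) ⬝ᵥ (w ᵥ* c₁) = 0 := by
      have h7 : (w ᵥ* (c₁ * c₁ᵀ)) ⬝ᵥ w = 0 := by rw [hw0, zero_dotProduct]
      rwa [← vecMul_vecMul, ← dotProduct_mulVec, mulVec_transpose] at h7
    exact dotProduct_self_eq_zero.1 h6
  have hdetP : 1 ≤ (C₁ * C₁ᵀ).det := by
    have h2 : C₁ * C₁ᵀ = (c₁ * c₁ᵀ).map (Int.cast : ℤ → ℝ) := by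
      rw [map_intCast_mul, hC₁, transpose_map]
    have := hP.det_pos
    rw [h2] at this ⊢
    exact one_le_of_int_det this
  have main : ∀ x : Matrix (Fin g) (Fin g) ℝ, x.IsSymm →
      1 ≤ (gramDenom (c.map (Int.cast : ℤ → ℝ)) (d.map (Int.cast : ℤ → ℝ)) x).det ∧
      ((gramDenom (c.map (Int.cast : ℤ → ℝ)) (d.map (Int.cast : ℤ → ℝ)) x).det ≤ 1 →
        (C₁ * x + D₁) * C₁ᵀ = 0) := by
    intro x hx
    set W := gramDenom (c.map (Int.cast : ℤ → ℝ)) (d.map (Int.cast : ℤ → ℝ)) x with hW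
    set M₁ := C₁ * x + D₁ with hM₁
    have hVM : V * (c.map (Int.cast : ℤ → ℝ) * x + d.map (Int.cast : ℤ → ℝ)) = fromRows M₁ D₂ := by
      rw [Matrix.mul_add, ← Matrix.mul_assoc, hVc, hVd, fromRows_mul]
      ext (i | i) j <;> simp [hM₁]
    have hblock : V * W * Vᵀ = fromBlocks (C₁ * C₁ᵀ + M₁ * M₁ᵀ) (M₁ * D₂ᵀ) (D₂ * M₁ᵀ)
        (D₂ * D₂ᵀ) := by
      have h1 : V * W * Vᵀ = (V * c.map (Int.cast : ℤ → ℝ)) * (V * c.map (Int.cast : ℤ → ℝ))ᵀ +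
          (V * (c.map (Int.cast : ℤ → ℝ) * x + d.map (Int.cast : ℤ → ℝ))) *
            (V * (c.map (Int.cast : ℤ → ℝ) * x + d.map (Int.cast : ℤ → ℝ)))ᵀ := by
        rw [hW, gramDenom, transpose_mul V, transpose_mul V]
        simp only [Matrix.mul_add, Matrix.add_mul, Matrix.mul_assoc]
      rw [h1, hVc, hVM, transpose_fromRows, transpose_fromRows, fromRows_mul_fromCols,
        fromRows_mul_fromCols, fromBlocks_add]
      simp
    have hdet : (V * W * Vᵀ).det = W.det := by
      have h1 : V * W * Vᵀ = V * (W * (Vᵀ * V)) * V' := by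
        simp only [Matrix.mul_assoc, hVV', Matrix.mul_one]
      rw [h1, det_conj_of_mul_eq_one hVV' hV'V, det_mul, hdetV, mul_one]
    have hPD : (V * W * Vᵀ).PosDef := by
      have h1 := (hpos x hx).posSemidef.mul_mul_conjTranspose_same V
      rw [conjTranspose_eq_transpose_of_trivial] at h1
      rw [h1.posDef_iff_det_ne_zero, hdet]
      exact (hpos x hx).det_pos.ne'
    have hD2 : (D₂ * D₂ᵀ).PosDef := by
      have h1 := hPD.submatrix (e := (Sum.inr : κ → ι ⊕ κ)) Sum.inr_injective
      rw [hblock] at h1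
      exact h1
    have hdetD2 : 1 ≤ (D₂ * D₂ᵀ).det := by
      have h2 : D₂ * D₂ᵀ = (d₂ * d₂ᵀ).map (Int.cast : ℤ → ℝ) := by
        rw [map_intCast_mul, hD₂, transpose_map]
      have := hD2.det_pos
      rw [h2] at this ⊢
      exact one_le_of_int_det this
    have hD2u : IsUnit (D₂ * D₂ᵀ).det := hD2.det_pos.ne'.isUnit
    set G := (D₂ * D₂ᵀ)⁻¹ with hG
    have hGT : Gᵀ = G := by
      rw [hG, transpose_nonsing_inv]; simp
    -- Symmetric and idempotent: the orthogonal projection onto the complement of the row space of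
    -- `D₂`. It fixes the rows of `C₁`, since `C₁ ᵗD₂ = 0`.
    set Pr := (1 : Matrix (Fin g) (Fin g) ℝ) - D₂ᵀ * G * D₂ with hPr
    have hPrT : Prᵀ = Pr := by
      rw [hPr]; simp [hGT, Matrix.mul_assoc]
    have hPrPr : Pr * Pr = Pr := by
      have h1 : (D₂ᵀ * G * D₂) * (D₂ᵀ * G * D₂) = D₂ᵀ * G * D₂ := by
        calc (D₂ᵀ * G * D₂) * (D₂ᵀ * G * D₂) = D₂ᵀ * G * ((D₂ * D₂ᵀ) * G) * D₂ := by
              simp only [Matrix.mul_assoc]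
          _ = _ := by rw [hG, Matrix.mul_nonsing_inv _ hD2u, Matrix.mul_one]
      rw [hPr, sub_mul, mul_sub, mul_sub, h1]
      simp
    have hQ : M₁ * Pr * M₁ᵀ = (M₁ * Pr) * (M₁ * Pr)ᴴ := by
      rw [conjTranspose_eq_transpose_of_trivial, transpose_mul, hPrT, Matrix.mul_assoc M₁ Pr (Pr * _),
        ← Matrix.mul_assoc Pr Pr, hPrPr, Matrix.mul_assoc]
    have hschur : W.det = (D₂ * D₂ᵀ).det * (C₁ * C₁ᵀ + M₁ * Pr * M₁ᵀ).det := by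
      let : Invertible (D₂ * D₂ᵀ) := Matrix.invertibleOfIsUnitDet _ hD2u
      rw [← hdet, hblock, det_fromBlocks₂₂, invOf_eq_nonsing_inv, ← hG, hPr]
      congr 2
      rw [Matrix.mul_sub, Matrix.sub_mul, Matrix.mul_one, add_sub_assoc]
      simp only [Matrix.mul_assoc]
    have hQpsd : (M₁ * Pr * M₁ᵀ).PosSemidef := by
      rw [hQ]; exact posSemidef_self_mul_conjTranspose _
    obtain ⟨k1, k2⟩ := det_le_det_add hP hQpsd
    have k3 : 1 ≤ (C₁ * C₁ᵀ + M₁ * Pr * M₁ᵀ).det := hdetP.trans k1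
    rw [hschur]
    refine ⟨one_le_mul_of_one_le_of_one_le hdetD2 k3, fun hle => ?_⟩
    have k4 : (C₁ * C₁ᵀ + M₁ * Pr * M₁ᵀ).det ≤ 1 := by nlinarith
    have k5 := k2 (by linarith)
    rw [hQ, self_mul_conjTranspose_eq_zero] at k5
    have k6 : Pr * C₁ᵀ = C₁ᵀ := by
      rw [hPr, Matrix.sub_mul, Matrix.one_mul, Matrix.mul_assoc, horthR', Matrix.mul_zero, sub_zero]
    rw [← k6, ← Matrix.mul_assoc, k5, Matrix.zero_mul]
  refine ⟨fun x hx => (main x hx).1, fun hc => ?_⟩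
  have hne : Nonempty ι := by
    by_contra hempty
    rw [not_nonempty_iff] at hempty
    apply hc
    have h1 : U * c = 0 := by
      rw [hUc]; ext (i | i) j
      · exact hempty.elim i
      · simp
    calc c = (U' * U) * c := by rw [hU'U, Matrix.one_mul]
      _ = 0 := by rw [Matrix.mul_assoc, h1, Matrix.mul_zero]
  obtain ⟨i⟩ := hne
  refine ⟨C₁ i, ?_, -(D₁ * C₁ᵀ) i i, fun x hx hle => ?_⟩
  · intro h0
    have h1 : c₁ i = 0 := by
      ext j
      have := congrFun h0 j
      simpa [hC₁] using this
    have h2 := hindep (Pi.single i 1) (by rw [single_one_vecMul]; exact h1)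
    have := congrFun h2 i
    simp at this
  · have h1 := congrFun (congrFun ((main x hx).2 hle) i) i
    rw [Matrix.add_mul, Matrix.add_apply, Matrix.zero_apply] at h1
    have h2 : (C₁ * x * C₁ᵀ) i i = C₁ i ⬝ᵥ x *ᵥ C₁ i := by
      rw [Matrix.mul_assoc]; rfl
    rw [← h2]
    linarith

/-- The point `x + iy` where `x` has coordinates `u`. -/
noncomputable def point (u : Sym2 (Fin g) → ℝ) (y : Matrix (Fin g) (Fin g) ℝ) :
    Matrix (Fin g) (Fin g) ℂ :=
  symMat (fun p => (u p : ℂ)) + Complex.I • y.map Complex.ofReal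

theorem pointAt_eq_point (u : Sym2 (Fin g) → ℝ) : pointAt u = point u 1 := by
  rw [point, map_ofReal_one]; rfl

@[simp] theorem im_point (u : Sym2 (Fin g) → ℝ) (y : Matrix (Fin g) (Fin g) ℝ) :
    im (point u y) = y := by
  ext; simp [point]

@[simp] theorem re_point (u : Sym2 (Fin g) → ℝ) (y : Matrix (Fin g) (Fin g) ℝ) :
    re (point u y) = symMat u := by
  ext; simp [point]

theorem isSymm_of_posDef {y : Matrix (Fin g) (Fin g) ℝ} (hy : y.PosDef) : y.IsSymm := by
  have := hy.1
  rwa [IsHermitian, conjTranspose_eq_transpose_of_trivial] at this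

theorem point_mem (u : Sym2 (Fin g) → ℝ) {y : Matrix (Fin g) (Fin g) ℝ} (hy : y.PosDef) :
    point u y ∈ siegelUpperHalfSpace g := by
  refine ⟨(symMat_isSymm _).add (IsSymm.smul ?_ _), ?_⟩
  · rw [IsSymm, ← transpose_map, (isSymm_of_posDef hy).eq]
  · have := im_point u y
    rw [im] at this
    rwa [this]

/-- In `(M + ic)(ᵗM - i ᵗc)` with `M = cx + d` the imaginary part cancels, because `c ᵗd = d ᵗc`
makes `c ᵗM` symmetric. -/
theorem denom_point_one_mul_conjTranspose (γ : Gam g) (u : Sym2 (Fin g) → ℝ) :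
    denom γ (point u 1) * (denom γ (point u 1))ᴴ =
      (gramDenom (γ.1.toBlocks₂₁.map (Int.cast : ℤ → ℝ)) (γ.1.toBlocks₂₂.map (Int.cast : ℤ → ℝ))
        (symMat u)).map Complex.ofReal := by
  set c := γ.1.toBlocks₂₁.map (Int.cast : ℤ → ℝ) with hc
  set d := γ.1.toBlocks₂₂.map (Int.cast : ℤ → ℝ) with hd
  set M := c * symMat u + d with hM
  have hcd : c * dᵀ = d * cᵀ := by
    rw [hc, hd, ← transpose_map, ← transpose_map, ← map_intCast_mul, ← map_intCast_mul,
      blockC_mul_blockD_transpose_int]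
  have hcM : c * Mᵀ = M * cᵀ := by
    rw [hM, transpose_add, transpose_mul, (symMat_isSymm u).eq, mul_add, add_mul, hcd,
      Matrix.mul_assoc]
  have hD : denom γ (point u 1) = M.map Complex.ofReal + Complex.I • c.map Complex.ofReal := by
    have h1 := re_denom γ (point u 1)
    have h2 := im_denom γ (point u 1)
    rw [re_point] at h1
    rw [im_point, Matrix.mul_one] at h2
    ext i j
    have h1' := congrFun (congrFun h1 i) j
    have h2' := congrFun (congrFun h2 i) j
    apply Complex.ext
    · simpa [hM, hc, hd] using h1'
    · simpa [hc] using h2'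
  have hDH : (denom γ (point u 1))ᴴ =
      (Mᵀ).map Complex.ofReal - Complex.I • (cᵀ).map Complex.ofReal := by
    rw [hD]; ext i j; simp [sub_eq_add_neg]
  have hc2 := congrArg (fun A : Matrix (Fin g) (Fin g) ℝ => A.map Complex.ofReal) hcM
  simp only [map_ofReal_mul] at hc2
  have hadd : (gramDenom c d (symMat u)).map Complex.ofReal =
      c.map Complex.ofReal * (cᵀ).map Complex.ofReal +
        M.map Complex.ofReal * (Mᵀ).map Complex.ofReal := by
    rw [← map_ofReal_mul, ← map_ofReal_mul, gramDenom]
    ext; simp [hM]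
  rw [hDH, hD, hadd, add_mul, mul_sub, mul_sub, Matrix.mul_smul, Matrix.mul_smul, Matrix.smul_mul,
    Matrix.smul_mul, hc2, smul_smul, Complex.I_mul_I, neg_one_smul]
  abel

theorem norm_det_denom_point_one_sq (γ : Gam g) (u : Sym2 (Fin g) → ℝ) :
    ‖(denom γ (point u 1)).det‖ ^ 2 =
      (gramDenom (γ.1.toBlocks₂₁.map (Int.cast : ℤ → ℝ)) (γ.1.toBlocks₂₂.map (Int.cast : ℤ → ℝ))
        (symMat u)).det := by
  have h := congrArg Matrix.det (denom_point_one_mul_conjTranspose γ u)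
  rw [map_ofReal_det, det_mul, det_conjTranspose] at h
  apply Complex.ofReal_injective
  rw [Complex.ofReal_pow, ← Complex.mul_conj']
  exact h

theorem gramDenom_posDef (γ : Gam g) {x : Matrix (Fin g) (Fin g) ℝ} (hx : x.IsSymm) :
    (gramDenom (γ.1.toBlocks₂₁.map (Int.cast : ℤ → ℝ)) (γ.1.toBlocks₂₂.map (Int.cast : ℤ → ℝ))
      x).PosDef := by
  obtain ⟨u, rfl⟩ := exists_eq_symMat hx
  apply posDef_of_map_ofReal
  rw [← denom_point_one_mul_conjTranspose]
  have h := isUnit_det_denom γ (point_mem u PosDef.one)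
  apply PosDef.mul_conjTranspose_self
  rw [Matrix.vecMul_injective_iff_isUnit, Matrix.isUnit_iff_isUnit_det]
  exact h

theorem one_le_norm_det_denom (γ : Gam g) (u : Sym2 (Fin g) → ℝ) :
    1 ≤ ‖(denom γ (point u 1)).det‖ := by
  have h := (one_le_det_gramDenom (blockC_mul_blockD_transpose_int γ)
    fun x hx => gramDenom_posDef γ hx).1 (symMat u) (symMat_isSymm u)
  rw [← norm_det_denom_point_one_sq] at h
  exact (one_le_sq_iff₀ (norm_nonneg _)).1 h

theorem volume_linear_eq_zero {ι : Type*} [Fintype ι] (L : (ι → ℝ) →ₗ[ℝ] ℝ) (hL : L ≠ 0) (r : ℝ) :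
    volume {u : ι → ℝ | L u = r} = 0 := by
  let s : AffineSubspace ℝ (ι → ℝ) :=
    { carrier := {u | L u = r}
      smul_vsub_vadd_mem' := by
        intro c p q t hp hq ht
        simp only [Set.mem_ofPred_eq, vsub_eq_sub, vadd_eq_add, map_add, map_smul, map_sub] at *
        rw [hp, hq, ht]; simp }
  have hs : s ≠ ⊤ := by
    intro h
    apply hL
    have h1 : ∀ u, L u = r := fun u => by
      have : u ∈ s := h ▸ AffineSubspace.mem_top ℝ (ι → ℝ) u
      exact this
    have h0 : r = 0 := by rw [← h1 0, map_zero]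
    ext u
    simp [h1, h0]
  exact Measure.addHaar_affineSubspace volume s hs

/-- The exceptional set lies in a level set of the linear form `x ↦ ᵗv x v`, which is Lebesgue null
once that form is nonzero. -/
theorem ae_one_lt_norm_det_denom (γ : Gam g) (hγ : γ.1.toBlocks₂₁ ≠ 0) :
    ∀ᵐ u : Sym2 (Fin g) → ℝ, 1 < ‖(denom γ (point u 1)).det‖ := by
  obtain ⟨v, hv, r, hvr⟩ := (one_le_det_gramDenom (blockC_mul_blockD_transpose_int γ)
    fun x hx => gramDenom_posDef γ hx).2 hγ
  let L : (Sym2 (Fin g) → ℝ) →ₗ[ℝ] ℝ :=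
    { toFun := fun u => v ⬝ᵥ symMat u *ᵥ v
      map_add' := fun a b => by
        have : symMat (a + b) = symMat a + symMat b := rfl
        rw [this, add_mulVec, dotProduct_add]
      map_smul' := fun a b => by
        have : symMat (a • b) = a • symMat b := rfl
        rw [this, smul_mulVec, dotProduct_smul]; rfl }
  have hL : L ≠ 0 := by
    intro h
    obtain ⟨a, ha⟩ := Function.ne_iff.1 hv
    -- At the diagonal matrix unit `E_aa` the form takes the value `v_a²`, which is nonzero for this
    -- `a`.
    have h1 := LinearMap.congr_fun h (Pi.single s(a, a) 1)
    have h2 : symMat (Pi.single s(a, a) (1 : ℝ)) = Matrix.single a a 1 := by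
      ext i j
      simp only [symMat_apply, Pi.single_apply, Matrix.single_apply]
      congr 1
      simp only [Sym2.eq_iff, eq_iff_iff]
      constructor
      · rintro (⟨h1, h2⟩ | ⟨h1, h2⟩)
        · exact ⟨h1.symm, h2.symm⟩
        · exact ⟨h1.symm, h2.symm⟩
      · rintro ⟨h1, h2⟩
        exact Or.inl ⟨h1.symm, h2.symm⟩
    change v ⬝ᵥ symMat (Pi.single s(a, a) (1 : ℝ)) *ᵥ v = 0 at h1
    rw [h2] at h1
    simp [dotProduct, Matrix.single_mulVec, Function.update_apply] at h1
    exact ha h1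
  have h0 := volume_linear_eq_zero L hL r
  rw [ae_iff]
  refine measure_mono_null (fun u hu => ?_) h0
  simp only [Set.mem_ofPred_eq, not_lt] at hu ⊢
  refine hvr _ (symMat_isSymm u) ?_
  rw [← norm_det_denom_point_one_sq]
  exact pow_le_one₀ (norm_nonneg _) hu

/-! ### Fourier series on the torus -/

section Torus

variable {ι : Type*} [Fintype ι]

/-- A continuous periodic function descends to the torus. -/
theorem exists_torus_lift {f : (ι → ℝ) → ℂ} (hf : Continuous f)
    (hper : ∀ u, ∀ m : ι → ℤ, f (u + fun i => (m i : ℝ)) = f u) :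
    ∃ F : C(UnitAddTorus ι, ℂ), ∀ u : ι → ℝ, F (fun i => (u i : UnitAddCircle)) = f u := by
  let φ : C(ι → ℝ, UnitAddTorus ι) := ⟨fun u i => (u i : UnitAddCircle),
    continuous_pi fun i => (AddCircle.continuous_mk' 1).comp (continuous_apply i)⟩
  have hq : IsQuotientMap φ := by
    have : IsOpenQuotientMap (Pi.map fun (_ : ι) (x : ℝ) => (x : UnitAddCircle)) :=
      IsOpenQuotientMap.piMap fun _ => QuotientAddGroup.isOpenQuotientMap_mk
    exact this.isQuotientMap
  have hfac : Function.FactorsThrough (⟨f, hf⟩ : C(ι → ℝ, ℂ)) φ := by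
    intro a b hab
    have : ∀ i, ∃ m : ℤ, b i + m = a i := fun i => by
      have h : (a i : UnitAddCircle) = b i := congrFun hab i
      have h2 : ((a i - b i : ℝ) : UnitAddCircle) = 0 := by
        rw [AddCircle.coe_sub, h, sub_self]
      obtain ⟨n, hn⟩ := (AddCircle.coe_eq_zero_iff 1).1 h2
      exact ⟨n, by simp at hn; linarith⟩
    choose m hm using this
    change f a = f b
    rw [← hper b m]
    congr 1
    ext i
    exact (hm i).symm
  exact ⟨hq.lift _ hfac, fun u => ContinuousMap.congr_fun (hq.lift_comp _ hfac) u⟩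

theorem mFourier_coe (n : ι → ℤ) (u : ι → ℝ) :
    UnitAddTorus.mFourier n (fun i => (u i : UnitAddCircle)) = e (∑ i, (n i : ℂ) * u i) := by
  simp only [UnitAddTorus.mFourier, ContinuousMap.coe_mk, fourier_coe_apply, e, Finset.mul_sum,
    Complex.exp_sum]
  refine Finset.prod_congr rfl fun i _ => ?_
  congr 1
  push_cast; ring

/-- The fundamental box of the torus. -/
def box (ι : Type*) : Set (ι → ℝ) := Set.Icc (fun _ => (-1 / 2 : ℝ)) (fun _ => 1 / 2)

theorem isCompact_box : IsCompact (box ι) := isCompact_Icc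

theorem volume_real_box : volume.real (box ι) = 1 := by
  rw [Measure.real, box, Real.volume_Icc_pi]
  norm_num

theorem Ioc_ae_eq_Icc_shift (v : ι → ℝ) :
    ({x : ι → ℝ | ∀ i, x i ∈ Set.Ioc (v i - 1 / 2) (v i - 1 / 2 + 1)} : Set (ι → ℝ)) =ᵐ[volume]
      Set.Icc (fun i => v i - 1 / 2) (fun i => v i + 1 / 2) := by
  have h : {x : ι → ℝ | ∀ i, x i ∈ Set.Ioc (v i - 1 / 2) (v i - 1 / 2 + 1)} =
      Set.univ.pi fun i => Set.Ioc (v i - 1 / 2) (v i + 1 / 2) := by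
    ext x
    simp only [Set.mem_ofPred_eq, Set.mem_univ_pi]
    refine forall_congr' fun i => ?_
    rw [show v i - 1 / 2 + 1 = v i + 1 / 2 by ring]
  rw [h]
  exact Measure.univ_pi_Ioc_ae_eq_Icc

theorem mFourierCoeff_eq_of_lift (F : UnitAddTorus ι → ℂ) (n : ι → ℤ) (v : ι → ℝ) :
    UnitAddTorus.mFourierCoeff F n =
      ∫ u in Set.Icc (fun i => v i - 1 / 2) (fun i => v i + 1 / 2),
        F (fun i => (u i : UnitAddCircle)) * e (-∑ i, (n i : ℂ) * u i) := by
  rw [UnitAddTorus.mFourierCoeff_eq_integral F n fun i => v i - 1 / 2,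
    setIntegral_congr_set (Ioc_ae_eq_Icc_shift v)]
  refine integral_congr_ae (Eventually.of_forall fun u => ?_)
  simp only [mFourier_coe, smul_eq_mul, mul_comm, Pi.neg_apply, Int.cast_neg, mul_neg,
    Finset.sum_neg_distrib]

/-- Pointwise convergence of multiple Fourier series. -/
theorem hasSum_fourier_of_summable {f : (ι → ℝ) → ℂ} (hf : Continuous f)
    (hper : ∀ u, ∀ m : ι → ℤ, f (u + fun i => (m i : ℝ)) = f u)
    (hsum : Summable fun n : ι → ℤ => ∫ u in box ι, f u * e (-∑ i, (n i : ℂ) * u i))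
    (v : ι → ℝ) :
    HasSum (fun n : ι → ℤ => (∫ u in box ι, f u * e (-∑ i, (n i : ℂ) * u i)) *
      e (∑ i, (n i : ℂ) * v i)) (f v) := by
  obtain ⟨F, hF⟩ := exists_torus_lift hf hper
  have hc : ∀ n, UnitAddTorus.mFourierCoeff F n
      = ∫ u in box ι, f u * e (-∑ i, (n i : ℂ) * u i) := fun n => by
    rw [mFourierCoeff_eq_of_lift F n 0]
    simp only [hF, box, Pi.zero_apply, zero_sub, zero_add, neg_div]
  have h := UnitAddTorus.hasSum_mFourier_series_apply_of_summable (f := F)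
    (by simpa only [funext hc] using hsum) fun i => (v i : UnitAddCircle)
  simpa only [hc, hF, mFourier_coe, smul_eq_mul] using h

/-- Translation invariance of the integral of a periodic function over a period box. -/
theorem integral_box_add {f : (ι → ℝ) → ℂ} (hf : Continuous f)
    (hper : ∀ u, ∀ m : ι → ℤ, f (u + fun i => (m i : ℝ)) = f u) (v : ι → ℝ) :
    ∫ u in box ι, f (u + v) = ∫ u in box ι, f u := by
  obtain ⟨F, hF⟩ := exists_torus_lift hf hper
  -- Both integrals are the zeroth Fourier coefficient of the same function on the torus, computed
  -- over two period boxes.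
  have h0 := mFourierCoeff_eq_of_lift F 0 0
  have hv := mFourierCoeff_eq_of_lift F 0 v
  rw [h0] at hv
  simp only [hF, Pi.zero_apply, Int.cast_zero, zero_mul, Finset.sum_const_zero, neg_zero, e_zero,
    mul_one, zero_sub, zero_add] at hv
  have hbox : box ι = Set.Icc (fun _ => -(1 / 2)) (fun _ => 1 / 2) := by
    simp only [box, neg_div]
  rw [hbox, hv]
  have hpre : (fun u : ι → ℝ => u + v) ⁻¹'
      Set.Icc (fun i => v i - 1 / 2) (fun i => v i + 1 / 2)
      = Set.Icc (fun _ => -(1 / 2)) (fun _ => 1 / 2) := by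
    ext u
    simp only [Set.mem_preimage, Set.mem_Icc, Pi.le_def, Pi.add_apply]
    refine and_congr (forall_congr' fun i => ?_) (forall_congr' fun i => ?_)
    · constructor <;> intro h <;> linarith
    · constructor <;> intro h <;> linarith
  rw [← hpre]
  exact (measurePreserving_add_right volume v).setIntegral_preimage_emb
    (MeasurableEquiv.addRight v).measurableEmbedding f _

end Torus

/-! ### Periodic holomorphic functions on tube domains -/

section Tube

variable {ι : Type*} [Fintype ι]

/-- The vector `u + ib`. -/
noncomputable def cvec (u b : ι → ℝ) : ι → ℂ := fun i => (u i : ℂ) + Complex.I * b i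

/-- The tube domain over `Ω`. -/
def tube (Ω : Set (ι → ℝ)) : Set (ι → ℂ) := {ζ | (fun i => (ζ i).im) ∈ Ω}

theorem cvec_mem_tube {Ω : Set (ι → ℝ)} {b : ι → ℝ} (hb : b ∈ Ω) (u : ι → ℝ) :
    cvec u b ∈ tube Ω := by
  have : (fun i => (cvec u b i).im) = b := by ext i; simp [cvec]
  rwa [tube, Set.mem_ofPred_eq, this]

theorem continuous_cvec : Continuous fun p : (ι → ℝ) × (ι → ℝ) => cvec p.1 p.2 := by
  unfold cvec; fun_prop

theorem cvec_add (u v b : ι → ℝ) : cvec (u + v) b = cvec u b + fun i => (v i : ℂ) := by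
  ext i; simp [cvec]; ring

/-- Periodic functions on a tube domain that are continuous and holomorphic along complex lines. -/
structure IsPeriodicHolo (Ω : Set (ι → ℝ)) (Φ : (ι → ℂ) → ℂ) : Prop where
  cont : ContinuousOn Φ (tube Ω)
  diff : ∀ ζ ∈ tube Ω, ∀ η : ι → ℂ, DifferentiableAt ℂ (fun w : ℂ => Φ (ζ + w • η)) 0
  periodic : ∀ ζ ∈ tube Ω, ∀ m : ι → ℤ, Φ (ζ + fun i => (m i : ℂ)) = Φ ζ

variable {Ω : Set (ι → ℝ)} {Φ : (ι → ℂ) → ℂ}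

theorem IsPeriodicHolo.diff' (h : IsPeriodicHolo Ω Φ) {ζ η : ι → ℂ} {w₀ : ℂ}
    (hw : ζ + w₀ • η ∈ tube Ω) : DifferentiableAt ℂ (fun w : ℂ => Φ (ζ + w • η)) w₀ := by
  have h1 := h.diff _ hw η
  have h2 : (fun w : ℂ => Φ (ζ + w • η)) =
      (fun w : ℂ => Φ (ζ + w₀ • η + w • η)) ∘ fun w => w - w₀ := by
    ext w
    simp only [Function.comp_apply, sub_smul]
    congr 1
    abel
  rw [h2]
  refine DifferentiableAt.comp w₀ (by simpa using h1) (by fun_prop)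

theorem IsPeriodicHolo.continuous_slice (h : IsPeriodicHolo Ω Φ) {b : ι → ℝ} (hb : b ∈ Ω) :
    Continuous fun u => Φ (cvec u b) :=
  h.cont.comp_continuous (continuous_cvec.comp (Continuous.prodMk_left b))
    fun u => cvec_mem_tube hb u

theorem IsPeriodicHolo.periodic_slice (h : IsPeriodicHolo Ω Φ) {b : ι → ℝ} (hb : b ∈ Ω)
    (u : ι → ℝ) (m : ι → ℤ) : Φ (cvec (u + fun i => (m i : ℝ)) b) = Φ (cvec u b) := by
  rw [cvec_add, ← h.periodic _ (cvec_mem_tube hb u) m]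
  congr 2

theorem cvec_add_smul_ofReal (u b v : ι → ℝ) (w : ℂ) :
    cvec u b + w • (fun i => (v i : ℂ)) = cvec (u + w.re • v) (b + w.im • v) := by
  ext i
  apply Complex.ext <;> simp [cvec]

/-- The integral is complex differentiable in `w`, by differentiation under the integral sign. Real
translations of `w` translate the box and do not change it, by periodicity. The derivative in the
real direction is therefore zero, and it equals the complex derivative. -/
theorem IsPeriodicHolo.integral_eq_aux (h : IsPeriodicHolo Ω Φ) (hΩ : IsOpen Ω)
    {b₀ v : ι → ℝ} {w₀ : ℂ} (hw₀ : b₀ + w₀.im • v ∈ Ω) :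
    HasDerivAt (fun w : ℂ => ∫ u in box ι, Φ (cvec u b₀ + w • fun i => (v i : ℂ))) 0 w₀ := by
  set V : ι → ℂ := fun i => (v i : ℂ) with hV
  set S : Set ℂ := {w | b₀ + w.im • v ∈ Ω} with hS
  have hSo : IsOpen S := hΩ.preimage (by fun_prop)
  have hmem : ∀ u, ∀ w ∈ S, cvec u b₀ + w • V ∈ tube Ω := fun u w hw => by
    rw [hV, cvec_add_smul_ofReal]; exact cvec_mem_tube hw _
  obtain ⟨r, hr, hball⟩ := Metric.isOpen_iff.1 hSo w₀ hw₀
  have hcl : Metric.closedBall w₀ (r / 2) ⊆ S :=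
    (Metric.closedBall_subset_ball (by linarith)).trans hball
  have hjoint : ContinuousOn (fun p : (ι → ℝ) × ℂ => Φ (cvec p.1 b₀ + p.2 • V))
      (Set.univ ×ˢ S) := by
    refine h.cont.comp (Continuous.continuousOn ?_) fun p hp => hmem p.1 p.2 hp.2
    exact (continuous_cvec.comp (continuous_fst.prodMk continuous_const)).add
      (continuous_snd.smul continuous_const)
  obtain ⟨B, hB⟩ := ((isCompact_box (ι := ι)).prod (isCompact_closedBall w₀ (r / 2))
    ).exists_bound_of_continuousOn (hjoint.mono (Set.prod_mono (Set.subset_univ _) hcl))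
  have hslice : ∀ w ∈ S, Continuous fun u => Φ (cvec u b₀ + w • V) := fun w hw =>
    h.cont.comp_continuous ((continuous_cvec.comp (Continuous.prodMk_left b₀)).add
      continuous_const) fun u => hmem u w hw
  have hdiff : ∀ u, ∀ w ∈ S, DifferentiableAt ℂ (fun w => Φ (cvec u b₀ + w • V)) w :=
    fun u w hw => h.diff' (hmem u w hw)
  have hreal : ∀ t : ℝ, w₀ + t ∈ S := fun t => by
    simpa [hS] using hw₀
  -- Joint differentiability in `u` is not assumed; measurability comes from writing the derivative
  -- as a limit of difference quotients that are continuous in `u`.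
  have hmeas : AEStronglyMeasurable (fun u => deriv (fun w => Φ (cvec u b₀ + w • V)) w₀)
      (volume.restrict (box ι)) := by
    refine aestronglyMeasurable_of_tendsto_ae atTop
      (f := fun (n : ℕ) u => ((n : ℂ) + 1) * (Φ (cvec u b₀ + (w₀ + ((1 / ((n : ℝ) + 1) : ℝ) : ℂ)) • V)
        - Φ (cvec u b₀ + w₀ • V))) (fun n => ?_) (Eventually.of_forall fun u => ?_)
    · exact (continuous_const.mul ((hslice _ (hreal _)).sub (hslice _ hw₀))).aestronglyMeasurable
    · have h1 := (hdiff u w₀ hw₀).hasDerivAt.tendsto_slope_zero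
      have h2 : Tendsto (fun n : ℕ => ((1 / ((n : ℝ) + 1) : ℝ) : ℂ)) atTop (𝓝[≠] 0) := by
        rw [tendsto_nhdsWithin_iff]
        constructor
        · have := (Complex.continuous_ofReal.tendsto 0).comp
            (tendsto_one_div_add_atTop_nhds_zero_nat (𝕜 := ℝ))
          simpa [Function.comp_def] using this
        · refine Eventually.of_forall fun n => ?_
          rw [Set.mem_compl_iff, Set.mem_singleton_iff, Complex.ofReal_eq_zero]
          positivity
      refine (h1.comp h2).congr fun n => ?_
      simp
  -- The bound `B / (r / 4)` is Cauchy's estimate: a disc of radius `r / 4` around a point of the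
  -- ball of radius `r / 4` stays in the disc of radius `r / 2`, where `B` bounds the function.
  have key := hasDerivAt_integral_of_dominated_loc_of_deriv_le (μ := volume.restrict (box ι))
    (F := fun w u => Φ (cvec u b₀ + w • V))
    (F' := fun w u => deriv (fun w => Φ (cvec u b₀ + w • V)) w) (x₀ := w₀)
    (s := Metric.ball w₀ (r / 4)) (bound := fun _ => B / (r / 4))
    (Metric.ball_mem_nhds _ (by positivity))
    (by
      filter_upwards [hSo.mem_nhds hw₀] with w hw
      exact (hslice w hw).aestronglyMeasurable)
    ((hslice w₀ hw₀).continuousOn.integrableOn_compact isCompact_box)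
    hmeas
    (by
      refine (ae_restrict_mem (isCompact_box (ι := ι)).measurableSet).mono fun u hu w hw => ?_
      have hsub : Metric.closedBall w (r / 4) ⊆ Metric.closedBall w₀ (r / 2) := by
        refine Metric.closedBall_subset_closedBall' ?_
        rw [Metric.mem_ball] at hw
        linarith
      refine Complex.norm_deriv_le_of_forall_mem_sphere_norm_le (by positivity) ?_ fun z hz => ?_
      · refine DifferentiableOn.diffContOnCl fun z hz => ?_
        rw [closure_ball _ (by positivity)] at hz
        exact (hdiff u z (hcl (hsub hz))).differentiableWithinAt
      · exact hB (u, z) ⟨hu, hsub (Metric.sphere_subset_closedBall hz)⟩)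
    (by
      have : IsFiniteMeasure (volume.restrict (box ι)) :=
        ⟨by rw [Measure.restrict_apply_univ]; exact isCompact_box.measure_lt_top⟩
      exact integrable_const _)
    (by
      refine Eventually.of_forall fun u w hw => ?_
      refine (hdiff u w (hcl ?_)).hasDerivAt
      exact Metric.ball_subset_closedBall.trans
        (Metric.closedBall_subset_closedBall (by linarith)) hw)
  have hder := key.2
  have hconst : ∀ t : ℝ, ∫ u in box ι, Φ (cvec u b₀ + (w₀ + t) • V)
      = ∫ u in box ι, Φ (cvec u b₀ + w₀ • V) := fun t => by
    have h1 := integral_box_add (f := fun u => Φ (cvec u b₀ + w₀ • V)) (hslice w₀ hw₀)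
      (fun u m => by
        rw [hV, cvec_add_smul_ofReal, cvec_add_smul_ofReal, add_right_comm]
        exact h.periodic_slice hw₀ _ m) (t • v)
    rw [← h1]
    refine integral_congr_ae (Eventually.of_forall fun u => ?_)
    simp only [cvec_add, add_smul]
    congr 1
    ext i
    simp [hV]
    ring
  have hz : (∫ u in box ι, deriv (fun w => Φ (cvec u b₀ + w • V)) w₀) = 0 := by
    have h1 : HasDerivAt (fun w : ℂ => ∫ u in box ι, Φ (cvec u b₀ + w • V))
        (∫ u in box ι, deriv (fun w => Φ (cvec u b₀ + w • V)) w₀) (w₀ + ((0 : ℝ) : ℂ)) := by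
      rw [Complex.ofReal_zero, add_zero]; exact hder
    have h2 := (h1.comp_const_add w₀ _).comp_ofReal
    simp only [hconst] at h2
    exact (h2.unique (hasDerivAt_const _ _))
  rw [hz] at hder
  exact hder

/-- Along `v = b' - b` the parameters `w = 0` and `w = i` give the two slices. Convexity of `Ω`
makes the set of admissible `w` connected, so the vanishing derivative forces equality. -/
theorem IsPeriodicHolo.integral_slice_eq (h : IsPeriodicHolo Ω Φ) (hΩ : IsOpen Ω)
    (hc : Convex ℝ Ω) {b b' : ι → ℝ} (hb : b ∈ Ω) (hb' : b' ∈ Ω) :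
    ∫ u in box ι, Φ (cvec u b) = ∫ u in box ι, Φ (cvec u b') := by
  set v := b' - b with hv
  set S : Set ℂ := {w | b + w.im • v ∈ Ω} with hS
  have hSo : IsOpen S := hΩ.preimage (by fun_prop)
  have hSc : Convex ℝ S := by
    intro z hz w hw p q hp hq hpq
    have h1 := hc hz hw hp hq hpq
    have h2 : b + (p • z + q • w).im • v = p • (b + z.im • v) + q • (b + w.im • v) := by
      have : b = p • b + q • b := by rw [← add_smul, hpq, one_smul]
      simp only [Complex.add_im, Complex.smul_im, smul_eq_mul, smul_add, add_smul, mul_smul]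
      conv_lhs => rw [this]
      abel
    change b + (p • z + q • w).im • v ∈ Ω
    rwa [h2]
  have h0 : (0 : ℂ) ∈ S := by simpa [hS] using hb
  have hI : Complex.I ∈ S := by simpa [hS, hv] using hb'
  have hder : ∀ w ∈ S, HasDerivAt
      (fun w : ℂ => ∫ u in box ι, Φ (cvec u b + w • fun i => (v i : ℂ))) 0 w :=
    fun w hw => h.integral_eq_aux hΩ hw
  have := hSo.is_const_of_deriv_eq_zero hSc.isPreconnected
    (fun w hw => (hder w hw).differentiableAt.differentiableWithinAt)
    (fun w hw => (hder w hw).deriv) h0 hI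
  simpa only [cvec_add_smul_ofReal, hv, Complex.zero_re, Complex.zero_im, zero_smul, add_zero,
    Complex.I_re, Complex.I_im, one_smul, add_sub_cancel] using this

/-- The pairing of an integral vector with a complex vector. -/
def pair (n : ι → ℤ) (ζ : ι → ℂ) : ℂ := ∑ i, (n i : ℂ) * ζ i

theorem e_neg_mul_e (w : ℂ) : e (-w) * e w = 1 := by
  rw [← e_add]; simp

theorem continuous_pair (n : ι → ℤ) : Continuous (pair n) := by
  unfold pair; fun_prop

theorem continuous_e : Continuous e := by
  unfold e; fun_prop

theorem pair_add (n : ι → ℤ) (ζ η : ι → ℂ) : pair n (ζ + η) = pair n ζ + pair n η := by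
  simp [pair, mul_add, Finset.sum_add_distrib]

theorem IsPeriodicHolo.twist (h : IsPeriodicHolo Ω Φ) (n : ι → ℤ) :
    IsPeriodicHolo Ω fun ζ => Φ ζ * e (-pair n ζ) where
  cont := h.cont.mul (continuous_e.comp (continuous_pair n).neg).continuousOn
  diff := fun ζ hζ η => by
    refine (h.diff ζ hζ η).mul ?_
    simp only [e, pair]
    fun_prop
  periodic := fun ζ hζ m => by
    have h1 : pair n (fun i => (m i : ℂ)) = ((∑ i, n i * m i : ℤ) : ℂ) := by
      simp [pair]
    rw [h.periodic ζ hζ m, pair_add, h1, neg_add, e_add, ← Int.cast_neg, e_intCast, mul_one]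

/-- The Fourier coefficients of a periodic holomorphic function, computed over `b`. -/
noncomputable def tubeCoeff (Φ : (ι → ℂ) → ℂ) (n : ι → ℤ) (b : ι → ℝ) : ℂ :=
  ∫ u in box ι, Φ (cvec u b) * e (-pair n (cvec u b))

theorem IsPeriodicHolo.tubeCoeff_eq (h : IsPeriodicHolo Ω Φ) (hΩ : IsOpen Ω)
    (hc : Convex ℝ Ω) (n : ι → ℤ) {b b' : ι → ℝ} (hb : b ∈ Ω) (hb' : b' ∈ Ω) :
    tubeCoeff Φ n b = tubeCoeff Φ n b' :=
  (h.twist n).integral_slice_eq hΩ hc hb hb'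

theorem pair_cvec (n : ι → ℤ) (u b : ι → ℝ) :
    pair n (cvec u b) = ∑ i, (n i : ℂ) * u i + Complex.I * ((∑ i, n i * b i : ℝ) : ℂ) := by
  simp only [pair, cvec, mul_add, Finset.sum_add_distrib]
  push_cast
  rw [Finset.mul_sum]
  congr 1
  exact Finset.sum_congr rfl fun i _ => by ring

theorem im_pair_cvec (n : ι → ℤ) (u b : ι → ℝ) :
    (pair n (cvec u b)).im = ∑ i, n i * b i := by
  simp [pair, cvec]

theorem norm_tubeCoeff_le {Φ : (ι → ℂ) → ℂ} (n : ι → ℤ) {b : ι → ℝ} {B : ℝ}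
    (hB : ∀ u ∈ box ι, ‖Φ (cvec u b)‖ ≤ B) :
    ‖tubeCoeff Φ n b‖ ≤ B * Real.exp (2 * Real.pi * ∑ i, n i * b i) := by
  have h1 : ∀ u ∈ box ι, ‖Φ (cvec u b) * e (-pair n (cvec u b))‖ ≤
      B * Real.exp (2 * Real.pi * ∑ i, n i * b i) := fun u hu => by
    rw [norm_mul, norm_e, Complex.neg_im, im_pair_cvec, mul_neg, neg_neg]
    exact mul_le_mul_of_nonneg_right (hB u hu) (Real.exp_pos _).le
  have h2 := norm_setIntegral_le_of_norm_le_const (μ := volume) isCompact_box.measure_lt_top h1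
  rwa [volume_real_box, mul_one] at h2

theorem summable_exp_neg_abs {c : ℝ} (hc : 0 < c) :
    Summable fun n : ℤ => Real.exp (-(c * |(n : ℝ)|)) := by
  have h : Summable fun n : ℕ => Real.exp (-(c * |(n : ℝ)|)) := by
    refine (Real.summable_exp_nat_mul_iff.2 (neg_lt_zero.2 hc)).congr fun n => ?_
    rw [Nat.abs_cast]; ring_nf
  exact Summable.of_nat_of_neg (by simpa using h) (by simpa using h)

/-- The Fourier expansion of a periodic holomorphic function on a tube domain. -/
theorem IsPeriodicHolo.hasSum (h : IsPeriodicHolo Ω Φ) (hΩ : IsOpen Ω)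
    (hc : Convex ℝ Ω) {b₁ : ι → ℝ} (hb₁ : b₁ ∈ Ω) (u : ι → ℝ) {b : ι → ℝ} (hb : b ∈ Ω) :
    HasSum (fun n : ι → ℤ => tubeCoeff Φ n b₁ * e (pair n (cvec u b))) (Φ (cvec u b)) := by
  have hcoef : ∀ n : ι → ℤ, ∫ u in box ι, Φ (cvec u b) * e (-∑ i, (n i : ℂ) * u i) =
      tubeCoeff Φ n b₁ * e (Complex.I * ((∑ i, n i * b i : ℝ) : ℂ)) := fun n => by
    rw [h.tubeCoeff_eq hΩ hc n hb₁ hb, tubeCoeff, ← integral_mul_const]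
    refine integral_congr_ae (Eventually.of_forall fun u => ?_)
    simp only [pair_cvec, neg_add, e_add]
    rw [mul_assoc, mul_assoc, e_neg_mul_e, mul_one]
  obtain ⟨ε, hε, hball⟩ := Metric.isOpen_iff.1 hΩ b hb
  have hcl : Metric.closedBall b (ε / 2) ⊆ Ω :=
    (Metric.closedBall_subset_ball (by linarith)).trans hball
  obtain ⟨B, hB⟩ := ((isCompact_box (ι := ι)).prod (isCompact_closedBall b (ε / 2))
    ).exists_bound_of_continuousOn (f := fun p => Φ (cvec p.1 p.2))
      (h.cont.comp continuous_cvec.continuousOn fun p hp => cvec_mem_tube (hcl hp.2) p.1)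
  have hbound : ∀ n : ι → ℤ, ‖tubeCoeff Φ n b₁ * e (Complex.I * ((∑ i, n i * b i : ℝ) : ℂ))‖ ≤
      B * ∏ i, Real.exp (-(2 * Real.pi * (ε / 2) * |((n i : ℤ) : ℝ)|)) := fun n => by
    -- Evaluating the coefficient over `b - (ε/2)σ` instead of `b` gains the factor `exp(-πε ∑ |n
    -- i|)`; the shift remains in the compact ball because `|σ i| ≤ 1`.
    set σ : ι → ℝ := fun i => SignType.sign (n i) with hσ
    have hmem : b - (ε / 2) • σ ∈ Metric.closedBall b (ε / 2) := by
      rw [Metric.mem_closedBall, dist_eq_norm, sub_sub_cancel_left, norm_neg, norm_smul,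
        Real.norm_of_nonneg (by positivity)]
      refine mul_le_of_le_one_right (by positivity) ?_
      rw [pi_norm_le_iff_of_nonneg zero_le_one]
      intro i
      simp only [hσ]
      cases SignType.sign (n i) <;> simp
    have h1 := norm_tubeCoeff_le (Φ := Φ) n (b := b - (ε / 2) • σ) (B := B)
      fun u hu => hB (u, _) ⟨hu, hmem⟩
    rw [h.tubeCoeff_eq hΩ hc n (hcl hmem) hb₁] at h1
    have h2 : ∑ i, (n i : ℝ) * (b - (ε / 2) • σ) i =
        ∑ i, (n i : ℝ) * b i - ε / 2 * ∑ i, |(n i : ℝ)| := by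
      rw [Finset.mul_sum, ← Finset.sum_sub_distrib]
      refine Finset.sum_congr rfl fun i _ => ?_
      have : (n i : ℝ) * σ i = |(n i : ℝ)| := by
        have := self_mul_sign (n i)
        simp only [hσ]
        rw [← Int.cast_abs, ← this]
        push_cast
        cases SignType.sign (n i) <;> simp
      simp only [Pi.sub_apply, Pi.smul_apply, smul_eq_mul]
      linear_combination -(ε / 2) * this
    rw [h2] at h1
    rw [norm_mul, norm_e, ← Real.exp_sum]
    have h3 : (Complex.I * ((∑ i, n i * b i : ℝ) : ℂ)).im = ∑ i, n i * b i := by simp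
    rw [h3]
    refine (mul_le_mul_of_nonneg_right h1 (Real.exp_pos _).le).trans (le_of_eq ?_)
    rw [mul_assoc, ← Real.exp_add]
    congr 2
    rw [Finset.sum_neg_distrib, ← Finset.mul_sum]
    ring
  have hsum : Summable fun n : ι → ℤ =>
      ∫ u in box ι, Φ (cvec u b) * e (-∑ i, (n i : ℂ) * u i) := by
    simp only [hcoef]
    refine Summable.of_norm_bounded ?_ hbound
    exact (summable_pi_prod (fun _ => (Real.exp_pos _).le)
      (summable_exp_neg_abs (c := 2 * Real.pi * (ε / 2)) (by positivity))).mul_left B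
  have := hasSum_fourier_of_summable (h.continuous_slice hb) (h.periodic_slice hb) hsum u
  refine this.congr_fun fun n => ?_
  rw [hcoef, pair_cvec, add_comm, e_add]
  ring

end Tube

/-! ### The Fourier expansion of the Poincaré series -/

/-- The coordinates of positive definite matrices. -/
def posCone (g : ℕ) : Set (Sym2 (Fin g) → ℝ) := {b | (symMat b).PosDef}

/-- Coercivity applied to `v ᵗv` gives `ᵗv v ≤ K ᵗv y v`, while entries of size at most `ε` change
the form by at most `ε g ᵗv v`. The choice `ε = 1/(Kg + 1)` makes `K ε g < 1`. -/
theorem posDef_add_of_small {y : Matrix (Fin g) (Fin g) ℝ} (hy : y.PosDef) :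
    ∃ ε > 0, ∀ h : Matrix (Fin g) (Fin g) ℝ, h.IsSymm → (∀ i j, |h i j| ≤ ε) →
      (y + h).PosDef := by
  set K : ℝ := g ^ 4 * trace y⁻¹ with hK
  have hK0 : 0 ≤ K := mul_nonneg (by positivity) hy.inv.posSemidef.trace_nonneg
  refine ⟨1 / (K * g + 1), by positivity, fun h hh hle => ?_⟩
  refine .of_dotProduct_mulVec_pos ?_ fun v hv => ?_
  · refine hy.1.add ?_
    rw [IsHermitian, conjTranspose_eq_transpose_of_trivial, hh.eq]
  rw [star_trivial, add_mulVec, dotProduct_add]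
  have h1 := re_trace_le_of_posDef hy (posSemidef_vecMulVec_self_star v)
  simp only [star_trivial, RCLike.re_to_real] at h1
  have h2 : trace (vecMulVec v v) = v ⬝ᵥ v := by simp [trace, vecMulVec_apply, dotProduct]
  have h3 : trace (y * vecMulVec v v) = v ⬝ᵥ y *ᵥ v := by
    rw [Matrix.mul_vecMulVec, trace_vecMulVec, dotProduct_comm]
  rw [h2, h3] at h1
  have hvv : 0 < v ⬝ᵥ v := by
    have := dotProduct_star_self_pos_iff.2 hv
    simpa using this
  have h4 : |v ⬝ᵥ h *ᵥ v| ≤ 1 / (K * g + 1) * (g * (v ⬝ᵥ v)) := by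
    have e1 : v ⬝ᵥ h *ᵥ v = ∑ i, ∑ j, v i * (h i j * v j) := by
      simp only [dotProduct, mulVec, Finset.mul_sum]
    have e2 : (g : ℝ) * (v ⬝ᵥ v) = ∑ i : Fin g, ∑ j : Fin g, (v i ^ 2 + v j ^ 2) / 2 := by
      simp only [add_div, Finset.sum_add_distrib, dotProduct]
      simp only [Finset.sum_const, Finset.card_univ, Fintype.card_fin, nsmul_eq_mul,
        ← Finset.mul_sum, ← Finset.sum_div, ← sq]
      ring
    rw [e1, e2, Finset.mul_sum]
    refine (Finset.abs_sum_le_sum_abs _ _).trans (Finset.sum_le_sum fun i _ => ?_)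
    rw [Finset.mul_sum]
    refine (Finset.abs_sum_le_sum_abs _ _).trans (Finset.sum_le_sum fun j _ => ?_)
    rw [abs_mul, abs_mul]
    calc |v i| * (|h i j| * |v j|) = |h i j| * (|v i| * |v j|) := by ring
      _ ≤ 1 / (K * g + 1) * ((v i ^ 2 + v j ^ 2) / 2) := by
        refine mul_le_mul (hle i j) ?_ (by positivity) (by positivity)
        nlinarith [sq_nonneg (|v i| - |v j|), sq_abs (v i), sq_abs (v j)]
  have h5 : K * (1 / (K * g + 1) * (g * (v ⬝ᵥ v))) < v ⬝ᵥ v := by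
    have : K * (1 / (K * g + 1) * (g * (v ⬝ᵥ v))) = (K * g) * (v ⬝ᵥ v) / (K * g + 1) := by ring
    rw [this, div_lt_iff₀ (by positivity)]
    nlinarith
  have h6 := neg_abs_le (v ⬝ᵥ h *ᵥ v)
  have h7 : 0 < K * (v ⬝ᵥ y *ᵥ v + v ⬝ᵥ h *ᵥ v) := by nlinarith
  exact pos_of_mul_pos_right h7 hK0

theorem isOpen_posCone : IsOpen (posCone g) := by
  rw [Metric.isOpen_iff]
  intro b hb
  obtain ⟨ε, hε, h⟩ := posDef_add_of_small hb
  refine ⟨ε, hε, fun c hc => ?_⟩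
  have h1 := h (symMat (c - b)) (symMat_isSymm _) fun i j => by
    rw [Metric.mem_ball, dist_eq_norm] at hc
    exact (norm_le_pi_norm (c - b) s(i, j)).trans hc.le
  have h2 : symMat b + symMat (c - b) = symMat c := by ext; simp
  rwa [h2] at h1

theorem convex_posCone : Convex ℝ (posCone g) := by
  rw [convex_iff_forall_pos]
  intro a ha b hb p q hp hq _
  change (symMat (p • a + q • b)).PosDef
  have h : symMat (p • a + q • b) = p • symMat a + q • symMat b := rfl
  rw [h]
  exact (PosDef.smul ha hp).add (PosDef.smul hb hq)

theorem im_symMat (ζ : Sym2 (Fin g) → ℂ) : im (symMat ζ) = symMat fun p => (ζ p).im := by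
  ext; simp

theorem symMat_mem_iff {ζ : Sym2 (Fin g) → ℂ} :
    symMat ζ ∈ siegelUpperHalfSpace g ↔ ζ ∈ tube (posCone g) := by
  constructor
  · intro h
    have := h.2
    change (im (symMat ζ)).PosDef at this
    rwa [im_symMat] at this
  · intro h
    refine ⟨symMat_isSymm _, ?_⟩
    change (im (symMat ζ)).PosDef
    rw [im_symMat]
    exact h

theorem symMat_cvec (u b : Sym2 (Fin g) → ℝ) : symMat (cvec u b) = point u (symMat b) := by
  ext; simp [cvec, point]

section Differentiability

variable {E : Type*} [NormedAddCommGroup E] [NormedSpace ℂ E] {x : E}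

theorem differentiableAt_det {n : Type*} [Fintype n] [DecidableEq n] {M : E → Matrix n n ℂ}
    (h : ∀ i j, DifferentiableAt ℂ (fun ζ => M ζ i j) x) :
    DifferentiableAt ℂ (fun ζ => (M ζ).det) x := by
  simp only [det_apply']
  fun_prop

theorem differentiableAt_adjugate {n : Type*} [Fintype n] [DecidableEq n] {M : E → Matrix n n ℂ}
    (h : ∀ i j, DifferentiableAt ℂ (fun ζ => M ζ i j) x) (i j : n) :
    DifferentiableAt ℂ (fun ζ => (M ζ).adjugate i j) x := by
  simp only [adjugate_apply]
  refine differentiableAt_det fun a b => ?_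
  by_cases ha : a = j
  · subst ha
    simp only [updateRow_self]
    fun_prop
  · simp only [updateRow_ne ha]
    exact h a b

theorem differentiableAt_mul {n : Type*} [Fintype n] {M N : E → Matrix n n ℂ}
    (h : ∀ i j, DifferentiableAt ℂ (fun ζ => M ζ i j) x)
    (h' : ∀ i j, DifferentiableAt ℂ (fun ζ => N ζ i j) x) (i j : n) :
    DifferentiableAt ℂ (fun ζ => (M ζ * N ζ) i j) x := by
  simp only [mul_apply]
  fun_prop

end Differentiability

theorem differentiableAt_summand (s : HalfIntPosDef g) (k : ℕ) (γ : Gam g)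
    {ζ : Sym2 (Fin g) → ℂ} (hζ : ζ ∈ tube (posCone g)) :
    DifferentiableAt ℂ (fun ζ => summand s k (symMat ζ) γ) ζ := by
  have hz := symMat_mem_iff.2 hζ
  have h0 := (isUnit_det_denom γ hz).ne_zero
  have hsym : ∀ i j, DifferentiableAt ℂ
      (fun ζ : Sym2 (Fin g) → ℂ => (symMat ζ : Matrix (Fin g) (Fin g) ℂ) i j) ζ := fun i j => by
    simp only [symMat_apply]; fun_prop
  have hconst : ∀ (A : Matrix (Fin g) (Fin g) ℂ) (i j), DifferentiableAt ℂ
      (fun _ : Sym2 (Fin g) → ℂ => A i j) ζ := fun A i j => by fun_prop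
  have haff : ∀ (A B : Matrix (Fin g) (Fin g) ℂ) (i j), DifferentiableAt ℂ
      (fun ζ : Sym2 (Fin g) → ℂ => (A * symMat ζ + B) i j) ζ := fun A B i j => by
    simp only [Matrix.add_apply]
    exact (differentiableAt_mul (M := fun _ => A) (N := fun ζ => symMat ζ) (hconst A) hsym i j).add
      (hconst B i j)
  have hdet : DifferentiableAt ℂ (fun ζ => (denom γ (symMat ζ)).det) ζ :=
    differentiableAt_det (haff (blockC γ) (blockD γ))
  have hinv : ∀ i j, DifferentiableAt ℂ (fun ζ => (denom γ (symMat ζ))⁻¹ i j) ζ := fun i j => by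
    simp only [Matrix.inv_def, Ring.inverse_eq_inv', Matrix.smul_apply, smul_eq_mul]
    exact (hdet.inv h0).mul (differentiableAt_adjugate (haff (blockC γ) (blockD γ)) i j)
  have hact : ∀ i j, DifferentiableAt ℂ (fun ζ => act γ (symMat ζ) i j) ζ :=
    differentiableAt_mul (M := fun ζ => blockA γ * symMat ζ + blockB γ)
      (N := fun ζ => (denom γ (symMat ζ))⁻¹) (haff (blockA γ) (blockB γ)) hinv
  have htr : DifferentiableAt ℂ
      (fun ζ => trace (s.1.map Complex.ofReal * act γ (symMat ζ))) ζ := by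
    simp only [trace, diag_apply]
    exact DifferentiableAt.fun_sum fun i _ => differentiableAt_mul
      (M := fun _ => s.1.map Complex.ofReal) (N := fun ζ => act γ (symMat ζ))
      (hconst (s.1.map Complex.ofReal)) hact i i
  unfold summand
  refine DifferentiableAt.mul ?_ ?_
  · simp only [_root_.zpow_neg, zpow_natCast]
    exact (hdet.pow k).inv (pow_ne_zero k h0)
  · simp only [e]
    fun_prop

/-- Local boundedness of `growth` turns the majorant of the summands into a locally uniform one, so
that continuity and holomorphy pass to the series. -/
theorem continuousOn_growth (l₀ l : ℕ) :
    ContinuousOn (fun ζ : Sym2 (Fin g) → ℂ => growth l₀ l (symMat ζ)) (tube (posCone g)) := by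
  have him : Continuous fun ζ : Sym2 (Fin g) → ℂ => im (symMat ζ) := by
    refine continuous_matrix fun i j => ?_
    simp only [map_apply, symMat_apply]
    fun_prop
  have hdet : ∀ ζ ∈ tube (posCone g), (im (symMat ζ)).det ≠ 0 := fun ζ hζ =>
    (symMat_mem_iff.2 hζ).2.det_pos.ne'
  have hinv : ContinuousOn (fun ζ : Sym2 (Fin g) → ℂ => entrySum (im (symMat ζ))⁻¹)
      (tube (posCone g)) := by
    simp only [entrySum, Matrix.inv_def, Ring.inverse_eq_inv', Matrix.smul_apply, smul_eq_mul]
    refine continuousOn_finsetSum _ fun i _ => continuousOn_finsetSum _ fun j _ => ?_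
    exact ((him.matrix_det.continuousOn.inv₀ hdet).mul
      (him.matrix_adjugate.matrix_elem i j).continuousOn).norm
  have hre : Continuous fun ζ : Sym2 (Fin g) → ℂ => entrySum (re (symMat ζ)) := by
    simp only [entrySum, map_apply, symMat_apply]
    fun_prop
  unfold growth
  refine ((him.matrix_det.pow l).continuousOn.inv₀ fun ζ hζ => pow_ne_zero l (hdet ζ hζ)).mul ?_
  refine ContinuousOn.pow (ContinuousOn.mul ?_ ?_) _
  · exact (continuous_const.mul him.matrix_trace).continuousOn
  · exact (continuousOn_const.add (hinv.mul (continuous_const.add hre).continuousOn)).pow 2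

theorem summable_cosetSummand (hg : 1 ≤ g) (s : HalfIntPosDef g) {l : ℕ} (hl : 2 * g ^ 2 ≤ l)
    {z : Matrix (Fin g) (Fin g) ℂ} (hz : z ∈ siegelUpperHalfSpace g) :
    Summable fun q : Cosets g => ‖cosetSummand s (2 * l) z q‖ := by
  obtain ⟨b, hb, -, h⟩ := exists_norm_cosetSummand_le hg s hl
  exact Summable.of_nonneg_of_le (fun _ => norm_nonneg _) (fun q => h q z hz) (hb.mul_left _)

theorem isOpen_tube {ι : Type*} [Fintype ι] {Ω : Set (ι → ℝ)} (hΩ : IsOpen Ω) :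
    IsOpen (tube Ω) := hΩ.preimage (by fun_prop)

/-- A neighbourhood on which the summands have a uniform summable bound. -/
theorem exists_local_bound (hg : 1 ≤ g) (s : HalfIntPosDef g) {l : ℕ} (hl : 2 * g ^ 2 ≤ l)
    {ζ₀ : Sym2 (Fin g) → ℂ} (hζ : ζ₀ ∈ tube (posCone g)) :
    ∃ V : Set (Sym2 (Fin g) → ℂ), IsOpen V ∧ ζ₀ ∈ V ∧ V ⊆ tube (posCone g) ∧
      ∃ c : Cosets g → ℝ, Summable c ∧
        ∀ q, ∀ ζ ∈ V, ‖cosetSummand s (2 * l) (symMat ζ) q‖ ≤ c q := by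
  obtain ⟨b, hb, hb0, h⟩ := exists_norm_cosetSummand_le hg s hl
  have hopen := isOpen_tube (isOpen_posCone (g := g))
  have hcont := continuousOn_growth (g := g) (2 * g ^ 2) l
  set R := growth (2 * g ^ 2) l (symMat ζ₀) + 1 with hR
  refine ⟨tube (posCone g) ∩ (fun ζ => growth (2 * g ^ 2) l (symMat ζ)) ⁻¹' Set.Iio R,
    hcont.isOpen_inter_preimage hopen isOpen_Iio, ⟨hζ, ?_⟩, Set.inter_subset_left,
    fun q => R * b q, hb.mul_left R, fun q ζ hζ' => ?_⟩
  · simp [hR]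
  · exact (h q _ (symMat_mem_iff.2 hζ'.1)).trans
      (mul_le_mul_of_nonneg_right (le_of_lt hζ'.2) (hb0 q))

theorem intCast_symMat (m : Sym2 (Fin g) → ℤ) :
    (symMat m).map (Int.cast : ℤ → ℂ) = symMat fun p => (m p : ℂ) := by ext; simp

/-- The Poincaré series is a periodic holomorphic function. -/
theorem isPeriodicHolo_poincareSeries (hg : 1 ≤ g) (s : HalfIntPosDef g) {l : ℕ}
    (hl : 2 * g ^ 2 ≤ l) :
    IsPeriodicHolo (posCone g) fun ζ => poincareSeries s (2 * l) (symMat ζ) where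
  cont := fun ζ₀ hζ₀ => by
    obtain ⟨V, hV, hmem, hsub, c, hc, hle⟩ := exists_local_bound hg s hl hζ₀
    have : ContinuousOn (fun ζ => poincareSeries s (2 * l) (symMat ζ)) V := by
      unfold poincareSeries
      refine continuousOn_tsum (fun q ζ hζ => ?_) hc hle
      exact (differentiableAt_summand s _ _ (hsub hζ)).continuousAt.continuousWithinAt
    exact (this.continuousAt (hV.mem_nhds hmem)).continuousWithinAt
  diff := fun ζ₀ hζ₀ η => by
    obtain ⟨V, hV, hmem, hsub, c, hc, hle⟩ := exists_local_bound hg s hl hζ₀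
    have hW : IsOpen ((fun w : ℂ => ζ₀ + w • η) ⁻¹' V) := hV.preimage (by fun_prop)
    have : DifferentiableOn ℂ (fun w : ℂ => poincareSeries s (2 * l) (symMat (ζ₀ + w • η)))
        ((fun w : ℂ => ζ₀ + w • η) ⁻¹' V) := by
      unfold poincareSeries
      refine Complex.differentiableOn_tsum_of_summable_norm hc (fun q w hw => ?_) hW
        (fun q w hw => hle q _ hw)
      have h1 := differentiableAt_summand s (2 * l) q.out (hsub hw)
      exact (h1.comp w (by fun_prop : DifferentiableAt ℂ (fun w : ℂ => ζ₀ + w • η) w)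
        ).differentiableWithinAt
    exact this.differentiableAt (hW.mem_nhds (by simpa using hmem))
  periodic := fun ζ hζ m => by
    have h := poincareSeries_add s (even_two_mul l) (symMat_mem_iff.2 hζ) (symMat_isSymm m)
    rw [intCast_symMat] at h
    exact h

/-- The coordinates of the identity matrix. -/
theorem exists_coord_one : ∃ b : Sym2 (Fin g) → ℝ, symMat b = 1 :=
  (exists_eq_symMat isSymm_one).imp fun _ h => h.symm

theorem trace_mul_point (n : Sym2 (Fin g) → ℤ) (ζ : Sym2 (Fin g) → ℂ) :
    trace ((halfMat fun p => (n p : ℝ)).map Complex.ofReal * symMat ζ) = pair n ζ := by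
  rw [trace_halfMat_mul_symMat]; simp [pair]

theorem poincareCoeff_eq_tubeCoeff (s : HalfIntPosDef g) (k : ℕ) (t : HalfIntPosDef g)
    {n : Sym2 (Fin g) → ℤ} (hn : halfMat (fun p => (n p : ℝ)) = t.1) {b : Sym2 (Fin g) → ℝ}
    (hb : symMat b = 1) :
    poincareCoeff s k t = tubeCoeff (fun ζ => poincareSeries s k (symMat ζ)) n b := by
  rw [poincareCoeff, fourierCoeff, tubeCoeff, box]
  simp only [← hn, pointAt_eq_point, ← hb, ← symMat_cvec, trace_mul_point]

/-- Boundedness of the growth factor along a degenerating direction. -/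
theorem exists_growth_le (hg : 1 ≤ g) {l₀ l : ℕ} (hl : l₀ < l) {v : Fin g → ℝ} (hv : v ≠ 0) :
    ∃ K : ℝ, 0 ≤ K ∧ ∀ M : ℝ, 0 ≤ M → ∀ u ∈ box (Sym2 (Fin g)),
      (1 + M • vecMulVec v v).PosDef ∧
      growth l₀ l (point u (1 + M • vecMulVec v v)) ≤ K / (1 + M * (v ⬝ᵥ v)) := by
  have hvv : 0 < v ⬝ᵥ v := by
    have := dotProduct_star_self_pos_iff.2 hv
    simpa using this
  set q := v ⬝ᵥ v with hq
  set A := vecMulVec v v with hA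
  set a := entrySum A with ha
  have ha0 : 0 ≤ a := entrySum_nonneg A
  set o := entrySum (1 : Matrix (Fin g) (Fin g) ℝ) with ho
  have ho0 : 0 ≤ o := entrySum_nonneg _
  set K₁ : ℝ := g ^ 6 * g * (1 + (o + a / q) * (1 + g ^ 2)) ^ 2 with hK₁
  have hK₁0 : 0 ≤ K₁ := by positivity
  refine ⟨K₁ ^ l₀, by positivity, fun M hM u hu => ?_⟩
  have hMq : 0 ≤ M * q := by positivity
  have hApsd : A.PosSemidef := by
    have := posSemidef_vecMulVec_self_star v
    rwa [star_trivial] at this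
  have hpd : (1 + M • A).PosDef := PosDef.one.add_posSemidef (hApsd.smul hM)
  refine ⟨hpd, ?_⟩
  have hAA : A * A = q • A := by
    rw [hA, vecMulVec_mul_vecMulVec, hq, vecMulVec_smul]
  have hdet : (1 + M • A).det = 1 + M * q := by
    have h1 : M • A = replicateCol Unit (M • v) * replicateRow Unit v := by
      ext i j; simp [hA, vecMulVec_apply, mul_apply, mul_assoc]
    rw [h1, det_one_add_replicateCol_mul_replicateRow, dotProduct_smul, smul_eq_mul]
  -- The Sherman–Morrison formula: the inverse stays bounded as `M` grows, while determinant and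
  -- trace grow linearly. Thus `growth` is of order `(1 + Mq)^(l₀ - l)`, and `l₀ < l` gives decay.
  have hinv : (1 + M • A)⁻¹ = 1 + -((M / (1 + M * q)) • A) := by
    apply Matrix.inv_eq_right_inv
    have h : (1 + M • A) * (1 + -((M / (1 + M * q)) • A)) =
        1 + (M - M / (1 + M * q) - M * (M / (1 + M * q)) * q) • A := by
      rw [mul_add, mul_one, mul_neg, add_mul, one_mul, Matrix.smul_mul, Matrix.mul_smul, hAA]
      module
    have h' : M - M / (1 + M * q) - M * (M / (1 + M * q)) * q = 0 := by
      field_simp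
      ring
    rw [h, h', zero_smul, add_zero]
  have hinvle : entrySum (1 + M • A)⁻¹ ≤ o + a / q := by
    rw [hinv]
    refine (entrySum_add_le _ _).trans (add_le_add le_rfl ?_)
    rw [entrySum_neg]
    have : entrySum ((M / (1 + M * q)) • A) = M / (1 + M * q) * a := by
      have h0 : 0 ≤ M / (1 + M * q) := by positivity
      simp only [ha, entrySum, Matrix.smul_apply, norm_smul, Real.norm_of_nonneg h0,
        Finset.mul_sum]
    rw [this, div_mul_eq_mul_div, div_le_div_iff₀ (by positivity) hvv]
    nlinarith
  have htr : trace (1 + M • A) ≤ g * (1 + M * q) := by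
    rw [trace_add, trace_smul, trace_one, hA, trace_vecMulVec, ← hq, Fintype.card_fin, smul_eq_mul]
    have : (1 : ℝ) ≤ g := by exact_mod_cast hg
    nlinarith
  have hre : entrySum (symMat u) ≤ (g : ℝ) ^ 2 := by
    have h1 : ∀ p, |u p| ≤ 1 := fun p => by
      have h1 := hu.1 p
      have h2 := hu.2 p
      rw [abs_le]; constructor <;> linarith
    calc entrySum (symMat u) ≤ ∑ _i : Fin g, ∑ _j : Fin g, (1 : ℝ) :=
          Finset.sum_le_sum fun i _ => Finset.sum_le_sum fun j _ => h1 _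
      _ = _ := by simp [sq]
  rw [growth, im_point, re_point, hdet]
  have hinv0 := entrySum_nonneg (1 + M • A)⁻¹
  have hre0 := entrySum_nonneg (symMat u)
  have htr0 := hpd.posSemidef.trace_nonneg
  have hbase : (g : ℝ) ^ 6 * trace (1 + M • A) *
      (1 + entrySum (1 + M • A)⁻¹ * (1 + entrySum (symMat u))) ^ 2 ≤ K₁ * (1 + M * q) := by
    calc _ ≤ (g : ℝ) ^ 6 * (g * (1 + M * q)) * (1 + (o + a / q) * (1 + g ^ 2)) ^ 2 := by gcongr
      _ = _ := by rw [hK₁]; ring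
  calc _ ≤ ((1 + M * q) ^ l)⁻¹ * (K₁ * (1 + M * q)) ^ l₀ := by gcongr
    _ ≤ K₁ ^ l₀ / (1 + M * q) := by
      rw [mul_pow, inv_mul_eq_div, div_le_div_iff₀ (by positivity) (by positivity), mul_assoc,
        ← pow_succ]
      gcongr
      · linarith
      · omega

/-- Choose `v ≠ 0` with `ᵗv T v ≤ 0` and compute the coefficient over `1 + M v ᵗv`. The exponential
weight stays below `exp(2π Tr T)` while the bound on the series decays like `1/M`. Decay, not mere
boundedness, is needed for singular semidefinite `T`, where `ᵗv T v` may be zero. -/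
theorem tubeCoeff_eq_zero (hg : 1 ≤ g) (s : HalfIntPosDef g) {l : ℕ} (hl : 2 * g ^ 2 < l)
    {n : Sym2 (Fin g) → ℤ} (hn : ¬ (halfMat fun p => (n p : ℝ)).PosDef)
    {b : Sym2 (Fin g) → ℝ} (hb : b ∈ posCone g) :
    tubeCoeff (fun ζ => poincareSeries s (2 * l) (symMat ζ)) n b = 0 := by
  set T := halfMat fun p => (n p : ℝ) with hT
  obtain ⟨v, hv, hv0⟩ : ∃ v : Fin g → ℝ, v ≠ 0 ∧ v ⬝ᵥ T *ᵥ v ≤ 0 := by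
    by_contra! hcon
    apply hn
    refine .of_dotProduct_mulVec_pos ?_ fun v hv => ?_
    · rw [IsHermitian, conjTranspose_eq_transpose_of_trivial, (halfMat_isSymm _).eq]
    · rw [star_trivial]; exact hcon v hv
  have hvv : 0 < v ⬝ᵥ v := by
    have := dotProduct_star_self_pos_iff.2 hv
    simpa using this
  obtain ⟨K, hK0, hK⟩ := exists_growth_le hg hl hv
  obtain ⟨c, hc, hc0, hle⟩ := exists_norm_cosetSummand_le hg s hl.le
  have hbound : ∀ M : ℝ, 0 ≤ M →
      ‖tubeCoeff (fun ζ => poincareSeries s (2 * l) (symMat ζ)) n b‖ ≤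
        K * (∑' q, c q) * Real.exp (2 * Real.pi * trace T) / (1 + M * (v ⬝ᵥ v)) := by
    intro M hM
    have hpd : (1 + M • vecMulVec v v).PosDef :=
      (hK M hM (fun _ => 0) ⟨fun _ => by norm_num, fun _ => by norm_num⟩).1
    obtain ⟨y, hy⟩ := exists_eq_symMat (isSymm_of_posDef hpd)
    have hyC : y ∈ posCone g := by rw [posCone, Set.mem_ofPred_eq, ← hy]; exact hpd
    rw [(isPeriodicHolo_poincareSeries hg s hl.le).tubeCoeff_eq isOpen_posCone convex_posCone n
      hb hyC]
    have hMv : 0 < 1 + M * (v ⬝ᵥ v) := by positivity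
    have hB : ∀ u ∈ box (Sym2 (Fin g)), ‖poincareSeries s (2 * l) (symMat (cvec u y))‖ ≤
        K / (1 + M * (v ⬝ᵥ v)) * ∑' q, c q := fun u hu => by
      rw [symMat_cvec, ← hy, ← tsum_mul_left]
      refine tsum_of_norm_bounded (hc.mul_left _).hasSum fun q => ?_
      exact (hle q _ (point_mem u hpd)).trans
        (mul_le_mul_of_nonneg_right (hK M hM u hu).2 (hc0 q))
    have h1 := norm_tubeCoeff_le (Φ := fun ζ => poincareSeries s (2 * l) (symMat ζ)) n hB
    have h2 : ∑ p, (n p : ℝ) * y p = trace T + M * (v ⬝ᵥ T *ᵥ v) := by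
      rw [← trace_halfMat_mul_symMat_real, ← hy, ← hT, mul_add, trace_add, mul_one,
        Matrix.mul_smul, trace_smul, Matrix.mul_vecMulVec, trace_vecMulVec, dotProduct_comm,
        smul_eq_mul]
    rw [h2] at h1
    refine h1.trans ?_
    have h3 : Real.exp (2 * Real.pi * (trace T + M * (v ⬝ᵥ T *ᵥ v))) ≤
        Real.exp (2 * Real.pi * trace T) := by
      apply Real.exp_le_exp.2
      have : M * (v ⬝ᵥ T *ᵥ v) ≤ 0 := mul_nonpos_of_nonneg_of_nonpos hM hv0
      nlinarith [Real.pi_pos]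
    have h4 : 0 ≤ ∑' q, c q := tsum_nonneg hc0
    calc _ ≤ K / (1 + M * (v ⬝ᵥ v)) * (∑' q, c q) * Real.exp (2 * Real.pi * trace T) := by gcongr
      _ = _ := by ring
  rw [← norm_le_zero_iff]
  have hlim : Tendsto (fun M : ℝ => K * (∑' q, c q) * Real.exp (2 * Real.pi * trace T) /
      (1 + M * (v ⬝ᵥ v))) atTop (𝓝 0) := by
    refine Tendsto.const_div_atTop ?_ _
    exact tendsto_atTop_add_const_left _ _ (tendsto_id.atTop_mul_const hvv)
  refine ge_of_tendsto hlim ?_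
  filter_upwards [eventually_ge_atTop 0] with M hM using hbound M hM

theorem halfMat_comp_injective {m n : Sym2 (Fin g) → ℤ}
    (h : halfMat (fun p => (m p : ℝ)) = halfMat fun p => (n p : ℝ)) : m = n := by
  ext p
  exact_mod_cast congrFun (halfMat_injective h) p

/-- The Fourier expansion of the Poincaré series. -/
theorem hasSum_poincareCoeff (hg : 1 ≤ g) (s : HalfIntPosDef g) {l : ℕ} (hl : 2 * g ^ 2 < l)
    {z : Matrix (Fin g) (Fin g) ℂ} (hz : z ∈ siegelUpperHalfSpace g) :
    HasSum (fun t : HalfIntPosDef g =>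
      poincareCoeff s (2 * l) t * e (trace (t.1.map Complex.ofReal * z)))
      (poincareSeries s (2 * l) z) := by
  obtain ⟨b₁, hb₁⟩ := exists_coord_one (g := g)
  have hb₁C : b₁ ∈ posCone g := by
    rw [posCone, Set.mem_ofPred_eq, hb₁]; exact PosDef.one
  obtain ⟨ζ, rfl⟩ := exists_eq_symMat hz.1
  have hζ : cvec (fun p => (ζ p).re) (fun p => (ζ p).im) = ζ := by
    ext p; simp [cvec, mul_comm Complex.I]
  have h := (isPeriodicHolo_poincareSeries hg s hl.le).hasSum isOpen_posCone convex_posCone hb₁C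
    (fun p => (ζ p).re) (b := fun p => (ζ p).im) (symMat_mem_iff.1 hz)
  rw [hζ] at h
  choose ψ hψ using exists_halfMat_eq (g := g)
  have hinj : Function.Injective ψ := fun t t' htt => by
    apply Subtype.ext
    rw [← hψ t, ← hψ t', htt]
  -- The sum over all integral vectors restricts to forms in `HalfIntPosDef g`, since every other
  -- index carries a zero coefficient.
  rw [← hinj.hasSum_iff] at h
  · refine h.congr_fun fun t => ?_
    rw [Function.comp_apply, poincareCoeff_eq_tubeCoeff s _ t (hψ t) hb₁, ← trace_mul_point, hψ]
  · intro n hn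
    rw [tubeCoeff_eq_zero hg s hl ?_ hb₁C, zero_mul]
    intro hpd
    apply hn
    refine ⟨⟨halfMat fun p => (n p : ℝ), hpd, fun i => ⟨n s(i, i), by simp [halfMat]⟩,
      fun i j => ?_⟩, ?_⟩
    · by_cases hij : i = j
      · exact ⟨2 * n s(i, j), by simp [halfMat, hij]⟩
      · exact ⟨n s(i, j), by simp [halfMat, hij]; ring⟩
    · exact halfMat_comp_injective (hψ _)

/-! ### Cosets with `c = 0` and the group `GL(g, ℤ)` -/

/-- The element `(a 0; 0 ᵗa⁻¹)` of the modular group. -/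
def leviEmb (a : GL (Fin g) ℤ) : Gam g :=
  ⟨fromBlocks a.1 0 0 (a⁻¹).1ᵀ, SymplecticGroup.fromBlocks_mem_iff.2
    ⟨by simp, by simp, by rw [← transpose_mul, ← Units.val_mul, inv_mul_cancel]; simp⟩⟩

/-- The coset of `(a 0; 0 ᵗa⁻¹)`. -/
def leviCoset (a : GL (Fin g) ℤ) : Cosets g := Quotient.mk _ (leviEmb a)

theorem mk_eq_mk_of_eq_mul {γ δ β : Gam g} (hβ : β ∈ gamInfty g) (h : δ = β * γ) :
    (Quotient.mk _ γ : Cosets g) = Quotient.mk _ δ := by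
  refine Quotient.sound ?_
  change (QuotientGroup.rightRel (gamInfty g)) _ _
  rw [QuotientGroup.rightRel_apply, h, mul_inv_cancel_right]
  exact hβ

theorem leviCoset_eq_iff {a b : GL (Fin g) ℤ} : leviCoset a = leviCoset b ↔ b = a ∨ b = -a := by
  constructor
  · intro h
    have h1 : (QuotientGroup.rightRel (gamInfty g)) (leviEmb a) (leviEmb b) := Quotient.exact h
    rw [QuotientGroup.rightRel_apply] at h1
    obtain ⟨S, -, hS⟩ := h1
    have h2 : (leviEmb b).1 = (leviEmb b * (leviEmb a)⁻¹).1 * (leviEmb a).1 := by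
      rw [← Submonoid.coe_mul, inv_mul_cancel_right]
    rcases hS with hS | hS
    · left
      rw [hS] at h2
      simp only [leviEmb, fromBlocks_multiply, fromBlocks_inj] at h2
      ext1
      simpa using h2.1
    · right
      rw [hS, fromBlocks_neg] at h2
      simp only [leviEmb, fromBlocks_multiply, fromBlocks_inj] at h2
      ext1
      simpa using h2.1
  · rintro (rfl | rfl)
    · rfl
    · refine mk_eq_mk_of_eq_mul (β := leviEmb (-1)) ⟨0, isSymm_zero, Or.inr ?_⟩ ?_
      · rw [fromBlocks_neg]; simp [leviEmb]
      · apply Subtype.ext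
        simp [leviEmb, fromBlocks_multiply]

/-- When `c = 0` the relations give `ᵗD A = 1`, so `A` is unimodular, and `γ` is the translation by
the symmetric matrix `B ᵗA` times `(A 0; 0 ᵗA⁻¹)`. -/
theorem exists_leviCoset_eq {γ : Gam g} (h : γ.1.toBlocks₂₁ = 0) :
    ∃ a, leviCoset a = Quotient.mk _ γ := by
  set A := γ.1.toBlocks₁₁ with hA
  set B := γ.1.toBlocks₁₂ with hB
  set D := γ.1.toBlocks₂₂ with hD
  have hγ : γ.1 = fromBlocks A B 0 D := by rw [← fromBlocks_toBlocks γ.1, h]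
  have hmem := γ.2
  rw [hγ] at hmem
  obtain ⟨-, h2, h3⟩ := SymplecticGroup.fromBlocks_mem_iff.1 hmem
  rw [transpose_zero, Matrix.zero_mul, sub_zero] at h3
  have h4 : Dᵀ * A = 1 := by rw [← transpose_transpose A, ← transpose_mul, h3, transpose_one]
  have h5 : A * Dᵀ = 1 := mul_eq_one_comm.1 h4
  have h6 : D * Aᵀ = 1 := mul_eq_one_comm.1 h3
  have hS : (B * Aᵀ).IsSymm := by
    rw [IsSymm, transpose_mul, transpose_transpose]
    calc A * Bᵀ = A * (Bᵀ * D) * Aᵀ := by rw [Matrix.mul_assoc, Matrix.mul_assoc, h6, Matrix.mul_one]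
      _ = A * Dᵀ * B * Aᵀ := by rw [h2]; simp only [Matrix.mul_assoc]
      _ = B * Aᵀ := by rw [h5, Matrix.one_mul]
  refine ⟨⟨A, Dᵀ, h5, h4⟩, mk_eq_mk_of_eq_mul (β := translation _ hS) ⟨_, hS, Or.inl rfl⟩ ?_⟩
  apply Subtype.ext
  rw [hγ]
  simp [leviEmb, translation, fromBlocks_multiply, Matrix.mul_assoc, h3]

theorem toBlocks₂₁_out_ne_zero {q : Cosets g} (h : q ∉ Set.range (leviCoset (g := g))) :
    q.out.1.toBlocks₂₁ ≠ 0 := fun h0 => by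
  obtain ⟨a, ha⟩ := exists_leviCoset_eq h0
  exact h ⟨a, ha.trans q.out_eq⟩

theorem map_intCast_transpose_mul (a : GL (Fin g) ℤ) :
    (a.1.map (Int.cast : ℤ → ℂ)) * (a⁻¹).1.map (Int.cast : ℤ → ℂ) = 1 := by
  have h : (a.1 * (a⁻¹).1).map (Int.castRingHom ℂ) = 1 := by
    rw [← Units.val_mul, mul_inv_cancel, Units.val_one]; exact Matrix.map_one _ (by simp) (by simp)
  rwa [Matrix.map_mul] at h

theorem transform_map_ofReal (a : GL (Fin g) ℤ) (s : Matrix (Fin g) (Fin g) ℝ) :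
    (transform a s).map Complex.ofReal = (a.1.map (Int.cast : ℤ → ℂ))ᵀ * s.map Complex.ofReal *
      a.1.map (Int.cast : ℤ → ℂ) := by
  have h : (a.1.map (Int.cast : ℤ → ℝ)).map Complex.ofReal = a.1.map (Int.cast : ℤ → ℂ) := by
    ext; simp
  rw [transform, map_ofReal_mul, map_ofReal_mul, h, ← h, transpose_map]

/-- Here `det(cz+d) = ±1` disappears for even `k`, and `γz = a z ᵗa`. In particular these summands
do not depend on the even weight. -/
theorem summand_leviEmb (s : HalfIntPosDef g) {k : ℕ} (hk : Even k) (a : GL (Fin g) ℤ)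
    (z : Matrix (Fin g) (Fin g) ℂ) :
    summand s k z (leviEmb a) = e (trace ((transform a s.1).map Complex.ofReal * z)) := by
  have hA : blockA (leviEmb a) = a.1.map Int.cast := rfl
  have hB : blockB (leviEmb a) = 0 := by ext; simp [blockB, leviEmb]
  have hC : blockC (leviEmb a) = 0 := by ext; simp [blockC, leviEmb]
  have hD : blockD (leviEmb a) = ((a⁻¹).1.map Int.cast)ᵀ := rfl
  have hden : denom (leviEmb a) z = ((a⁻¹).1.map (Int.cast : ℤ → ℂ))ᵀ := by
    rw [denom, hC, hD, Matrix.zero_mul, zero_add]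
  have hinv : (denom (leviEmb a) z)⁻¹ = (a.1.map (Int.cast : ℤ → ℂ))ᵀ := by
    rw [hden]
    apply Matrix.inv_eq_left_inv
    rw [← transpose_mul, mul_eq_one_comm.1 (map_intCast_transpose_mul a), transpose_one]
  have hdet : (denom (leviEmb a) z).det ^ (-(k : ℤ)) = 1 := by
    have h1 : (denom (leviEmb a) z).det = (((a⁻¹).1.det : ℤ) : ℂ) := by
      rw [hden, det_transpose]
      exact ((Int.castRingHom ℂ).map_det _).symm
    have h2 : IsUnit (a⁻¹).1.det := (Matrix.isUnit_iff_isUnit_det _).1 (a⁻¹).isUnit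
    rw [h1, _root_.zpow_neg, zpow_natCast]
    rcases Int.isUnit_iff.1 h2 with h | h
    · rw [h, Int.cast_one, one_pow, inv_one]
    · rw [h, Int.cast_neg, Int.cast_one, hk.neg_one_pow, inv_one]
  rw [summand, hdet, one_mul, act, hinv, hA, hB, add_zero, transform_map_ofReal, ← Matrix.mul_assoc,
    ← Matrix.mul_assoc, trace_mul_comm, ← Matrix.mul_assoc, ← Matrix.mul_assoc]

theorem cosetSummand_leviCoset (s : HalfIntPosDef g) {k : ℕ} (hk : Even k) (a : GL (Fin g) ℤ)
    {z : Matrix (Fin g) (Fin g) ℂ} (hz : z ∈ siegelUpperHalfSpace g) :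
    cosetSummand s k z (leviCoset a) = e (trace ((transform a s.1).map Complex.ofReal * z)) := by
  rw [leviCoset, cosetSummand_mk s hk hz, summand_leviEmb s hk]

theorem transform_posDef (a : GL (Fin g) ℤ) {s : Matrix (Fin g) (Fin g) ℝ} (hs : s.PosDef) :
    (transform a s).PosDef := by
  have hu : IsUnit (a.1.map (Int.cast : ℤ → ℝ)) := a.isUnit.map (Int.castRingHom ℝ).mapMatrix
  have h := hs.conjTranspose_mul_mul_same (B := a.1.map (Int.cast : ℤ → ℝ))
    (Matrix.mulVec_injective_of_isUnit hu)
  rwa [conjTranspose_eq_transpose_of_trivial] at h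

/-- Since `Tr(ᵗa s a S) = Tr(s · a S ᵗa)`, integrality against symmetric integral matrices is
preserved. Testing with `E_ii` and `E_ij + E_ji` then recovers half-integrality of the entries. -/
theorem exists_int_trace_transform (s : HalfIntPosDef g) (a : GL (Fin g) ℤ)
    {S : Matrix (Fin g) (Fin g) ℤ} (hS : S.IsSymm) :
    ∃ m : ℤ, trace (transform a s.1 * S.map (Int.cast : ℤ → ℝ)) = m := by
  obtain ⟨n, hn⟩ := exists_halfMat_eq s
  have hsym : (a.1 * S * a.1ᵀ).IsSymm := by
    rw [IsSymm, transpose_mul, transpose_mul, transpose_transpose, hS.eq, Matrix.mul_assoc]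
  obtain ⟨m, hm⟩ := exists_int_trace_eq n hsym
  refine ⟨m, ?_⟩
  have h1 : (a.1 * S * a.1ᵀ).map (Int.cast : ℤ → ℝ) = a.1.map (Int.cast : ℤ → ℝ) *
      S.map (Int.cast : ℤ → ℝ) * (a.1.map (Int.cast : ℤ → ℝ))ᵀ := by
    rw [map_intCast_mul, map_intCast_mul, transpose_map]
  have h2 : (a.1 * S * a.1ᵀ).map (Int.cast : ℤ → ℂ) =
      ((a.1 * S * a.1ᵀ).map (Int.cast : ℤ → ℝ)).map Complex.ofReal := by ext; simp
  rw [hn, h2, ← map_ofReal_mul] at hm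
  have h3 : trace (s.1 * (a.1 * S * a.1ᵀ).map (Int.cast : ℤ → ℝ)) = m := by
    apply Complex.ofReal_injective
    rw [Complex.ofReal_intCast, ← hm]
    simp [trace]
  rw [← h3, h1, transform, ← Matrix.mul_assoc, ← Matrix.mul_assoc, trace_mul_comm _ (_)ᵀ]
  simp only [Matrix.mul_assoc]

theorem map_intCast_single (i j : Fin g) :
    (single i j (1 : ℤ)).map (Int.cast : ℤ → ℝ) = single i j 1 := by
  ext k l
  simp only [map_apply, single_apply]
  split_ifs <;> simp

theorem exists_int_transform_diag (s : HalfIntPosDef g) (a : GL (Fin g) ℤ) (i : Fin g) :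
    ∃ n : ℤ, transform a s.1 i i = n := by
  obtain ⟨m, hm⟩ := exists_int_trace_transform s a (S := single i i 1) (by simp [IsSymm])
  refine ⟨m, ?_⟩
  have hmap : (single i i (1 : ℤ)).map (Int.cast : ℤ → ℝ) = single i i 1 :=
    map_intCast_single i i
  rw [← hm, hmap, trace_mul_single, MulOpposite.op_one, one_smul]

theorem exists_int_two_mul_transform (s : HalfIntPosDef g) (a : GL (Fin g) ℤ) (i j : Fin g) :
    ∃ n : ℤ, 2 * transform a s.1 i j = n := by
  obtain ⟨m, hm⟩ := exists_int_trace_transform s a (S := single i j 1 + single j i 1)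
    (by simp [IsSymm, add_comm])
  refine ⟨m, ?_⟩
  have hsym : transform a s.1 j i = transform a s.1 i j :=
    (isSymm_of_posDef (transform_posDef a s.2.1)).apply i j
  have hmap : (single i j (1 : ℤ) + single j i 1).map (Int.cast : ℤ → ℝ) =
      single i j 1 + single j i 1 := by
    rw [Matrix.map_add _ Int.cast_add, map_intCast_single, map_intCast_single]
  rw [← hm, hmap, mul_add, trace_add, trace_mul_single, trace_mul_single, MulOpposite.op_one,
    one_smul, one_smul, hsym, two_mul]

/-- The form `ᵗa s a` as a half-integral form. -/
noncomputable def transformForm (a : GL (Fin g) ℤ) (s : HalfIntPosDef g) : HalfIntPosDef g :=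
  ⟨transform a s.1, transform_posDef a s.2.1, exists_int_transform_diag s a,
    exists_int_two_mul_transform s a⟩

/-- Coercivity of `s` applied to `a ᵗa` bounds the sum of the squares of the entries of `a` by a
multiple of `Tr(s a ᵗa) = Tr t`; only finitely many integral matrices qualify. -/
theorem finite_transform_eq (s t : HalfIntPosDef g) :
    {a : GL (Fin g) ℤ | transform a s.1 = t.1}.Finite := by
  set K : ℝ := g ^ 4 * trace (s.1)⁻¹ * trace t.1 with hK
  set N : ℤ := ⌈K⌉ + 1 with hN
  have hfin : {M : Matrix (Fin g) (Fin g) ℤ | ∀ i j, M i j ∈ Set.Icc (-N) N}.Finite :=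
    Set.Finite.pi' fun _ => Set.Finite.pi' fun _ => Set.finite_Icc _ _
  refine (hfin.preimage (Units.val_injective (α := Matrix (Fin g) (Fin g) ℤ)).injOn).subset
    fun a ha => ?_
  intro i j
  set A := a.1.map (Int.cast : ℤ → ℝ) with hA
  have h1 := re_trace_le_of_posDef s.2.1 (posSemidef_conjTranspose_mul_self Aᵀ)
  rw [re_trace_conjTranspose_mul_self, conjTranspose_eq_transpose_of_trivial, transpose_transpose,
    ← Matrix.mul_assoc, trace_mul_comm, ← Matrix.mul_assoc] at h1
  have h2 : Aᵀ * s.1 * A = t.1 := ha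
  rw [h2] at h1
  simp only [RCLike.re_to_real] at h1
  have h3 : ‖Aᵀ j i‖ ^ 2 ≤ ∑ i, ∑ j, ‖Aᵀ i j‖ ^ 2 :=
    (Finset.single_le_sum (f := fun i => ‖Aᵀ j i‖ ^ 2) (fun _ _ => by positivity)
      (Finset.mem_univ i)).trans
    (Finset.single_le_sum (f := fun j => ∑ i, ‖Aᵀ j i‖ ^ 2) (fun _ _ => by positivity)
      (Finset.mem_univ j))
  have h4 : |(a.1 i j : ℝ)| ^ 2 ≤ K := h3.trans h1
  have h5 : |(a.1 i j : ℝ)| ≤ N := by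
    have := Int.le_ceil K
    rw [hN]; push_cast
    nlinarith [sq_nonneg (|(a.1 i j : ℝ)| - 1), abs_nonneg (a.1 i j : ℝ)]
  have h6 : |a.1 i j| ≤ N := by exact_mod_cast h5
  exact abs_le.1 h6

theorem finite_aut (s : HalfIntPosDef g) : Finite (aut s) := (finite_transform_eq s s).to_subtype

theorem transform_neg (a : GL (Fin g) ℤ) (s : Matrix (Fin g) (Fin g) ℝ) :
    transform (-a) s = transform a s := by
  have h : (-a).1.map (Int.cast : ℤ → ℝ) = -(a.1.map (Int.cast : ℤ → ℝ)) := by ext; simp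
  rw [transform, h]; simp [transform]

theorem neg_ne_self (hg : 1 ≤ g) (a : GL (Fin g) ℤ) : -a ≠ a := fun h => by
  have h1 : -a.1 = a.1 := congrArg Units.val h
  have h2 : a.1 = 0 := by
    ext i j
    have := congrFun (congrFun h1 i) j
    simp only [Matrix.neg_apply] at this
    simp only [Matrix.zero_apply]
    omega
  have h3 : a.1 * (a⁻¹).1 = 1 := by rw [← Units.val_mul, mul_inv_cancel, Units.val_one]
  rw [h2, Matrix.zero_mul] at h3
  have := congrFun (congrFun h3 ⟨0, hg⟩) ⟨0, hg⟩
  simp at this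

/-- Right multiplication by one solution `b` identifies `Aut(s)` with the set of all solutions. -/
theorem card_transform_eq (s t : HalfIntPosDef g) (h : Equivalent s t) :
    Nat.card {a : GL (Fin g) ℤ // transform a s.1 = t.1} = Nat.card (aut s) := by
  obtain ⟨b, hb⟩ := h
  refine (Nat.card_congr ((Equiv.mulRight b).subtypeEquiv fun a => ?_)).symm
  change transform a s.1 = s.1 ↔ transform (a * b) s.1 = t.1
  rw [transform_mul, ← hb]
  constructor
  · intro h; rw [h]
  · intro h
    have := congrArg (transform b⁻¹) h
    rwa [← transform_mul, ← transform_mul b, mul_inv_cancel, transform_one, transform_one] at this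

/-- The fibres of `leviCoset` are the pairs `{a, -a}`, distinct because `g ≥ 1`; this is the source
of the factor `1/2` in the limit. -/
theorem two_mul_ncard_image_leviCoset (hg : 1 ≤ g) (s t : HalfIntPosDef g) :
    2 * (leviCoset '' {a | transform a s.1 = t.1}).ncard =
      Nat.card {a : GL (Fin g) ℤ // transform a s.1 = t.1} := by
  classical
  set F := (finite_transform_eq s t).toFinset with hF
  have h1 : (leviCoset '' {a | transform a s.1 = t.1}) = (F.image leviCoset : Set (Cosets g)) := by
    simp [hF]
  have h2 : Nat.card {a : GL (Fin g) ℤ // transform a s.1 = t.1} = F.card := by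
    rw [hF, ← Set.ncard_eq_toFinset_card _ (finite_transform_eq s t)]; rfl
  rw [h1, Set.ncard_coe_finset, h2, Finset.card_eq_sum_card_image leviCoset F,
    Finset.sum_const_nat (m := 2), mul_comm]
  intro q hq
  obtain ⟨a, ha, rfl⟩ := Finset.mem_image.1 hq
  have h3 : F.filter (fun b => leviCoset b = leviCoset a) = {a, -a} := by
    ext b
    rw [Finset.mem_filter, eq_comm, leviCoset_eq_iff, Finset.mem_insert, Finset.mem_singleton]
    refine ⟨fun h => h.2, fun h => ⟨?_, h⟩⟩
    have ha' : transform a s.1 = t.1 := by simpa [hF] using ha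
    rcases h with rfl | rfl
    · exact ha
    · simpa [hF, transform_neg] using ha'
  rw [h3, Finset.card_pair (neg_ne_self hg a).symm]

/-! ### Orthogonality and the limit of the coefficients -/

section Orthogonality

variable {ι : Type*} [Fintype ι]

theorem e_half : e (1 / 2) = -1 := by
  rw [e, ← Complex.exp_pi_mul_I]
  congr 1
  ring

/-- Orthogonality of the exponentials on a slice of a tube domain. -/
theorem integral_box_e_pair_mul (m n : ι → ℤ) (b : ι → ℝ) [Decidable (m = n)] :
    ∫ u in box ι, e (pair m (cvec u b)) * e (-pair n (cvec u b)) = if m = n then 1 else 0 := by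
  split_ifs with h
  · subst h
    simp only [mul_comm (e (pair m _)), e_neg_mul_e]
    simp [volume_real_box]
  · obtain ⟨i, hi⟩ := Function.ne_iff.1 h
    have hd : (m i : ℂ) - n i ≠ 0 := sub_ne_zero.2 (by exact_mod_cast hi)
    set f : (ι → ℝ) → ℂ := fun u => e (pair m (cvec u b)) * e (-pair n (cvec u b)) with hf
    have hshift : ∀ u v : ι → ℝ, f (u + v) = f u * e (∑ j, ((m j : ℂ) - n j) * v j) := by
      intro u v
      simp only [hf, cvec_add, pair_add, neg_add, e_add]
      have : ∑ j, ((m j : ℂ) - n j) * v j =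
          pair m (fun j => (v j : ℂ)) + -pair n fun j => (v j : ℂ) := by
        rw [← sub_eq_add_neg]
        simp only [pair, sub_mul, Finset.sum_sub_distrib]
      rw [this, e_add]; ring
    have hcont : Continuous f := by
      have : Continuous fun u : ι → ℝ => cvec u b := continuous_cvec.comp (Continuous.prodMk_left b)
      exact (continuous_e.comp ((continuous_pair m).comp this)).mul
        (continuous_e.comp ((continuous_pair n).comp this).neg)
    have hper : ∀ u, ∀ l : ι → ℤ, f (u + fun j => (l j : ℝ)) = f u := fun u l => by
      rw [hshift]
      have : ∑ j, ((m j : ℂ) - n j) * ((l j : ℝ) : ℂ) = ((∑ j, (m j - n j) * l j : ℤ) : ℂ) := by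
        push_cast; rfl
      rw [this, e_intCast, mul_one]
    classical
    -- This shift multiplies the integrand by `e(1/2) = -1`, while translation invariance leaves the
    -- integral unchanged; so the integral equals its own negative.
    have h1 := integral_box_add hcont hper (Pi.single i (1 / (2 * ((m i : ℝ) - n i))))
    have h2 : ∑ j, ((m j : ℂ) - n j) *
        ((Pi.single i (1 / (2 * ((m i : ℝ) - n i))) : ι → ℝ) j : ℂ) = 1 / 2 := by
      rw [Finset.sum_eq_single i (fun j _ hj => by simp [hj]) (by simp)]
      rw [Pi.single_eq_same]
      push_cast
      field_simp
    simp only [hshift, h2, e_half, mul_neg, mul_one, integral_neg] at h1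
    exact CharZero.neg_eq_self_iff.1 h1

end Orthogonality

theorem norm_summand_eq (s : HalfIntPosDef g) (k : ℕ) (z : Matrix (Fin g) (Fin g) ℂ) (γ : Gam g) :
    ‖summand s k z γ‖ = (‖(denom γ z).det‖ ^ k)⁻¹ *
      ‖e (trace (s.1.map Complex.ofReal * act γ z))‖ := by
  rw [summand, norm_mul, _root_.zpow_neg, zpow_natCast, norm_inv, norm_pow]

/-- Monotonicity in the weight lets the majorant found at one weight dominate all larger ones,
although its constants depend on the weight. -/
theorem norm_summand_le_of_le (s : HalfIntPosDef g) {k₀ k : ℕ} (hk : k₀ ≤ k)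
    {z : Matrix (Fin g) (Fin g) ℂ} {γ : Gam g} (h : 1 ≤ ‖(denom γ z).det‖) :
    ‖summand s k z γ‖ ≤ ‖summand s k₀ z γ‖ := by
  rw [norm_summand_eq, norm_summand_eq]
  gcongr

theorem tendsto_summand_zero (s : HalfIntPosDef g) {z : Matrix (Fin g) (Fin g) ℂ} {γ : Gam g}
    (h : 1 < ‖(denom γ z).det‖) : Tendsto (fun k => summand s k z γ) atTop (𝓝 0) := by
  rw [tendsto_zero_iff_norm_tendsto_zero]
  simp only [norm_summand_eq]
  have := (tendsto_inv_atTop_zero.comp (tendsto_pow_atTop_atTop_of_one_lt h)).mul_const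
    ‖e (trace (s.1.map Complex.ofReal * act γ z))‖
  simpa using this

theorem exists_growth_point_one_le (hg : 1 ≤ g) {l₀ l : ℕ} (hl : l₀ < l) :
    ∃ K : ℝ, 0 ≤ K ∧ ∀ u ∈ box (Sym2 (Fin g)), growth l₀ l (point u 1) ≤ K := by
  have hv : (Pi.single ⟨0, hg⟩ 1 : Fin g → ℝ) ≠ 0 := by simp
  obtain ⟨K, hK0, hK⟩ := exists_growth_le hg hl hv
  refine ⟨K, hK0, fun u hu => ?_⟩
  simpa using (hK 0 le_rfl u hu).2

instance : evenAtTop.IsCountablyGenerated := by unfold evenAtTop; infer_instance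

theorem eventually_evenAtTop {P : ℕ → Prop} (l₀ : ℕ) (h : ∀ l, l₀ ≤ l → P (2 * l)) :
    ∀ᶠ k in evenAtTop, P k := by
  rw [evenAtTop, eventually_inf_principal]
  filter_upwards [eventually_ge_atTop (2 * l₀)] with k hk hev
  obtain ⟨l, rfl⟩ := hev.two_dvd
  exact h l (by omega)

instance : Countable (Cosets g) :=
  have : Countable (Matrix (Fin g) (Fin g) ℤ) := inferInstanceAs (Countable (Fin g → Fin g → ℤ))
  bottomRow_injective.countable

theorem continuous_cosetSummand_slice (s : HalfIntPosDef g) (k : ℕ) (q : Cosets g)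
    {b : Sym2 (Fin g) → ℝ} (hb : b ∈ posCone g) :
    Continuous fun u => cosetSummand s k (symMat (cvec u b)) q := by
  rw [continuous_iff_continuousAt]
  intro u
  have h1 := (differentiableAt_summand s k q.out (cvec_mem_tube hb u)).continuousAt
  have h2 : Continuous fun u : Sym2 (Fin g) → ℝ => cvec u b :=
    continuous_cvec.comp (Continuous.prodMk_left b)
  exact ContinuousAt.comp (f := fun u : Sym2 (Fin g) → ℝ => cvec u b) h1 h2.continuousAt

theorem tsum_ite_mem_eq_ncard {α : Type*} {S : Set α} (hS : S.Finite) [DecidablePred (· ∈ S)] :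
    ∑' a, (if a ∈ S then (1 : ℂ) else 0) = S.ncard := by
  rw [tsum_eq_sum (s := hS.toFinset) (fun a ha => by simpa using ha),
    Finset.sum_congr rfl (g := fun _ => (1 : ℂ)) (fun a ha => by simpa using ha),
    Finset.sum_const, Set.ncard_eq_toFinset_card _ hS, nsmul_one]

/-- The Fourier coefficients of the Poincaré series converge to the number of cosets of
block-diagonal elements carrying `s` to `t`. -/
theorem tendsto_poincareCoeff (hg : 1 ≤ g) (s t : HalfIntPosDef g) :
    Tendsto (fun k => poincareCoeff s k t) evenAtTop
      (𝓝 ((leviCoset '' {a | transform a s.1 = t.1}).ncard : ℂ)) := by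
  classical
  obtain ⟨b, hb⟩ := exists_coord_one (g := g)
  have hbC : b ∈ posCone g := by
    rw [posCone, Set.mem_ofPred_eq, hb]; exact PosDef.one
  obtain ⟨n, hn⟩ := exists_halfMat_eq t
  -- The summable majorant needs only `2 * g ^ 2`; the extra one meets the strict inequality in the
  -- bound on `growth`.
  set l₀ := 2 * g ^ 2 + 1 with hl₀
  obtain ⟨c, hc, hc0, hle⟩ := exists_norm_cosetSummand_le hg s (l := l₀) (by omega)
  obtain ⟨K, hK0, hK⟩ := exists_growth_point_one_le hg (l₀ := 2 * g ^ 2) (l := l₀) (by omega)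
  set μ := volume.restrict (box (Sym2 (Fin g))) with hμ
  have : IsFiniteMeasure μ := ⟨by
    rw [hμ, Measure.restrict_apply_univ]; exact isCompact_box.measure_lt_top⟩
  set z : (Sym2 (Fin g) → ℝ) → Matrix (Fin g) (Fin g) ℂ := fun u => symMat (cvec u b) with hz
  have hzp : ∀ u, z u = point u 1 := fun u => by rw [hz, ← hb]; exact symMat_cvec u b
  have hzmem : ∀ u, z u ∈ siegelUpperHalfSpace g := fun u => by
    rw [hzp]; exact point_mem u PosDef.one
  have hbox : ∀ᵐ u ∂μ, u ∈ box (Sym2 (Fin g)) :=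
    ae_restrict_mem isCompact_box.measurableSet
  set E : (Sym2 (Fin g) → ℝ) → ℂ := fun u => e (-pair n (cvec u b)) with hE
  have hEc : Continuous E := continuous_e.comp
    ((continuous_pair n).comp (continuous_cvec.comp (Continuous.prodMk_left b))).neg
  set R : ℝ := Real.exp (2 * Real.pi * ∑ p, n p * b p) with hR
  have hER : ∀ u, ‖E u‖ = R := fun u => by
    rw [hE, norm_e, Complex.neg_im, im_pair_cvec, mul_neg, neg_neg]
  have hbound : ∀ k, 2 * l₀ ≤ k → ∀ u ∈ box (Sym2 (Fin g)), ∀ q,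
      ‖cosetSummand s k (z u) q‖ ≤ K * c q := fun k hk u hu q => by
    refine (norm_summand_le_of_le s hk ?_).trans ((hle q _ (hzmem u)).trans
      (mul_le_mul_of_nonneg_right (by rw [hzp]; exact hK u hu) (hc0 q)))
    rw [hzp]
    exact one_le_norm_det_denom _ u
  -- The pointwise limit of the summands: terms with `c = 0` are constant along even weights, so any
  -- even weight may be used to write them, and the others tend to zero for almost every `u`.
  set L : Cosets g → (Sym2 (Fin g) → ℝ) → ℂ := fun q u =>
    if q ∈ Set.range (leviCoset (g := g)) then cosetSummand s (2 * l₀) (z u) q else 0 with hL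
  have hLbound : ∀ u ∈ box (Sym2 (Fin g)), ∀ q, ‖L q u‖ ≤ K * c q := fun u hu q => by
    simp only [hL]
    split_ifs
    · exact hbound _ le_rfl u hu q
    · rw [norm_zero]; exact mul_nonneg hK0 (hc0 q)
  have hLc : ∀ q, Continuous (L q) := fun q => by
    simp only [hL]
    split_ifs
    · exact continuous_cosetSummand_slice s _ q hbC
    · exact continuous_const
  have hlim : ∀ᵐ u ∂μ, ∀ q, Tendsto (fun k => cosetSummand s k (z u) q) evenAtTop
      (𝓝 (L q u)) := by
    rw [ae_all_iff]
    intro q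
    by_cases hq : q ∈ Set.range (leviCoset (g := g))
    · refine Eventually.of_forall fun u => ?_
      simp only [hL, if_pos hq]
      obtain ⟨a, rfl⟩ := hq
      refine tendsto_const_nhds.congr' ?_
      refine eventually_evenAtTop 0 fun l _ => ?_
      simp only [cosetSummand_leviCoset s (even_two_mul _) a (hzmem u)]
    · filter_upwards [ae_restrict_of_ae
        (ae_one_lt_norm_det_denom q.out (toBlocks₂₁_out_ne_zero hq))] with u hu
      simp only [hL, if_neg hq]
      refine (tendsto_summand_zero s ?_).mono_left inf_le_left
      rw [hzp]; exact hu
  have hLE : HasSum (fun q => ∫ u, L q u * E u ∂μ) (∫ u, (∑' q, L q u) * E u ∂μ) := by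
    refine hasSum_integral_of_dominated_convergence (fun q _ => K * c q * R)
      (fun q => ((hLc q).mul hEc).aestronglyMeasurable) (fun q => ?_)
      (Eventually.of_forall fun _ => (hc.mul_left K).mul_right R) (integrable_const _) ?_
    · filter_upwards [hbox] with u hu
      rw [norm_mul, hER]
      exact mul_le_mul_of_nonneg_right (hLbound u hu q) (Real.exp_pos _).le
    · filter_upwards [hbox] with u hu
      exact (Summable.of_norm_bounded (hc.mul_left K) (hLbound u hu)).hasSum.mul_right _
  have hint : ∀ q, ∫ u, L q u * E u ∂μ =
      if q ∈ leviCoset '' {a | transform a s.1 = t.1} then 1 else 0 := by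
    intro q
    by_cases hq : q ∈ Set.range (leviCoset (g := g))
    · obtain ⟨a, rfl⟩ := hq
      obtain ⟨m, hm⟩ := exists_halfMat_eq (transformForm a s)
      have hm' : halfMat (fun p => (m p : ℝ)) = transform a s.1 := hm
      have h1 : ∀ u, L (leviCoset a) u = e (pair m (cvec u b)) := fun u => by
        simp only [hL, Set.mem_range_self, if_true]
        rw [cosetSummand_leviCoset s (even_two_mul _) a (hzmem u), ← hm', trace_mul_point]
      simp only [h1, hE]
      rw [integral_box_e_pair_mul]
      refine if_congr ?_ rfl rfl
      constructor
      · rintro rfl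
        exact ⟨a, hm'.symm.trans hn, rfl⟩
      · rintro ⟨a', ha', h2⟩
        refine halfMat_comp_injective ?_
        rw [hm', hn, ← show transform a' s.1 = t.1 from ha']
        rcases leviCoset_eq_iff.1 h2 with rfl | rfl
        · rfl
        · exact transform_neg _ _
    · have h1 : ∀ u, L q u = 0 := fun u => by simp only [hL, if_neg hq]
      simp only [h1, zero_mul, integral_zero]
      rw [if_neg]
      rintro ⟨a, -, rfl⟩
      exact hq ⟨a, rfl⟩
  have hvalue : ∫ u, (∑' q, L q u) * E u ∂μ =
      ((leviCoset '' {a | transform a s.1 = t.1}).ncard : ℂ) := by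
    rw [← hLE.tsum_eq, funext hint, tsum_ite_mem_eq_ncard ((finite_transform_eq s t).image _)]
  rw [← hvalue]
  simp only [fun k => poincareCoeff_eq_tubeCoeff s k t hn hb, tubeCoeff]
  -- Dominated convergence is used twice with the same majorant: for the integral here, and for the
  -- sum over cosets at almost every `u` below.
  refine tendsto_integral_filter_of_dominated_convergence (fun _ => (∑' q, K * c q) * R) ?_ ?_
    (integrable_const _) ?_
  · refine eventually_evenAtTop l₀ fun l hl => ?_
    exact (((isPeriodicHolo_poincareSeries hg s (l := l) (by omega)).continuous_slice hbC).mul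
      hEc).aestronglyMeasurable
  · refine eventually_evenAtTop l₀ fun l hl => ?_
    filter_upwards [hbox] with u hu
    rw [norm_mul]
    refine mul_le_mul ?_ (hER u).le (norm_nonneg _)
      (tsum_nonneg fun q => mul_nonneg hK0 (hc0 q))
    exact tsum_of_norm_bounded (hc.mul_left K).hasSum (hbound _ (by omega) u hu)
  · filter_upwards [hlim, hbox] with u hu hu'
    refine Tendsto.mul_const _ ?_
    refine tendsto_tsum_of_dominated_convergence (hc.mul_left K) hu ?_
    exact eventually_evenAtTop l₀ fun l hl => hbound _ (by omega) u hu'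

end SiegelPoincare

end

open SiegelPoincare in
theorem theorem3p1 (g : ℕ) (hg : 1 ≤ g) (s : HalfIntPosDef g) :
    (∀ᶠ k in evenAtTop, ∀ z ∈ siegelUpperHalfSpace g,
      Summable (fun q : Cosets g => ‖cosetSummand s k z q‖) ∧
      HasSum (fun t : HalfIntPosDef g =>
        poincareCoeff s k t * e (Matrix.trace (t.1.map Complex.ofReal * z)))
        (poincareSeries s k z)) ∧
    Finite (aut s) ∧
    ∀ t : HalfIntPosDef g,
      (Equivalent s t →
        Filter.Tendsto (fun k : ℕ => poincareCoeff s k t) evenAtTop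
          (nhds ((Nat.card (aut s) : ℂ) / 2))) ∧
      (¬ Equivalent s t →
        Filter.Tendsto (fun k : ℕ => poincareCoeff s k t) evenAtTop (nhds 0)) := by
  refine ⟨eventually_evenAtTop (2 * g ^ 2 + 1) fun l hl z hz =>
    ⟨summable_cosetSummand hg s (by omega) hz, hasSum_poincareCoeff hg s (by omega) hz⟩,
    finite_aut s, fun t => ⟨fun h => ?_, fun h => ?_⟩⟩
  · convert tendsto_poincareCoeff hg s t using 2
    -- The limit is a number of cosets; doubling it counts the solutions `a`, as many as there are
    -- elements of `Aut(s)`.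
    rw [← card_transform_eq s t h, ← two_mul_ncard_image_leviCoset hg s t]
    push_cast
    ring
  · convert tendsto_poincareCoeff hg s t using 2
    have : {a : GL (Fin g) ℤ | transform a s.1 = t.1} = ∅ :=
      Set.eq_empty_of_forall_notMem fun a ha => h ⟨a, ha⟩
    simp [this]
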